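/- **Setting.** Let $\Omega\subset\mathbb C$ be either a discrete set without accumulation points in $\mathbb C$, or a finite union of pairwise disjoint oriented simple piecewise $C^1$ contours, each of which is closed or extends to infinity in both directions. Let $\mu$ be the counting measure on $\Omega$ in the first case and $d\mu=dz$ in the second case, and let $L^2(\Omega)$ be $\ell^2(\Omega)$, respectively $L^2(\Omega,|dz|)$. Fix $1\le n\le m$ and consider the $3m$ real parameters $p=(x^{(i)}_\ell)_{1\le i\le m,\ \ell=1,2,3}$. Put $$\Delta(z)=\Delta(z\mid p)=\mathrm{diag}\big(e^{x^{(1)}_3z^3+x^{(1)}_2z^2+x^{(1)}_1z},\dots,e^{x^{(m)}_3z^3+x^{(m)}_2z^2+x^{(m)}_1z},1\big).$$ Let $F,G:\Omega\to\mathbb C^{m+1}$ be functions not depending on $p$ with $F_a(u)G_a(u)=0$ for all $u\in\Omega$ and $a=1,\dots,m+1$, let $c=c(u\mid p)$ be a non-vanishing scalar function on $\Omega$, which may depend on $p$, and put $f=c\,\Delta F$, $g=c^{-1}\Delta^{-1}G$. One says that the bounded operator $H=H_p$ on $L^2(\Omega)$ is *cubic integrable* with data $(c,F,G)$ if the entries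 of $f$ and $g$ lie in $L^2\cap L^\infty$ and $H$ is the integral operator with kernel $f(u)^Tg(v)/(u-v)$ for $u\ne v$, and $0$ for $u=v$, with respect to $d\mu(v)$ (understood as a principal value where it does not converge absolutely). Let $U\subset\mathbb R^{3m}$ be open, and suppose that for every $p\in U$ the operator $H_p$ is cubic integrable with data $(c(\cdot\mid p),F,G)$ and $1-H_p$ is invertible. If $c$ depends on $p$, its dependence is assumed to be regular in the following sense: every $p_0\in U$ has a neighbourhood on which one can use a parameter-independent scalar $d(u)$ instead, meaning that for all $p$ in the neighbourhood there is a cubic integrable operator with data $(d,F,G)$ at $p$, its difference from $1$ is invertible, and $d/c(\cdot\mid p)$ or $c(\cdot\mid p)/d$ is bounded on $\Omega$. (If $c$ does not depend on $p$, this holds with $d=c$.) For $k\ge1$ let $$Y_k(p)=\int_\Omega u^{k-1}\big((1-H)^{-1}f\big)(u)\,g(u)^T\,d\mu(u),$$ an $(m+1)\times(m+1)$ matrix, and let $q_k$ be its upper left $n\times n$ block. Consider formal pseudo-differential operators $\sum_{k\le N}a_k\partial^k$ with $n\times n$ matrix-valued coefficients depending on $p$, where $\partial=\sum_{j=1}^n\partial/\partial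 x^{(j)}_1$ and the product is given by $(a\partial^i)(b\partial^j)=\sum_{r\ge0}\binom ir a(\partial^rb)\partial^{i+j-r}$. Let $$P=I_n+\sum_{k\ge1}q_k\,\partial^{-k},\qquad D^{(i)}_\ell=\big(P E_i\partial^\ell P^{-1}\big)_+,\qquad 1\le i\le n,\ \ell\in\{1,2,3\},$$ where $E_i$ is the $n\times n$ matrix whose only nonzero entry is a $1$ in position $(i,i)$, and $(\cdot)_+$ is the part with non-negative powers of $\partial$. **Claim.** The integrals defining the blocks $q_k$ converge absolutely for $p\in U$, the $q_k$ are smooth functions on $U$, and $P$ has an inverse $P^{-1}$ among the pseudo-differential operators with coefficients smooth on $U$. On $U$, the Sato equations $$\frac{\partial P}{\partial x^{(i)}_\ell}=D^{(i)}_\ell P-P E_i\partial^\ell,\qquad 1\le i\le n,\ \ell\in\{1,2,3\},$$ hold, and so do the Zakharov–Shabat equations of the $n$-component KP hierarchy $$\frac{\partial D^{(i)}_\ell}{\partial x^{(j)}_{\ell'}}-\frac{\partial D^{(j)}_{\ell'}}{\partial x^{(i)}_{\ell}}=\big[D^{(j)}_{\ell'},D^{(i)}_\ell\big],\qquad 1\le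 i,j\le n,\ \ell,\ell'\in\{1,2,3\},$$ where the parameter derivatives act on the coefficients. -/

import Mathlib

open MeasureTheory Filter Topology Set
open scoped ENNReal ContDiff

noncomputable section

namespace CubicKP

/-! ### Contours, discrete sets and the spaces `L²(Ω)` -/

/-- A continuous curve which is piecewise `C¹` with nonvanishing derivative: there is a locally
finite set `S` of corners, off which the curve is `C¹` with nonzero derivative and at which the
derivative has nonzero one-sided limits. -/
def IsPiecewiseRegular (γ : ℝ → ℂ) : Prop :=
  Continuous γ ∧ ∃ S : Set ℝ, (∀ a b : ℝ, (S ∩ Icc a b).Finite) ∧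
    (∀ t, t ∉ S → ContDiffAt ℝ 1 γ t ∧ deriv γ t ≠ 0) ∧
    ∀ t ∈ S, (∃ l : ℂ, l ≠ 0 ∧ Tendsto (deriv γ) (𝓝[<] t) (𝓝 l)) ∧
      ∃ r : ℂ, r ≠ 0 ∧ Tendsto (deriv γ) (𝓝[>] t) (𝓝 r)

/-- An oriented simple contour without endpoints: either closed (a periodic parametrization, run
through once on `[0, T)`), or extending to infinity in both directions. -/
structure SimpleContour where
  toFun : ℝ → ℂ
  regular : IsPiecewiseRegular toFun
  dom : Set ℝ
  closed_or_infinite :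
    (∃ T : ℝ, 0 < T ∧ dom = Ico 0 T ∧ Function.Periodic toFun T) ∨
      (dom = univ ∧ Tendsto toFun (cocompact ℝ) (cocompact ℂ))
  simple : InjOn toFun dom

/-- The set of points of a contour. -/
def SimpleContour.trace (γ : SimpleContour) : Set ℂ := γ.toFun '' γ.dom

/-- The arc length measure `|dz|` of a contour. -/
def SimpleContour.arcLength (γ : SimpleContour) : Measure ℂ :=
  Measure.map γ.toFun ((volume.restrict γ.dom).withDensity fun t => ‖deriv γ.toFun t‖ₑ)

/-- The unit tangent `γ'/|γ'|` as a function of the point of the contour (`0` off the contour; the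
sum has at most one term). -/
def SimpleContour.tangent (γ : SimpleContour) (z : ℂ) : ℂ :=
  ∑ᶠ (t : ℝ) (_ : t ∈ γ.dom ∧ γ.toFun t = z), deriv γ.toFun t / (‖deriv γ.toFun t‖ : ℂ)

theorem SimpleContour.tangent_apply (γ : SimpleContour) {t : ℝ} (ht : t ∈ γ.dom) :
    γ.tangent (γ.toFun t) = deriv γ.toFun t / (‖deriv γ.toFun t‖ : ℂ) := by
  classical
  unfold SimpleContour.tangent
  rw [finsum_eq_single _ t]
  · rw [finsum_eq_if]
    simp [ht]
  · intro s hs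
    rw [finsum_eq_if]
    split_ifs with h
    · exact absurd (γ.simple h.1 ht h.2) hs
    · rfl

/-- The admissible sets `Ω ⊂ ℂ`: a discrete set without accumulation points in `ℂ`, or a finite
union of pairwise disjoint simple contours, each closed or extending to infinity. -/
inductive Locus where
  | discrete (S : Set ℂ) (hS : ∀ R : ℝ, (S ∩ Metric.closedBall 0 R).Finite)
  | contours (N : ℕ) (γ : Fin N → SimpleContour)
      (hγ : Pairwise fun i j => Disjoint (γ i).trace (γ j).trace)

/-- The underlying set of points. -/
def Locus.carrier : Locus → Set ℂ
  | .discrete S _ => S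
  | .contours _ γ _ => ⋃ i, (γ i).trace

/-- The positive measure defining `L²(Ω)`: counting measure on a discrete set, arc length on
contours. -/
def Locus.measure : Locus → Measure ℂ
  | .discrete S _ => Measure.count.restrict S
  | .contours _ γ _ => ∑ i, (γ i).arcLength

/-- The density of `dμ` with respect to `Locus.measure`: `dμ` is the counting measure on a discrete
set, and `dμ = dz = γ'/|γ'| |dz|` on contours. -/
def Locus.density : Locus → ℂ → ℂ
  | .discrete _ _ => fun _ => 1
  | .contours _ γ _ => fun z => ∑ i, (γ i).tangent z

/-- The Hilbert space `L²(Ω)`. -/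
abbrev Locus.L2 (Ω : Locus) : Type := Lp ℂ 2 Ω.measure

/-- The class in `L²(Ω)` of a square integrable function (and `0` otherwise). -/
def Locus.toL2 (Ω : Locus) (φ : ℂ → ℂ) : Ω.L2 :=
  open Classical in if h : MemLp φ 2 Ω.measure then h.toLp φ else 0

/-- `H` is the integral operator `(Hφ)(u) = ∫_Ω K(u,v) φ(v) dμ(v)`, the integral being understood as
a Cauchy principal value at `v = u` (so that it is the ordinary integral whenever the latter
converges absolutely; on a discrete set it is the sum over `v ≠ u`). -/
def Locus.HasKernel (Ω : Locus) (H : Ω.L2 →L[ℂ] Ω.L2) (K : ℂ → ℂ → ℂ) : Prop :=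
  ∀ φ : Ω.L2, ∀ᵐ u ∂Ω.measure,
    Tendsto (fun ε : ℝ => ∫ v in {v | ε < dist u v}, K u v * φ v * Ω.density v ∂Ω.measure)
      (𝓝[>] 0) (𝓝 (H φ u))

/-! ### Cubic integrable operators -/

/-- The `3m` real parameters `p ℓ j`, where `ℓ = 0, 1, 2` stands for `x_1, x_2, x_3`, that is for
the variables `x_j`, `y_j`, `t_j`. -/
abbrev Params (m : ℕ) : Type := Fin 3 → Fin m → ℝ

/-- The diagonal entries `exp(t_j z³ + y_j z² + x_j z)`, `j = 1, …, m`, and `1` of `Δ(z)`. -/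
def dressing {m : ℕ} (p : Params m) (z : ℂ) : Fin (m + 1) → ℂ :=
  Fin.snoc (fun j : Fin m =>
    Complex.exp ((p 2 j : ℂ) * z ^ 3 + (p 1 j : ℂ) * z ^ 2 + (p 0 j : ℂ) * z)) 1

/-- `f = c Δ F`. -/
def vecf {m : ℕ} (c : ℂ → ℂ) (F : ℂ → Fin (m + 1) → ℂ) (p : Params m) (u : ℂ)
    (a : Fin (m + 1)) : ℂ :=
  c u * dressing p u a * F u a

/-- `g = c⁻¹ Δ⁻¹ G`. -/
def vecg {m : ℕ} (c : ℂ → ℂ) (G : ℂ → Fin (m + 1) → ℂ) (p : Params m) (u : ℂ)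
    (a : Fin (m + 1)) : ℂ :=
  (c u)⁻¹ * (dressing p u a)⁻¹ * G u a

/-- The kernel `f(u)ᵀ g(v) / (u - v)` for `u ≠ v`, and `0` for `u = v`. -/
def iiksKernel {ι : Type} [Fintype ι] (f g : ℂ → ι → ℂ) (u v : ℂ) : ℂ :=
  open Classical in if u = v then 0 else (∑ a, f u a * g v a) / (u - v)

/-- `H` is the cubic integrable operator on `L²(Ω)` with data `c, F, G` at the parameter `p`. -/
structure IsCubicIntegrable {m : ℕ} (Ω : Locus) (F G : ℂ → Fin (m + 1) → ℂ) (c : ℂ → ℂ)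
    (p : Params m) (H : Ω.L2 →L[ℂ] Ω.L2) : Prop where
  c_ne_zero : ∀ u ∈ Ω.carrier, c u ≠ 0
  c_measurable : AEStronglyMeasurable c Ω.measure
  /-- `F(u)ᵀ E_a G(u) = 0` for every `a`. -/
  orthogonal : ∀ u ∈ Ω.carrier, ∀ a, F u a * G u a = 0
  f_memL2 : ∀ a, MemLp (fun u => vecf c F p u a) 2 Ω.measure
  f_memLinfty : ∀ a, MemLp (fun u => vecf c F p u a) ∞ Ω.measure
  g_memL2 : ∀ a, MemLp (fun u => vecg c G p u a) 2 Ω.measure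
  g_memLinfty : ∀ a, MemLp (fun u => vecg c G p u a) ∞ Ω.measure
  hasKernel : Ω.HasKernel H (iiksKernel (vecf c F p) (vecg c G p))

/-- Regularity in the parameters `p ∈ U` of the scalar `c`: near every `p₀ ∈ U` one can use a
scalar `d` that does not depend on the parameters, for which the operator is still cubic integrable
with `1 - H` invertible, and which is comparable to `c` in the sense that `d / c` or `c / d` is
bounded on `Ω`. If `c` does not depend on `p`, then `d = c` does. -/
def ScalarRegular {m : ℕ} (Ω : Locus) (F G : ℂ → Fin (m + 1) → ℂ) (c : Params m → ℂ → ℂ)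
    (U : Set (Params m)) : Prop :=
  ∀ p₀ ∈ U, ∃ V ∈ 𝓝 p₀, ∃ d : ℂ → ℂ, ∀ p ∈ V,
    (∃ H : Ω.L2 →L[ℂ] Ω.L2, IsCubicIntegrable Ω F G d p H ∧ IsUnit (1 - H)) ∧
    ((∃ C : ℝ, ∀ u ∈ Ω.carrier, ‖d u‖ ≤ C * ‖c p u‖) ∨
      ∃ C : ℝ, ∀ u ∈ Ω.carrier, ‖c p u‖ ≤ C * ‖d u‖)

/-- The integrand `u^(k-1) ((1 - H)⁻¹ f)_a(u) g_b(u)` of the `(a,b)` entry of `Y_k`, with the density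
of `dμ` included. -/
def integrandY {m : ℕ} (Ω : Locus) (F G : ℂ → Fin (m + 1) → ℂ) (c : Params m → ℂ → ℂ)
    (H : Params m → Ω.L2 →L[ℂ] Ω.L2) (k : ℕ) (p : Params m) (a b : Fin (m + 1)) (u : ℂ) : ℂ :=
  u ^ (k - 1) * Ring.inverse (1 - H p) (Ω.toL2 fun v => vecf (c p) F p v a) u *
    vecg (c p) G p u b * Ω.density u

/-- The matrix `Y_k = ∫_Ω u^(k-1) ((1 - H)⁻¹ f)(u) g(u)ᵀ dμ(u)`, `k ≥ 1`. -/
def matY {m : ℕ} (Ω : Locus) (F G : ℂ → Fin (m + 1) → ℂ) (c : Params m → ℂ → ℂ)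
    (H : Params m → Ω.L2 →L[ℂ] Ω.L2) (k : ℕ) (p : Params m) :
    Matrix (Fin (m + 1)) (Fin (m + 1)) ℂ :=
  Matrix.of fun a b => ∫ u, integrandY Ω F G c H k p a b u ∂Ω.measure

/-- The index in `{1, …, m+1}` of the `i`-th element of `{1, …, n}`, `n ≤ m`. -/
def blockIdx {m n : ℕ} (hn : n ≤ m) (i : Fin n) : Fin (m + 1) := (Fin.castLE hn i).castSucc

/-- The upper left `n × n` block `q_k` of `Y_k`. -/
def matq {m n : ℕ} (hn : n ≤ m) (Ω : Locus) (F G : ℂ → Fin (m + 1) → ℂ) (c : Params m → ℂ → ℂ)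
    (H : Params m → Ω.L2 →L[ℂ] Ω.L2) (k : ℕ) (p : Params m) : Matrix (Fin n) (Fin n) ℂ :=
  (matY Ω F G c H k p).submatrix (blockIdx hn) (blockIdx hn)

/-! ### Matrix-valued pseudo-differential operators -/

/-- Matrix-valued functions of the parameters. -/
abbrev MatFun (m n : ℕ) : Type := Params m → Matrix (Fin n) (Fin n) ℂ

/-- Entrywise partial derivative with respect to `p ℓ i`. -/
def partialDeriv {m n : ℕ} (ℓ : Fin 3) (i : Fin m) (A : MatFun m n) : MatFun m n :=
  fun p => Matrix.of fun a b =>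
    lineDeriv ℝ (fun p' => A p' a b) p (Pi.single ℓ (Pi.single i 1))

/-- Entrywise smoothness on `U`. -/
def SmoothMatOn {m n : ℕ} (U : Set (Params m)) (A : MatFun m n) : Prop :=
  ∀ a b, ContDiffOn ℝ ∞ (fun p => A p a b) U

/-- The derivation `∂ = ∑_{j ≤ n} ∂/∂x_1^{(j)}` on matrix-valued functions. -/
def dX {m n : ℕ} (hn : n ≤ m) (A : MatFun m n) : MatFun m n :=
  ∑ j : Fin n, partialDeriv 0 (Fin.castLE hn j) A

theorem partialDeriv_zero {m n : ℕ} (ℓ : Fin 3) (i : Fin m) :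
    partialDeriv ℓ i (0 : MatFun m n) = 0 := by
  funext p
  ext a b
  simp [partialDeriv, lineDeriv]

theorem dX_iterate_zero {m n : ℕ} (hn : n ≤ m) (r : ℕ) :
    (dX hn)^[r] (0 : MatFun m n) = 0 := by
  induction r with
  | zero => rfl
  | succ r ih => rw [Function.iterate_succ_apply', ih]; simp [dX, partialDeriv_zero]

/-- Formal pseudo-differential operators `∑_{k ≤ N} a_k ∂^k` with matrix-valued coefficients, where
`∂ = ∑_{j ≤ n} ∂/∂x_1^{(j)}`; `coeff k` is the coefficient `a_k`. -/
@[ext]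
structure PseudoDiffOp {m n : ℕ} (hn : n ≤ m) where
  coeff : ℤ → MatFun m n
  bounded : ∃ N : ℤ, ∀ k, N < k → coeff k = 0

namespace PseudoDiffOp

variable {m n : ℕ} {hn : n ≤ m}

/-- `a ∂^s` for a constant matrix `a`. -/
def monomial (a : Matrix (Fin n) (Fin n) ℂ) (s : ℤ) : PseudoDiffOp hn where
  coeff k := if k = s then fun _ => a else 0
  bounded := ⟨s, fun k hk => if_neg hk.ne'⟩

instance : One (PseudoDiffOp hn) := ⟨monomial 1 0⟩

instance : Sub (PseudoDiffOp hn) where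
  sub A B :=
    { coeff := fun k => A.coeff k - B.coeff k
      bounded := by
        obtain ⟨N, hN⟩ := A.bounded
        obtain ⟨M, hM⟩ := B.bounded
        refine ⟨max N M, fun k hk => ?_⟩
        rw [hN k (lt_of_le_of_lt (le_max_left _ _) hk),
          hM k (lt_of_le_of_lt (le_max_right _ _) hk), sub_zero] }

/-- Composition, given by the generalized Leibniz rule
`(a ∂^i)(b ∂^j) = ∑_{r ≥ 0} binom(i, r) a (∂^r b) ∂^(i + j - r)`; each coefficient is a finite
sum. -/
instance : Mul (PseudoDiffOp hn) where
  mul A B :=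
    { coeff := fun k p => ∑ᶠ s : ℤ × ℕ,
        Ring.choose s.1 s.2 • (A.coeff s.1 p * ((dX hn)^[s.2] (B.coeff (k - s.1 + s.2))) p)
      bounded := by
        obtain ⟨N, hN⟩ := A.bounded
        obtain ⟨M, hM⟩ := B.bounded
        refine ⟨N + M, fun k hk => ?_⟩
        funext p
        refine finsum_eq_zero_of_forall_eq_zero fun s => ?_
        by_cases h : N < s.1
        · simp [hN _ h]
        · have h2 : M < k - s.1 + s.2 := by
            have := Int.natCast_nonneg s.2
            omega
          simp [hM _ h2, dX_iterate_zero] }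

/-- The part with non-negative powers of `∂`. -/
def pos (A : PseudoDiffOp hn) : PseudoDiffOp hn where
  coeff k := if 0 ≤ k then A.coeff k else 0
  bounded := by
    obtain ⟨N, hN⟩ := A.bounded
    exact ⟨N, fun k hk => by simp [hN k hk]⟩

/-- The coefficientwise derivative `∂A/∂x_ℓ^{(i)}` (with `ℓ` counted from `0`). -/
def paramDeriv (ℓ : Fin 3) (i : Fin n) (A : PseudoDiffOp hn) : PseudoDiffOp hn where
  coeff k := partialDeriv ℓ (Fin.castLE hn i) (A.coeff k)
  bounded := by
    obtain ⟨N, hN⟩ := A.bounded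
    exact ⟨N, fun k hk => by rw [hN k hk, partialDeriv_zero]⟩

/-- `I + ∑_{k ≥ 1} q_k ∂^(-k)`. -/
def ofSeq (q : ℕ → MatFun m n) : PseudoDiffOp hn where
  coeff k := if k = 0 then fun _ => 1 else if k < 0 then q k.natAbs else 0
  bounded := ⟨0, fun _ hk => by rw [if_neg hk.ne', if_neg (not_lt.mpr hk.le)]⟩

/-- Equality of the coefficients on `U`. -/
def EqOn (U : Set (Params m)) (A B : PseudoDiffOp hn) : Prop :=
  ∀ k, ∀ p ∈ U, A.coeff k p = B.coeff k p

/-- `Q` is the inverse of `P` among the pseudo-differential operators with coefficients that are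
smooth on `U`. -/
def IsInverseOn (U : Set (Params m)) (P Q : PseudoDiffOp hn) : Prop :=
  (∀ k, SmoothMatOn U (Q.coeff k)) ∧ EqOn U (P * Q) 1 ∧ EqOn U (Q * P) 1

/-- `E_i ∂^ℓ`, where `E_i` is the `i`-th diagonal matrix unit and `ℓ = 1, 2, 3` is counted from
`0`. -/
def unitPow (ℓ : Fin 3) (i : Fin n) : PseudoDiffOp hn :=
  monomial (Matrix.single i i 1) (((ℓ : ℕ) : ℤ) + 1)

/-- `D_ℓ^{(i)} = (P E_i ∂^ℓ P⁻¹)_+`, with `Q = P⁻¹`. -/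
def laxOp (P Q : PseudoDiffOp hn) (ℓ : Fin 3) (i : Fin n) : PseudoDiffOp hn :=
  (P * unitPow ℓ i * Q).pos

end PseudoDiffOp

end CubicKP

end

/-! The equations come from a closed algebra of moments. Put M_{r,s} = ∫ u^s ((1-H)⁻¹ u^r f)(u)
g(u)ᵀ dμ(u), cut down to the n × n block, so that q_{s+1} = M_{0,s}. Differentiating the
exponentials in the kernel of H produces (u^ℓ - v^ℓ)/(u - v), which cancels the singularity:
∂H/∂x_ℓ^{(i)} is the finite rank operator with kernel ∑_{a+b=ℓ-1} u^b f_i(u) v^a g_i(v). The product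
rule gives ∂M_{r,s}/∂x_ℓ^{(i)} = E_i M_{r+ℓ,s} - M_{r,s+ℓ} E_i + ∑_{a+b=ℓ-1} M_{r,a} E_i M_{b,s}
(`hasFDerivAt_moment`). The right-hand side is polynomial in moments, so all moments are smooth, and
for i ≤ n it stays inside the n × n block.

Algebra. Summing the case ℓ = 1 over i gives ∂M_{r,s} = M_{r+1,s} - M_{r,s+1} + M_{r,0} M_{0,s}.
Equivalently, the operators W_r = ∂^r + ∑_{k≥1} M_{r,k-1} ∂^{-k} satisfy W_{r+1} = ∂ W_r - M_{r,0}
W_0. As W_0 = P, each W_r is a differential operator times P. The derivative law with r = 0 says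
that ∂P/∂x_ℓ^{(i)} + P E_i ∂^ℓ is E_i W_ℓ + ∑ M_{0,a} E_i W_b, hence D P with D differential. Since
(∂P/∂x_ℓ^{(i)}) P⁻¹ has negative order, D is the positive part of P E_i ∂^ℓ P⁻¹: this is the Sato
equation (`PDO.sato`). Cross-differentiation yields Zakharov–Shabat (`zakharovShabat_of_sato`). The
calculus needs an associative ring on which derivations obey Leibniz, so it is carried out over the
ring of smooth matrix functions on an open set and transferred back by `PseudoDiffOp.Rep`.

Analysis. Square integrability of f and g is only given without polynomial factors, but on an open
set of parameters. Moving the parameters by ±2ε multiplies |f_j| and |g_j| by exp(2ε ∑_ℓ |Re u^ℓ|)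
for suitable signs, and this weight beats every power of |u|, because |u|² = 2 (Re u)² - Re(u²). So
all powers are allowed, and second order Taylor remainders are dominated in L²
(`exists_dominating`). For H the remainder kernel is bounded by ‖δ‖² α(u) β(v) with α, β in L²,
which gives differentiability in operator norm (`hasFDerivAt_operator`).

A parameter-dependent c is replaced near each point by a constant-in-p scalar d. This conjugates H
by multiplication with c/d and leaves the integrand of Y_k unchanged (`resolvent_gauge`). All
equations are local in p, so this suffices. -/

noncomputable section

open Finset.HasAntidiagonal (antidiagonal)

namespace CubicKP

/-! ### Formal pseudo-differential operators over a differential ring -/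

/-- A derivation of a (not necessarily commutative) ring. -/
structure RingDer (R : Type*) [Ring R] extends R →+ R where
  leibniz' : ∀ a b, toFun (a * b) = toFun a * b + a * toFun b

namespace RingDer

variable {R : Type*} [Ring R]

instance : FunLike (RingDer R) R R where
  coe d := d.toFun
  coe_injective d e h := by
    rcases d with ⟨d, hd⟩
    rcases e with ⟨e, he⟩
    congr 1
    exact DFunLike.coe_injective h

instance : AddMonoidHomClass (RingDer R) R R where
  map_add d := d.map_add'
  map_zero d := d.map_zero'

variable (δ : RingDer R)

theorem leibniz (a b : R) : δ (a * b) = δ a * b + a * δ b := δ.leibniz' a b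

theorem map_one : δ (1 : R) = 0 := by
  have h := δ.leibniz 1 1
  simpa using h

theorem iterate_zero (r : ℕ) : δ^[r] (0 : R) = 0 := iterate_map_zero δ r

theorem iterate_mul (n : ℕ) (a b : R) : δ^[n] (a * b) =
    ∑ x ∈ antidiagonal n, n.choose x.1 • (δ^[x.1] a * δ^[x.2] b) := by
  induction n with
  | zero => simp
  | succ n ih =>
    rw [Finset.sum_antidiagonal_choose_succ_nsmul (fun i j => δ^[i] a * δ^[j] b),
      Function.iterate_succ_apply', ih, map_sum, ← Finset.sum_add_distrib]
    refine Finset.sum_congr rfl fun x hx => ?_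
    rw [map_nsmul, leibniz, ← Function.iterate_succ_apply' δ, ← Function.iterate_succ_apply' δ,
      smul_add, add_comm]
    congr 2
    exact Nat.choose_symm_of_eq_add (Finset.HasAntidiagonal.mem_antidiagonal.mp hx).symm

/-- The derivation as an additive endomorphism, iterated. -/
def iterHom (r : ℕ) : R →+ R where
  toFun := δ^[r]
  map_zero' := δ.iterate_zero r
  map_add' := iterate_map_add δ r

theorem iterHom_apply (r : ℕ) (a : R) : δ.iterHom r a = δ^[r] a := rfl

end RingDer

/-- Sequences indexed by `ℤ` which vanish at all large indices. -/
def boundedSeq (R : Type*) [Ring R] : AddSubgroup (ℤ → R) where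
  carrier := {a | ∃ N : ℤ, ∀ k, N < k → a k = 0}
  zero_mem' := ⟨0, fun _ _ => rfl⟩
  add_mem' := by
    rintro a b ⟨N, hN⟩ ⟨M, hM⟩
    refine ⟨max N M, fun k hk => ?_⟩
    rw [Pi.add_apply, hN k (lt_of_le_of_lt (le_max_left _ _) hk),
      hM k (lt_of_le_of_lt (le_max_right _ _) hk), add_zero]
  neg_mem' := by
    rintro a ⟨N, hN⟩
    exact ⟨N, fun k hk => by rw [Pi.neg_apply, hN k hk, neg_zero]⟩

/-- Formal pseudo-differential operators `∑_{k ≤ N} a_k ∂^k` over a ring `R` with derivation `δ`. -/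
def PDO {R : Type*} [Ring R] (_ : RingDer R) : Type _ := boundedSeq R

namespace PDO

variable {R : Type*} [Ring R] {δ : RingDer R}

instance : AddCommGroup (PDO δ) := inferInstanceAs (AddCommGroup (boundedSeq R))

/-- The coefficient of `∂^k`. -/
def coeff (A : PDO δ) (k : ℤ) : R := A.1 k

@[ext]
theorem ext {A B : PDO δ} (h : ∀ k, A.coeff k = B.coeff k) : A = B := Subtype.ext (funext h)

/-- The operator with given coefficients. -/
def mk (a : ℤ → R) (N : ℤ) (h : ∀ k, N < k → a k = 0) : PDO δ := ⟨a, N, h⟩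

@[simp] theorem coeff_mk (a : ℤ → R) (N : ℤ) (h : ∀ k, N < k → a k = 0) (k : ℤ) :
    (mk a N h : PDO δ).coeff k = a k := rfl

@[simp] theorem coeff_add (A B : PDO δ) (k : ℤ) : (A + B).coeff k = A.coeff k + B.coeff k := rfl
@[simp] theorem coeff_sub (A B : PDO δ) (k : ℤ) : (A - B).coeff k = A.coeff k - B.coeff k := rfl

/-- The coefficients as additive maps. -/
def coeffHom (δ : RingDer R) (k : ℤ) : PDO δ →+ R where
  toFun A := A.coeff k
  map_zero' := rfl
  map_add' _ _ := rfl

theorem coeff_sum {ι : Type*} (s : Finset ι) (A : ι → PDO δ) (k : ℤ) :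
    (∑ i ∈ s, A i).coeff k = ∑ i ∈ s, (A i).coeff k := map_sum (coeffHom δ k) A s

/-- `A` has order at most `N`. -/
def OrdLE (A : PDO δ) (N : ℤ) : Prop := ∀ k, N < k → A.coeff k = 0

theorem exists_ordLE (A : PDO δ) : ∃ N, A.OrdLE N := A.2

/-- The general term of the coefficient of `∂^k` in a product. -/
def mulTerm (A B : PDO δ) (k : ℤ) (s : ℤ × ℕ) : R :=
  Ring.choose s.1 s.2 • (A.coeff s.1 * δ^[s.2] (B.coeff (k - s.1 + s.2)))

theorem mulTerm_eq_zero_left {A : PDO δ} {N : ℤ} (hA : A.OrdLE N) (B : PDO δ) (k : ℤ)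
    {s : ℤ × ℕ} (h : N < s.1) : mulTerm A B k s = 0 := by simp [mulTerm, hA _ h]

theorem mulTerm_eq_zero_right (A : PDO δ) {B : PDO δ} {M : ℤ} (hB : B.OrdLE M) (k : ℤ)
    {s : ℤ × ℕ} (h : M < k - s.1 + s.2) : mulTerm A B k s = 0 := by
  simp [mulTerm, hB _ h, δ.iterate_zero]

/-- The order of A bounds the first index above; the order of B then bounds it below and bounds the
number of derivatives. Without this, `finsum` would take its default value 0. -/
theorem mulTerm_finite (A B : PDO δ) (k : ℤ) : (Function.support (mulTerm A B k)).Finite := by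
  obtain ⟨N, hN⟩ := A.exists_ordLE
  obtain ⟨M, hM⟩ := B.exists_ordLE
  refine ((Set.finite_Icc (k - M) N).prod (Set.finite_Iic (M - k + N).toNat)).subset ?_
  rintro ⟨s, r⟩ h
  have h1 : s ≤ N := not_lt.mp fun h' => h (mulTerm_eq_zero_left hN B k h')
  have h2 : k - s + r ≤ M := not_lt.mp fun h' => h (mulTerm_eq_zero_right A hM k h')
  simp only [Set.mem_prod, Set.mem_Icc, Set.mem_Iic]
  omega

instance : Mul (PDO δ) where
  mul A B := ⟨fun k => ∑ᶠ s : ℤ × ℕ, mulTerm A B k s, by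
    obtain ⟨N, hN⟩ := A.exists_ordLE
    obtain ⟨M, hM⟩ := B.exists_ordLE
    refine ⟨N + M, fun k hk => finsum_eq_zero_of_forall_eq_zero fun s => ?_⟩
    by_cases h : N < s.1
    · exact mulTerm_eq_zero_left hN B k h
    · exact mulTerm_eq_zero_right A hM k (by omega)⟩

theorem coeff_mul (A B : PDO δ) (k : ℤ) : (A * B).coeff k = ∑ᶠ s : ℤ × ℕ, mulTerm A B k s := rfl

theorem OrdLE.mul {A B : PDO δ} {N M : ℤ} (hA : A.OrdLE N) (hB : B.OrdLE M) :
    (A * B).OrdLE (N + M) := fun k hk => finsum_eq_zero_of_forall_eq_zero fun s => by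
  by_cases h : N < s.1
  · exact mulTerm_eq_zero_left hA B k h
  · exact mulTerm_eq_zero_right A hB k (by omega)

/-- `a ∂^s`. -/
def monomial (a : R) (s : ℤ) : PDO δ := mk (fun k => if k = s then a else 0) s
  fun _ hk => if_neg hk.ne'

@[simp] theorem coeff_monomial (a : R) (s k : ℤ) :
    (monomial a s : PDO δ).coeff k = if k = s then a else 0 := rfl

instance : One (PDO δ) := ⟨monomial 1 0⟩

theorem coeff_one (k : ℤ) : (1 : PDO δ).coeff k = if k = 0 then 1 else 0 := rfl

theorem add_mul' (A B C : PDO δ) : (A + B) * C = A * C + B * C := by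
  ext k
  rw [coeff_add, coeff_mul, coeff_mul, coeff_mul,
    ← finsum_add_distrib (mulTerm_finite A C k) (mulTerm_finite B C k)]
  refine finsum_congr fun s => ?_
  simp [mulTerm, add_mul]

theorem mul_add' (A B C : PDO δ) : A * (B + C) = A * B + A * C := by
  ext k
  rw [coeff_add, coeff_mul, coeff_mul, coeff_mul,
    ← finsum_add_distrib (mulTerm_finite A B k) (mulTerm_finite A C k)]
  refine finsum_congr fun s => ?_
  simp [mulTerm, mul_add, iterate_map_add]

/-- Left multiplication by `a ∂^i`, `i ∈ ℕ`, is a finite sum. -/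
theorem coeff_monomial_mul_nat (a : R) (i : ℕ) (B : PDO δ) (k : ℤ) :
    (monomial a i * B).coeff k =
      ∑ r ∈ Finset.range (i + 1), i.choose r • (a * δ^[r] (B.coeff (k - i + r))) := by
  rw [coeff_mul, finsum_eq_sum_of_support_subset (s := ((Finset.range (i + 1)).map
    ⟨fun r : ℕ => ((i : ℤ), r), fun r r' h => (Prod.ext_iff.mp h).2⟩))]
  · rw [Finset.sum_map]
    refine Finset.sum_congr rfl fun r _ => ?_
    change mulTerm _ _ _ ((i : ℤ), r) = _
    simp [mulTerm, Ring.choose_natCast]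
  · rintro ⟨s, r⟩ h
    simp only [Function.mem_support, mulTerm, coeff_monomial] at h
    have hs : s = i := by
      by_contra h'
      simp [h'] at h
    subst hs
    have hr : r < i + 1 := by
      by_contra h'
      rw [Ring.choose_natCast, Nat.choose_eq_zero_of_lt (by omega)] at h
      simp at h
    simp only [Finset.coe_map, Set.mem_image]
    exact ⟨r, by simpa using hr, rfl⟩

theorem coeff_const_mul (a : R) (B : PDO δ) (k : ℤ) :
    (monomial a 0 * B).coeff k = a * B.coeff k := by
  have h := coeff_monomial_mul_nat a 0 B k
  simpa using h

theorem coeff_d_mul (B : PDO δ) (k : ℤ) :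
    (monomial 1 1 * B).coeff k = δ (B.coeff k) + B.coeff (k - 1) := by
  have h := coeff_monomial_mul_nat (1 : R) 1 B k
  simpa [Finset.sum_range_succ, add_comm] using h

/-- Right multiplication by `a ∂^i` with `a` constant. -/
theorem coeff_mul_monomial (A : PDO δ) {a : R} (ha : δ a = 0) (i k : ℤ) :
    (A * monomial a i).coeff k = A.coeff (k - i) * a := by
  have hit : ∀ r : ℕ, r ≠ 0 → δ^[r] a = 0 := by
    intro r hr
    obtain ⟨r, rfl⟩ := Nat.exists_eq_succ_of_ne_zero hr
    rw [Function.iterate_succ_apply, ha, δ.iterate_zero]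
  rw [coeff_mul, finsum_eq_single _ (k - i, 0)]
  · simp [mulTerm]
  · rintro ⟨s, r⟩ h
    simp only [mulTerm, coeff_monomial]
    split_ifs with hs
    · rw [hit r, mul_zero, smul_zero]
      rintro rfl
      apply h
      simp at hs ⊢
      omega
    · simp [δ.iterate_zero]

theorem one_mul' (A : PDO δ) : 1 * A = A := by
  ext k
  exact (coeff_const_mul 1 A k).trans (one_mul _)

theorem mul_one' (A : PDO δ) : A * 1 = A := by
  ext k
  refine (coeff_mul_monomial A δ.map_one 0 k).trans ?_
  simp

/-- Chu–Vandermonde for s + t - r = (s - r) + t, followed by binom(s, r) binom(s - r, x) = binom(r +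
x, r) binom(s, r + x). On the right the terms with first index below r vanish, so the sum is a
shifted antidiagonal. The binomials have integer upper entries, as negative powers of ∂ require. -/
theorem choose_vandermonde (s t : ℤ) (r r' : ℕ) :
    Ring.choose (s + t - r) r' * Ring.choose s r =
      ∑ x ∈ antidiagonal (r + r'),
        (x.1.choose r : ℤ) * (Ring.choose s x.1 * Ring.choose t x.2) := by
  have h1 : s + t - r = (s - r) + t := by ring
  rw [h1, Ring.add_choose_eq r' (Commute.all _ _), Finset.sum_mul]
  have h2 : ∑ x ∈ antidiagonal (r + r'),
        (x.1.choose r : ℤ) * (Ring.choose s x.1 * Ring.choose t x.2) =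
      ∑ x ∈ (antidiagonal r').map ⟨fun x : ℕ × ℕ => (r + x.1, x.2), by
        rintro ⟨a, b⟩ ⟨c, d⟩ h; simpa using h⟩,
        (x.1.choose r : ℤ) * (Ring.choose s x.1 * Ring.choose t x.2) := by
    symm
    refine Finset.sum_subset ?_ ?_
    · rintro ⟨a, b⟩ h
      simp only [Finset.mem_map, Finset.HasAntidiagonal.mem_antidiagonal,
        Prod.exists] at h ⊢
      obtain ⟨c, d, h1, h2, h3⟩ := h
      omega
    · rintro ⟨a, b⟩ h h'
      simp only [Finset.mem_map, Finset.HasAntidiagonal.mem_antidiagonal,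
        Prod.exists, not_exists, not_and] at h h'
      have : a < r := by
        by_contra hlt
        exact h' (a - r) b (by omega) (Prod.ext (show r + (a - r) = a by omega) rfl)
      simp [Nat.choose_eq_zero_of_lt this]
  rw [h2, Finset.sum_map]
  refine Finset.sum_congr rfl fun x _ => ?_
  change Ring.choose (s - ↑r) x.1 * Ring.choose t x.2 * Ring.choose s r =
    ((r + x.1).choose r : ℤ) * (Ring.choose s (r + x.1) * Ring.choose t x.2)
  have h3 := Ring.choose_smul_choose s (Nat.le_add_right r x.1)
  rw [nsmul_eq_mul, Nat.add_sub_cancel_left] at h3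
  rw [← mul_assoc, h3]
  ring

/-- Associativity of (a ∂^s)(b ∂^t)(c ·) in the terms with l derivatives in total: expand the right
side by the Leibniz rule and compare the coefficients of a (δ^i b)(δ^j c), which agree by
`choose_vandermonde`. -/
theorem assoc_antidiagonal (s t : ℤ) (l : ℕ) (a b c : R) :
    ∑ x ∈ antidiagonal l, (Ring.choose (s + t - x.1) x.2 * Ring.choose s x.1) •
        (a * δ^[x.1] b * δ^[x.2] c) =
      ∑ x ∈ antidiagonal l, (Ring.choose s x.1 * Ring.choose t x.2) •
        (a * δ^[x.1] (b * δ^[x.2] c)) := by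
  have hr : ∀ x ∈ antidiagonal l, (Ring.choose s x.1 * Ring.choose t x.2) •
        (a * δ^[x.1] (b * δ^[x.2] c)) =
      ∑ y ∈ antidiagonal l, ((x.1.choose y.1 : ℤ) *
        (Ring.choose s x.1 * Ring.choose t x.2)) • (a * δ^[y.1] b * δ^[y.2] c) := by
    rintro ⟨x, x'⟩ hx
    rw [Finset.HasAntidiagonal.mem_antidiagonal] at hx
    simp only at hx ⊢
    rw [δ.iterate_mul, Finset.mul_sum, Finset.smul_sum]
    have h2 : ∑ y ∈ antidiagonal l, ((x.choose y.1 : ℤ) *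
        (Ring.choose s x * Ring.choose t x')) • (a * δ^[y.1] b * δ^[y.2] c) =
      ∑ y ∈ (antidiagonal x).map ⟨fun y : ℕ × ℕ => (y.1, y.2 + x'), by
        rintro ⟨a, b⟩ ⟨c, d⟩ h; simpa using h⟩, ((x.choose y.1 : ℤ) *
        (Ring.choose s x * Ring.choose t x')) • (a * δ^[y.1] b * δ^[y.2] c) := by
      symm
      refine Finset.sum_subset ?_ ?_
      · rintro ⟨a, b⟩ h
        simp only [Finset.mem_map, Finset.HasAntidiagonal.mem_antidiagonal,
          Prod.exists] at h ⊢
        obtain ⟨c, d, h1, h2, h3⟩ := h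
        omega
      · rintro ⟨a, b⟩ h h'
        simp only [Finset.mem_map, Finset.HasAntidiagonal.mem_antidiagonal,
          Prod.exists, not_exists, not_and] at h h'
        have : x < a := by
          by_contra hlt
          exact h' a (x - a) (by omega) (Prod.ext rfl (show x - a + x' = b by omega))
        simp [Nat.choose_eq_zero_of_lt this]
    rw [h2, Finset.sum_map]
    refine Finset.sum_congr rfl fun y _ => ?_
    change _ = ((x.choose y.1 : ℤ) * (Ring.choose s x * Ring.choose t x')) •
      (a * δ^[y.1] b * δ^[y.2 + x'] c)
    rw [mul_smul_comm, ← natCast_zsmul, smul_smul, mul_comm, Function.iterate_add_apply, mul_assoc]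
  rw [Finset.sum_congr rfl hr, Finset.sum_comm]
  refine Finset.sum_congr rfl fun y hy => ?_
  rw [choose_vandermonde, ← Finset.sum_smul, Finset.HasAntidiagonal.mem_antidiagonal.mp hy]

theorem finsum_antidiagonal {M : Type*} [AddCommMonoid M] (f : ℕ × ℕ → M) (L : ℕ)
    (h : ∀ x, L ≤ x.1 + x.2 → f x = 0) :
    ∑ᶠ x, f x = ∑ l ∈ Finset.range L, ∑ x ∈ antidiagonal l, f x := by
  rw [finsum_eq_sum_of_support_subset (s := (Finset.range L).biUnion antidiagonal),
    Finset.sum_biUnion]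
  · intro l _ l' _ hl
    refine Finset.disjoint_left.mpr fun x hx hx' => hl ?_
    rw [← Finset.HasAntidiagonal.mem_antidiagonal.mp hx, ← Finset.HasAntidiagonal.mem_antidiagonal.mp hx']
  · intro x hx
    simp only [Finset.coe_biUnion, Set.mem_iUnion, Finset.mem_coe, Finset.HasAntidiagonal.mem_antidiagonal,
      Finset.mem_range]
    refine ⟨_, ?_, rfl⟩
    by_contra hlt
    exact hx (h x (not_lt.mp hlt))

/-- The reindexing of the four-fold sums in the associativity law. -/
def assocEquiv : (ℤ × ℕ) × (ℤ × ℕ) ≃ (ℤ × ℤ) × (ℕ × ℕ) where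
  toFun x := ((x.2.1, x.1.1 - x.2.1 + x.2.2), (x.2.2, x.1.2))
  invFun y := ((y.1.1 + y.1.2 - y.2.1, y.2.2), (y.1.1, y.2.1))
  left_inv := by
    rintro ⟨⟨a, b⟩, ⟨c, d⟩⟩
    simp only [Prod.mk.injEq, and_true]
    omega
  right_inv := by
    rintro ⟨⟨a, b⟩, ⟨c, d⟩⟩
    simp only [Prod.mk.injEq, and_true, true_and]
    omega

/-- The reordering of the four-fold sums in the associativity law. -/
def swapEquiv : (ℤ × ℕ) × (ℤ × ℕ) ≃ (ℤ × ℤ) × (ℕ × ℕ) where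
  toFun x := ((x.1.1, x.2.1), (x.1.2, x.2.2))
  invFun y := ((y.1.1, y.2.1), (y.1.2, y.2.2))
  left_inv := by rintro ⟨⟨a, b⟩, ⟨c, d⟩⟩; simp
  right_inv := by rintro ⟨⟨a, b⟩, ⟨c, d⟩⟩; simp

/-- The general term of the coefficient of `∂^k` in `(A * B) * C`. -/
def termL (A B C : PDO δ) (k : ℤ) (x : (ℤ × ℤ) × (ℕ × ℕ)) : R :=
  (Ring.choose (x.1.1 + x.1.2 - x.2.1) x.2.2 * Ring.choose x.1.1 x.2.1) •
    (A.coeff x.1.1 * δ^[x.2.1] (B.coeff x.1.2) *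
      δ^[x.2.2] (C.coeff (k - x.1.1 - x.1.2 + (x.2.1 + x.2.2 : ℕ))))

/-- The general term of the coefficient of `∂^k` in `A * (B * C)`. -/
def termR (A B C : PDO δ) (k : ℤ) (x : (ℤ × ℤ) × (ℕ × ℕ)) : R :=
  (Ring.choose x.1.1 x.2.1 * Ring.choose x.1.2 x.2.2) •
    (A.coeff x.1.1 * δ^[x.2.1] (B.coeff x.1.2 *
      δ^[x.2.2] (C.coeff (k - x.1.1 - x.1.2 + (x.2.1 + x.2.2 : ℕ)))))

theorem support_finite_of_bounds {f : (ℤ × ℤ) × (ℕ × ℕ) → R} {N M L k : ℤ}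
    (h1 : ∀ x, N < x.1.1 → f x = 0) (h2 : ∀ x, M < x.1.2 → f x = 0)
    (h3 : ∀ x, L < k - x.1.1 - x.1.2 + (x.2.1 + x.2.2 : ℕ) → f x = 0) :
    (Function.support f).Finite := by
  refine (((Set.finite_Icc (k - L - M) N).prod (Set.finite_Icc (k - L - N) M)).prod
    ((Set.finite_Iic (L - k + N + M).toNat).prod
      (Set.finite_Iic (L - k + N + M).toNat))).subset ?_
  rintro ⟨⟨s, t⟩, ⟨r, r'⟩⟩ h
  have e1 : s ≤ N := not_lt.mp fun h' => h (h1 _ h')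
  have e2 : t ≤ M := not_lt.mp fun h' => h (h2 _ h')
  have e3 : k - s - t + (r + r' : ℕ) ≤ L := not_lt.mp fun h' => h (h3 _ h')
  simp only [Set.mem_prod, Set.mem_Icc, Set.mem_Iic]
  omega

/-- Both sides are fourfold sums over the orders of the coefficients taken from A and B and over two
derivative counts. Once both are indexed this way, the coefficient of C involved depends only on the
two orders and the total count l, so the identity reduces to `assoc_antidiagonal` for each l. -/
theorem mul_assoc' (A B C : PDO δ) : A * B * C = A * (B * C) := by
  obtain ⟨N, hN⟩ := A.exists_ordLE
  obtain ⟨M, hM⟩ := B.exists_ordLE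
  obtain ⟨L, hL⟩ := C.exists_ordLE
  ext k
  have fL : (Function.support (termL A B C k)).Finite := by
    refine support_finite_of_bounds (N := N) (M := M) (L := L) (k := k) ?_ ?_ ?_
    · intro x h
      simp [termL, hN _ h]
    · intro x h
      simp [termL, hM _ h, δ.iterate_zero]
    · intro x h
      simp only [termL, hL _ h, δ.iterate_zero, mul_zero, smul_zero]
  have fR : (Function.support (termR A B C k)).Finite := by
    refine support_finite_of_bounds (N := N) (M := M) (L := L) (k := k) ?_ ?_ ?_
    · intro x h
      simp [termR, hN _ h]
    · intro x h
      simp [termR, hM _ h, δ.iterate_zero]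
    · intro x h
      simp only [termR, hL _ h, δ.iterate_zero, mul_zero, smul_zero]
  have hl : (A * B * C).coeff k = ∑ᶠ x, termL A B C k x := by
    rw [← finsum_comp_equiv assocEquiv, finsum_curry, coeff_mul]
    · refine finsum_congr fun s => ?_
      rw [mulTerm, coeff_mul, finsum_mul' _ _ (mulTerm_finite A B _),
        smul_finsum' _ ((mulTerm_finite A B s.1).subset fun x hx h => hx (by
          rw [h, zero_mul]))]
      refine finsum_congr fun t => ?_
      simp only [mulTerm, termL, assocEquiv, Equiv.coe_fn_mk]
      rw [smul_mul_assoc, smul_smul]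
      have e1 : t.1 + (s.1 - t.1 + t.2) - t.2 = s.1 := by ring
      have e2 : k - t.1 - (s.1 - t.1 + t.2) + (t.2 + s.2 : ℕ) = k - s.1 + s.2 := by
        push_cast
        ring
      rw [e1, e2]
    · exact fL.preimage assocEquiv.injective.injOn
  have hr : (A * (B * C)).coeff k = ∑ᶠ x, termR A B C k x := by
    rw [← finsum_comp_equiv swapEquiv, finsum_curry, coeff_mul]
    · refine finsum_congr fun s => ?_
      rw [mulTerm, coeff_mul, ← δ.iterHom_apply, map_finsum _ (mulTerm_finite B C _),
        mul_finsum' _ _ ((mulTerm_finite B C (k - s.1 + s.2)).subset fun x hx h => hx (by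
          rw [h, map_zero])),
        smul_finsum' _ ((mulTerm_finite B C (k - s.1 + s.2)).subset fun x hx h => hx (by
          rw [h, map_zero, mul_zero]))]
      refine finsum_congr fun t => ?_
      simp only [mulTerm, termR, swapEquiv, Equiv.coe_fn_mk]
      rw [map_zsmul, mul_smul_comm, smul_smul, δ.iterHom_apply]
      have e1 : k - s.1 - t.1 + (s.2 + t.2 : ℕ) = k - s.1 + s.2 - t.1 + t.2 := by
        push_cast
        ring
      rw [e1]
    · exact fR.preimage swapEquiv.injective.injOn
  rw [hl, hr, finsum_curry _ fL, finsum_curry _ fR]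
  refine finsum_congr fun y => ?_
  -- Beyond this total number of derivatives the index of the coefficient of C exceeds its order L,
  -- so only finitely many antidiagonals contribute.
  have hz : ∀ x : ℕ × ℕ, (L - k + y.1 + y.2 + 1).toNat ≤ x.1 + x.2 →
      L < k - y.1 - y.2 + (x.1 + x.2 : ℕ) := fun x hx => by omega
  rw [finsum_antidiagonal _ (L - k + y.1 + y.2 + 1).toNat,
    finsum_antidiagonal _ (L - k + y.1 + y.2 + 1).toNat]
  · refine Finset.sum_congr rfl fun l _ => ?_
    have h := assoc_antidiagonal (δ := δ) y.1 y.2 l (A.coeff y.1) (B.coeff y.2)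
      (C.coeff (k - y.1 - y.2 + l))
    refine (Finset.sum_congr rfl fun x hx => ?_).trans
      (h.trans (Finset.sum_congr rfl fun x hx => ?_))
    · simp only [termL, Finset.HasAntidiagonal.mem_antidiagonal.mp hx]
    · simp only [termR, Finset.HasAntidiagonal.mem_antidiagonal.mp hx]
  · intro x hx
    simp only [termR, hL _ (hz x hx), δ.iterate_zero, mul_zero, smul_zero]
  · intro x hx
    simp only [termL, hL _ (hz x hx), δ.iterate_zero, mul_zero, smul_zero]

theorem zero_mul' (A : PDO δ) : 0 * A = 0 := by
  have h := add_mul' 0 0 A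
  simpa using h

theorem mul_zero' (A : PDO δ) : A * 0 = 0 := by
  have h := mul_add' A 0 0
  simpa using h

instance : Ring (PDO δ) :=
  { (inferInstance : AddCommGroup (PDO δ)), (inferInstance : Mul (PDO δ)),
    (inferInstance : One (PDO δ)) with
    left_distrib := mul_add'
    right_distrib := add_mul'
    zero_mul := zero_mul'
    mul_zero := mul_zero'
    mul_assoc := mul_assoc'
    one_mul := one_mul'
    mul_one := mul_one' }

end PDO

end CubicKP

namespace CubicKP

/-! ### Derivations, orders, inverses and positive parts of formal operators -/

namespace PDO

variable {R : Type*} [Ring R] {δ : RingDer R}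

/-- A derivation of the coefficient ring acting on coefficients, as a map. -/
def mapCoeff (d : RingDer R) (A : PDO δ) : PDO δ := ⟨fun k => d (A.coeff k), by
  obtain ⟨N, hN⟩ := A.exists_ordLE
  exact ⟨N, fun k hk => (congrArg d (hN k hk)).trans (map_zero d)⟩⟩

/-- A derivation commuting with `δ`, acting on coefficients. -/
def mapDer (d : RingDer R) (hd : ∀ a, d (δ a) = δ (d a)) : RingDer (PDO δ) where
  toFun := mapCoeff d
  map_zero' := by
    ext k
    exact map_zero d
  map_add' A B := by
    ext k
    exact map_add d _ _
  leibniz' A B := by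
    ext k
    change d ((A * B).coeff k) = (mapCoeff d A * B + A * mapCoeff d B).coeff k
    have hit : ∀ (r : ℕ) (a : R), d (δ^[r] a) = δ^[r] (d a) := by
      intro r
      induction r with
      | zero => intro a; rfl
      | succ r ih => intro a; rw [Function.iterate_succ_apply, ih, hd, Function.iterate_succ_apply]
    rw [coeff_add, coeff_mul, coeff_mul, coeff_mul, map_finsum d (mulTerm_finite A B k),
      ← finsum_add_distrib (mulTerm_finite _ B k) (mulTerm_finite A _ k)]
    refine finsum_congr fun s => ?_
    simp only [mulTerm]
    rw [map_zsmul, d.leibniz, smul_add, hit]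
    rfl

@[simp] theorem coeff_mapDer (d : RingDer R) (hd : ∀ a, d (δ a) = δ (d a)) (A : PDO δ) (k : ℤ) :
    (mapDer d hd A).coeff k = d (A.coeff k) := rfl

theorem OrdLE.mono {A : PDO δ} {N M : ℤ} (h : A.OrdLE N) (hNM : N ≤ M) : A.OrdLE M :=
  fun k hk => h k (lt_of_le_of_lt hNM hk)

theorem ordLE_one : (1 : PDO δ).OrdLE 0 := fun k hk => by rw [coeff_one, if_neg hk.ne']

theorem OrdLE.pow {A : PDO δ} (hA : A.OrdLE (-1)) (j : ℕ) : (A ^ j).OrdLE (-j) := by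
  induction j with
  | zero => simpa using ordLE_one
  | succ j ih =>
    rw [pow_succ]
    exact (ih.mul hA).mono (by push_cast; omega)

theorem eq_zero_of_ordLE {A : PDO δ} (h : ∀ K : ℕ, A.OrdLE (-K)) : A = 0 := by
  ext k
  exact h (k.natAbs + 1) k (by omega)

/-- An operator with leading coefficient `1` and order `0` is invertible (geometric series). -/
theorem exists_inverse {N : PDO δ} (hN : N.OrdLE (-1)) :
    ∃ Q : PDO δ, Q.OrdLE 0 ∧ (1 - N) * Q = 1 ∧ Q * (1 - N) = 1 := by
  have hord : ∀ k : ℤ, 0 < k → (∑ j ∈ Finset.range (k.natAbs + 1), N ^ j).coeff k = 0 := by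
    intro k hk
    rw [coeff_sum]
    exact Finset.sum_eq_zero fun j _ => hN.pow j k (by omega)
  -- N^j has order at most -j, so the coefficient of ∂^k in the partial geometric sums no longer
  -- changes after j = |k|. The stable value defines Q, which therefore differs from the K-th
  -- partial sum by order at most -K.
  let Q : PDO δ := mk (fun k => (∑ j ∈ Finset.range (k.natAbs + 1), N ^ j).coeff k) 0 hord
  have hQ : ∀ K : ℕ, (Q - ∑ j ∈ Finset.range K, N ^ j).OrdLE (-K) := by
    intro K k hk
    rw [coeff_sub, coeff_mk, coeff_sum, coeff_sum]
    rcases le_total K (k.natAbs + 1) with h | h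
    · rw [Finset.sum_subset (Finset.range_mono h), sub_self]
      intro j _ hj
      rw [Finset.mem_range, not_lt] at hj
      exact hN.pow j k (by omega)
    · rw [sub_eq_zero]
      refine Finset.sum_subset (Finset.range_mono h) ?_
      intro j _ hj
      rw [Finset.mem_range, not_lt] at hj
      exact hN.pow j k (by omega)
  have hP : (1 - N).OrdLE 0 := by
    intro k hk
    rw [coeff_sub, ordLE_one k hk, hN k (by omega), sub_zero]
  have hgeom : ∀ K : ℕ, (1 - N) * ∑ j ∈ Finset.range K, N ^ j = 1 - N ^ K :=
    fun K => mul_neg_geom_sum N K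
  have hgeom' : ∀ K : ℕ, (∑ j ∈ Finset.range K, N ^ j) * (1 - N) = 1 - N ^ K :=
    fun K => geom_sum_mul_neg N K
  refine ⟨Q, hord, ?_, ?_⟩
  · rw [← sub_eq_zero]
    refine eq_zero_of_ordLE fun K k hk => ?_
    have h : (1 - N) * Q - 1 =
        (1 - N) * (Q - ∑ j ∈ Finset.range K, N ^ j) - N ^ K := by
      rw [mul_sub, hgeom]
      abel
    rw [h, coeff_sub, hP.mul (hQ K) k (by omega), hN.pow K k hk, sub_zero]
  · rw [← sub_eq_zero]
    refine eq_zero_of_ordLE fun K k hk => ?_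
    have h : Q * (1 - N) - 1 =
        (Q - ∑ j ∈ Finset.range K, N ^ j) * (1 - N) - N ^ K := by
      rw [sub_mul, hgeom']
      abel
    rw [h, coeff_sub, (hQ K).mul hP k (by omega), hN.pow K k hk, sub_zero]

/-- The part with non-negative powers of `∂`. -/
def pos (A : PDO δ) : PDO δ := ⟨fun k => if 0 ≤ k then A.coeff k else 0, by
  obtain ⟨N, hN⟩ := A.exists_ordLE
  exact ⟨N, fun k hk => by simp [hN k hk]⟩⟩

@[simp] theorem coeff_pos (A : PDO δ) (k : ℤ) :
    A.pos.coeff k = if 0 ≤ k then A.coeff k else 0 := rfl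

/-- `A` has only non-negative powers of `∂`. -/
def IsDiff (A : PDO δ) : Prop := ∀ k < 0, A.coeff k = 0

theorem IsDiff.const_mul {A : PDO δ} (h : A.IsDiff) (a : R) : (monomial a 0 * A).IsDiff :=
  fun k hk => by rw [coeff_const_mul, h k hk, mul_zero]

theorem IsDiff.d_mul {A : PDO δ} (h : A.IsDiff) : (monomial 1 1 * A).IsDiff :=
  fun k hk => by rw [coeff_d_mul, h k hk, h (k - 1) (by omega), map_zero, add_zero]

theorem IsDiff.add {A B : PDO δ} (hA : A.IsDiff) (hB : B.IsDiff) : (A + B).IsDiff :=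
  fun k hk => by rw [coeff_add, hA k hk, hB k hk, add_zero]

theorem IsDiff.sub {A B : PDO δ} (hA : A.IsDiff) (hB : B.IsDiff) : (A - B).IsDiff :=
  fun k hk => by rw [coeff_sub, hA k hk, hB k hk, sub_zero]

theorem isDiff_const (a : R) : (monomial a 0 : PDO δ).IsDiff :=
  fun k hk => by rw [coeff_monomial, if_neg hk.ne]

theorem isDiff_sum {ι : Type*} (s : Finset ι) (A : ι → PDO δ) (h : ∀ i ∈ s, (A i).IsDiff) :
    (∑ i ∈ s, A i).IsDiff :=
  fun k hk => by
    rw [coeff_sum]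
    exact Finset.sum_eq_zero fun i hi => h i hi k hk

/-- `1 + ∑_{k ≥ 1} q_k ∂^(-k)`. -/
def ofSeq (δ : RingDer R) (q : ℕ → R) : PDO δ :=
  mk (fun k => if k = 0 then 1 else if k < 0 then q k.natAbs else 0) 0
    fun _ hk => by rw [if_neg hk.ne', if_neg (not_lt.mpr hk.le)]

theorem ofSeq_eq_sub (q : ℕ → R) : ∃ N : PDO δ, N.OrdLE (-1) ∧ ofSeq δ q = 1 - N := by
  refine ⟨1 - ofSeq δ q, fun k hk => ?_, by abel⟩
  rw [coeff_sub, coeff_one, ofSeq, coeff_mk]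
  split_ifs
  · exact sub_self 1
  · omega
  · exact sub_self 0

/-! ### Wave operators built from moments, and the Sato equation -/

/-- The operators `∂^r + ∑_{k ≥ 1} M_{r,k-1} ∂^(-k)`. -/
def waveOp (δ : RingDer R) (M : ℕ → ℕ → R) (r : ℕ) : PDO δ :=
  mk (fun k => if k = r then 1 else if k < 0 then M r (k.natAbs - 1) else 0) r
    fun k hk => by rw [if_neg hk.ne', if_neg (by omega)]

theorem coeff_waveOp (M : ℕ → ℕ → R) (r : ℕ) (k : ℤ) : (waveOp δ M r).coeff k =
    if k = r then 1 else if k < 0 then M r (k.natAbs - 1) else 0 := rfl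

/-- The hypothesis on δ is exactly the comparison of negative coefficients: ∂ contributes δ M_{r,s}
+ M_{r,s+1}. At ∂^0 the coefficient M_{r,0} pushed up by ∂ is removed by the subtracted term. -/
theorem waveOp_succ (M : ℕ → ℕ → R)
    (hδ : ∀ r s, δ (M r s) = M (r + 1) s - M r (s + 1) + M r 0 * M 0 s) (r : ℕ) :
    waveOp δ M (r + 1) = monomial 1 1 * waveOp δ M r - monomial (M r 0) 0 * waveOp δ M 0 := by
  ext k
  rw [coeff_sub, coeff_d_mul, coeff_const_mul, coeff_waveOp, coeff_waveOp, coeff_waveOp,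
    coeff_waveOp]
  rcases lt_trichotomy k 0 with hk | rfl | hk
  · obtain ⟨s, rfl⟩ : ∃ s : ℕ, k = -(s + 1 : ℤ) := ⟨k.natAbs - 1, by omega⟩
    have h1 : (-(s + 1 : ℤ)).natAbs - 1 = s := by omega
    have h2 : (-(s + 1 : ℤ) - 1).natAbs - 1 = s + 1 := by omega
    rw [if_neg (by omega), if_pos hk, if_neg (by omega), if_pos hk, if_neg (by omega),
      if_pos (by omega), if_neg (by omega), if_pos hk, h1, h2, hδ]
    abel
  · have e1 : δ (if (0 : ℤ) = r then 1 else if (0 : ℤ) < 0 then M r ((0 : ℤ).natAbs - 1) else 0)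
        = 0 := by
      rw [if_neg (lt_irrefl (0 : ℤ))]
      split_ifs
      · exact δ.map_one
      · exact map_zero δ
    rw [e1, if_neg (by omega : ¬ (0 : ℤ) = (r + 1 : ℕ)), if_neg (lt_irrefl (0 : ℤ)),
      if_neg (by omega : ¬ (0 - 1 : ℤ) = r), if_pos (by omega : (0 - 1 : ℤ) < 0), if_pos (by simp)]
    simp
  · have e1 : δ (if k = r then 1 else if k < 0 then M r (k.natAbs - 1) else 0) = 0 := by
      rw [if_neg (by omega : ¬ k < 0)]
      split_ifs
      · exact δ.map_one
      · exact map_zero δ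
    rw [e1, if_neg (by omega : ¬ k < 0), if_neg (by omega : ¬ k - 1 < 0),
      if_neg (by omega : ¬ k = (0 : ℕ)), if_neg (by omega : ¬ k < 0), mul_zero, sub_zero, zero_add]
    refine if_congr ?_ rfl rfl
    omega

/-- The recursion `waveOp_succ` only uses left multiplication by ∂ and by functions, so iterating it
from W_0 keeps the left factor free of negative powers. -/
theorem exists_waveOp_eq_mul (M : ℕ → ℕ → R)
    (hδ : ∀ r s, δ (M r s) = M (r + 1) s - M r (s + 1) + M r 0 * M 0 s) (r : ℕ) :
    ∃ B : PDO δ, B.IsDiff ∧ waveOp δ M r = B * waveOp δ M 0 := by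
  induction r with
  | zero => exact ⟨1, isDiff_const 1, (one_mul _).symm⟩
  | succ r ih =>
    obtain ⟨B, hB, h⟩ := ih
    refine ⟨monomial 1 1 * B - monomial (M r 0) 0, hB.d_mul.sub (isDiff_const _), ?_⟩
    rw [waveOp_succ M hδ, h, sub_mul, mul_assoc]

/-- At negative powers this is the derivative law of the moments in row 0. At non-negative powers d
kills the constant leading part, and the polynomial part of W_0 E ∂^{l+1} is matched by the leading
terms ∂^b of the W_b on the right. Here l + 1 is the order of the flow. -/
theorem der_add_eq_sum (M : ℕ → ℕ → R) (d : RingDer R) (hd : ∀ a, d (δ a) = δ (d a)) {E : R}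
    (hE : δ E = 0) (l : ℕ)
    (hM : ∀ s, d (M 0 s) = E * M (l + 1) s - M 0 (s + l + 1) * E +
      ∑ x ∈ antidiagonal l, M 0 x.1 * E * M x.2 s) :
    mapDer d hd (waveOp δ M 0) + waveOp δ M 0 * monomial E (l + 1) =
      monomial E 0 * waveOp δ M (l + 1) +
        ∑ x ∈ antidiagonal l, monomial (M 0 x.1 * E) 0 * waveOp δ M x.2 := by
  ext k
  rw [coeff_add, coeff_add, coeff_mul_monomial _ hE, coeff_mapDer, coeff_const_mul, coeff_sum]
  simp only [coeff_const_mul, coeff_waveOp]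
  rcases lt_or_ge k 0 with hk | hk
  · obtain ⟨s, rfl⟩ : ∃ s : ℕ, k = -(s + 1 : ℤ) := ⟨k.natAbs - 1, by omega⟩
    have h1 : (-(s + 1 : ℤ)).natAbs - 1 = s := by omega
    have h2 : (-(s + 1 : ℤ) - (l + 1)).natAbs - 1 = s + l + 1 := by omega
    have h3 : ∀ r : ℕ, ¬ (-(s + 1 : ℤ)) = r := fun r => by omega
    simp only [h1, h3, if_false, if_pos hk]
    rw [if_neg (by omega), if_pos (by omega), h2, hM]
    abel
  · have e1 : d (if k = (0 : ℕ) then 1 else if k < 0 then M 0 (k.natAbs - 1) else 0) = 0 := by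
      rw [if_neg (by omega : ¬ k < 0)]
      split_ifs
      · exact d.map_one
      · exact map_zero d
    rw [e1]
    simp only [if_neg (by omega : ¬ k < 0), zero_add]
    obtain ⟨j, rfl⟩ := Int.eq_ofNat_of_zero_le hk
    -- Below the top power, only the pair (l - j, j) has leading term ∂^j; at j = l + 1 only E
    -- W_{l+1} contributes; above it everything vanishes.
    rcases lt_trichotomy j (l + 1) with h | h | h
    · rw [if_neg (by omega : ¬ (j : ℤ) - (l + 1) = (0 : ℕ)),
        if_pos (by omega : (j : ℤ) - (l + 1) < 0), if_neg (by omega : ¬ (j : ℤ) = (l + 1 : ℕ)),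
        mul_zero, zero_add, Finset.sum_eq_single (l - j, j)]
      · have : ((j : ℤ) - (l + 1)).natAbs - 1 = l - j := by omega
        simp [this]
      · rintro ⟨a, b⟩ hab hne
        rw [Finset.HasAntidiagonal.mem_antidiagonal] at hab
        rw [if_neg, mul_zero]
        rintro hjb
        apply hne
        simp only at hab hjb
        ext <;> simp <;> omega
      · intro h'
        exact absurd (Finset.HasAntidiagonal.mem_antidiagonal.mpr (by simp; omega)) h'
    · rw [if_pos (by omega : (j : ℤ) - (l + 1) = (0 : ℕ)), if_pos (by omega : (j : ℤ) = (l + 1 : ℕ)),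
        Finset.sum_eq_zero]
      · simp
      · intro x hx
        have := Finset.HasAntidiagonal.mem_antidiagonal.mp hx
        rw [if_neg (by omega), mul_zero]
    · rw [if_neg (by omega : ¬ (j : ℤ) - (l + 1) = (0 : ℕ)),
        if_neg (by omega : ¬ (j : ℤ) - (l + 1) < 0), if_neg (by omega : ¬ (j : ℤ) = (l + 1 : ℕ)),
        Finset.sum_eq_zero]
      · simp
      · intro x hx
        have := Finset.HasAntidiagonal.mem_antidiagonal.mp hx
        rw [if_neg (by omega), mul_zero]

/-- The decomposition into non-negative and negative powers is unique; this is how D is recognised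
as a Lax operator. -/
theorem pos_eq_of_isDiff {A D B : PDO δ} (hD : D.IsDiff) (hB : B.OrdLE (-1)) (h : A = D - B) :
    A.pos = D := by
  ext k
  rw [coeff_pos, h]
  split_ifs with hk
  · rw [coeff_sub, hB k (by omega), sub_zero]
  · rw [hD k (by omega)]

/-- The Sato equation. -/
theorem sato (M : ℕ → ℕ → R)
    (hδ : ∀ r s, δ (M r s) = M (r + 1) s - M r (s + 1) + M r 0 * M 0 s)
    (d : RingDer R) (hd : ∀ a, d (δ a) = δ (d a)) {E : R} (hE : δ E = 0) (l : ℕ)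
    (hM : ∀ s, d (M 0 s) = E * M (l + 1) s - M 0 (s + l + 1) * E +
      ∑ x ∈ antidiagonal l, M 0 x.1 * E * M x.2 s)
    {P Q : PDO δ} (hP : P = ofSeq δ fun k => M 0 (k - 1)) (hPQ : P * Q = 1) (hQP : Q * P = 1) :
    mapDer d hd P = (P * monomial E (l + 1) * Q).pos * P - P * monomial E (l + 1) := by
  -- Q is only given as some inverse; by uniqueness it is the geometric series, whose order is at
  -- most 0.
  have hQ : Q.OrdLE 0 := by
    obtain ⟨N, hN, hPN⟩ := ofSeq_eq_sub (δ := δ) fun k => M 0 (k - 1)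
    obtain ⟨Q', hQ', h1, -⟩ := exists_inverse hN
    rw [← hPN, ← hP] at h1
    have : Q = Q' := by
      calc Q = Q * (P * Q') := by rw [h1, mul_one]
        _ = Q' := by rw [← mul_assoc, hQP, one_mul]
    rwa [this]
  have hPw : P = waveOp δ M 0 := hP
  choose B hB hBM using exists_waveOp_eq_mul M hδ
  -- The right side of `der_add_eq_sum` with P split off from every wave operator.
  let D : PDO δ := monomial E 0 * B (l + 1) + ∑ x ∈ antidiagonal l, monomial (M 0 x.1 * E) 0 * B x.2
  have hD : D.IsDiff := ((hB _).const_mul _).add (isDiff_sum _ _ fun x _ => (hB _).const_mul _)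
  have hDP : mapDer d hd P + P * monomial E (l + 1) = D * P := by
    rw [hPw, der_add_eq_sum M d hd hE l hM, add_mul, Finset.sum_mul, hBM (l + 1), mul_assoc]
    congr 1
    refine Finset.sum_congr rfl fun x _ => ?_
    rw [mul_assoc, ← hBM]
  -- The leading coefficient 1 of P is constant, so differentiating P lowers its order.
  have hdP : (mapDer d hd P).OrdLE (-1) := by
    intro k hk
    rw [coeff_mapDer, hPw, coeff_waveOp, if_neg (by omega : ¬ k < 0)]
    split_ifs
    · exact d.map_one
    · exact map_zero d
  have hpos : (P * monomial E (l + 1) * Q).pos = D := by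
    refine pos_eq_of_isDiff hD (hdP.mul hQ) ?_
    have h : P * monomial E (l + 1) = D * P - mapDer d hd P := by rw [← hDP]; abel
    rw [h, sub_mul, mul_assoc, hPQ, mul_one]
  rw [hpos, ← hDP]
  abel

end PDO

/-! ### Compatibility of the Sato flows -/

/-- The Zakharov–Shabat equations follow from the Sato equations. -/
theorem zakharovShabat_of_sato {S : Type*} [Ring S] (d₁ d₂ : RingDer S) {P Q e₁ e₂ D₁ D₂ : S}
    (hd : d₂ (d₁ P) = d₁ (d₂ P)) (hPQ : P * Q = 1) (he : e₁ * e₂ = e₂ * e₁)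
    (h21 : d₂ e₁ = 0) (h12 : d₁ e₂ = 0)
    (h₁ : d₁ P = D₁ * P - P * e₁) (h₂ : d₂ P = D₂ * P - P * e₂) :
    d₂ D₁ - d₁ D₂ = D₂ * D₁ - D₁ * D₂ := by
  have e1 : d₂ (d₁ P) = d₂ D₁ * P + D₁ * (D₂ * P - P * e₂) - (D₂ * P - P * e₂) * e₁ := by
    rw [h₁, map_sub, d₂.leibniz, d₂.leibniz, h₂, h21, mul_zero, add_zero]
  have e2 : d₁ (d₂ P) = d₁ D₂ * P + D₂ * (D₁ * P - P * e₁) - (D₁ * P - P * e₁) * e₂ := by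
    rw [h₂, map_sub, d₁.leibniz, d₁.leibniz, h₁, h12, mul_zero, add_zero]
  have h : (d₂ D₁ - d₁ D₂ - (D₂ * D₁ - D₁ * D₂)) * P = 0 := by
    -- The difference of the two mixed derivatives, with the leftover commutator of e₁ and e₂ added
    -- back. It shows that the curvature kills P from the left, and P has a right inverse.
    have h' : (d₂ D₁ - d₁ D₂ - (D₂ * D₁ - D₁ * D₂)) * P =
        (d₂ D₁ * P + D₁ * (D₂ * P - P * e₂) - (D₂ * P - P * e₂) * e₁) -
        (d₁ D₂ * P + D₂ * (D₁ * P - P * e₁) - (D₁ * P - P * e₁) * e₂) +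
        P * (e₁ * e₂ - e₂ * e₁) := by noncomm_ring
    rw [h', ← e1, ← e2, hd, he]
    simp
  rw [← sub_eq_zero]
  calc _ = (d₂ D₁ - d₁ D₂ - (D₂ * D₁ - D₁ * D₂)) * (P * Q) := by rw [hPQ, mul_one]
    _ = 0 := by rw [← mul_assoc, h, zero_mul]

end CubicKP

namespace CubicKP

/-! ### The differential ring of smooth matrix-valued functions on an open set -/

section SmoothRing

variable {m n : ℕ} {U : Set (Params m)}

/-- The coordinate direction of the parameter `p ℓ i`. -/
def paramDir (ℓ : Fin 3) (i : Fin m) : Params m := Pi.single ℓ (Pi.single i 1)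

/-- Extension by zero. -/
def extendZero (a : U → Matrix (Fin n) (Fin n) ℂ) : MatFun m n :=
  open Classical in fun p => if h : p ∈ U then a ⟨p, h⟩ else 0

theorem extendZero_apply (a : U → Matrix (Fin n) (Fin n) ℂ) {p : Params m} (hp : p ∈ U) :
    extendZero a p = a ⟨p, hp⟩ := dif_pos hp

theorem SmoothMatOn.congr {A B : MatFun m n} (hA : SmoothMatOn U A) (h : ∀ p ∈ U, B p = A p) :
    SmoothMatOn U B := fun a b => (hA a b).congr fun p hp => by rw [h p hp]

theorem SmoothMatOn.mono {A : MatFun m n} {V : Set (Params m)} (hA : SmoothMatOn U A)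
    (h : V ⊆ U) : SmoothMatOn V A := fun a b => (hA a b).mono h

theorem SmoothMatOn.differentiableAt {A : MatFun m n} (hA : SmoothMatOn U A) (hU : IsOpen U)
    {p : Params m} (hp : p ∈ U) (a b : Fin n) : DifferentiableAt ℝ (fun p => A p a b) p :=
  ((hA a b).contDiffAt (hU.mem_nhds hp)).differentiableAt (by simp)

theorem SmoothMatOn.const (a : Matrix (Fin n) (Fin n) ℂ) : SmoothMatOn U (fun _ => a : MatFun m n) :=
  fun _ _ => contDiffOn_const

theorem SmoothMatOn.add {A B : MatFun m n} (hA : SmoothMatOn U A) (hB : SmoothMatOn U B) :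
    SmoothMatOn U (A + B) := fun a b => (hA a b).add (hB a b)

theorem SmoothMatOn.neg {A : MatFun m n} (hA : SmoothMatOn U A) :
    SmoothMatOn U (-A) := fun a b => (hA a b).neg

theorem SmoothMatOn.mul {A B : MatFun m n} (hA : SmoothMatOn U A) (hB : SmoothMatOn U B) :
    SmoothMatOn U (A * B) := fun a b => by
  have h : ContDiffOn ℝ ∞ (fun p => ∑ c, A p a c * B p c b) U :=
    ContDiffOn.sum fun c _ => (hA a c).mul (hB c b)
  exact h

theorem partialDeriv_apply (ℓ : Fin 3) (i : Fin m) (A : MatFun m n) (p : Params m)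
    (a b : Fin n) : partialDeriv ℓ i A p a b =
      lineDeriv ℝ (fun p' => A p' a b) p (paramDir ℓ i) := rfl

theorem partialDeriv_congr (hU : IsOpen U) (ℓ : Fin 3) (i : Fin m) {A B : MatFun m n}
    (h : ∀ p ∈ U, A p = B p) {p : Params m} (hp : p ∈ U) :
    partialDeriv ℓ i A p = partialDeriv ℓ i B p := by
  ext a b
  rw [partialDeriv_apply, partialDeriv_apply]
  refine Filter.EventuallyEq.lineDeriv_eq ?_
  filter_upwards [hU.mem_nhds hp] with x hx
  rw [h x hx]

theorem partialDeriv_eq_fderiv (hU : IsOpen U) (ℓ : Fin 3) (i : Fin m) {A : MatFun m n}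
    (hA : SmoothMatOn U A) {p : Params m} (hp : p ∈ U) (a b : Fin n) :
    partialDeriv ℓ i A p a b = fderiv ℝ (fun p' => A p' a b) p (paramDir ℓ i) :=
  (hA.differentiableAt hU hp a b).lineDeriv_eq_fderiv

theorem SmoothMatOn.partialDeriv (hU : IsOpen U) (ℓ : Fin 3) (i : Fin m) {A : MatFun m n}
    (hA : SmoothMatOn U A) : SmoothMatOn U (partialDeriv ℓ i A) := fun a b => by
  have h : ContDiffOn ℝ ∞ (fun p => fderiv ℝ (fun p' => A p' a b) p (paramDir ℓ i)) U :=
    ((hA a b).fderiv_of_isOpen hU (m := ∞) (by simp)).clm_apply contDiffOn_const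
  exact h.congr fun p hp => partialDeriv_eq_fderiv hU ℓ i hA hp a b

theorem partialDeriv_comm (hU : IsOpen U) (ℓ ℓ' : Fin 3) (i i' : Fin m) {A : MatFun m n}
    (hA : SmoothMatOn U A) {p : Params m} (hp : p ∈ U) :
    partialDeriv ℓ i (partialDeriv ℓ' i' A) p = partialDeriv ℓ' i' (partialDeriv ℓ i A) p := by
  ext a b
  have key : ∀ (k k' : Fin 3) (j j' : Fin m), partialDeriv k j (partialDeriv k' j' A) p a b =
      fderiv ℝ (fderiv ℝ (fun p' => A p' a b)) p (paramDir k j) (paramDir k' j') := by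
    intro k k' j j'
    rw [partialDeriv_eq_fderiv hU k j (hA.partialDeriv hU k' j') hp]
    have h1 : (fun p' => partialDeriv k' j' A p' a b) =ᶠ[𝓝 p]
        fun p' => fderiv ℝ (fun p' => A p' a b) p' (paramDir k' j') := by
      filter_upwards [hU.mem_nhds hp] with x hx
      exact partialDeriv_eq_fderiv hU k' j' hA hx a b
    rw [h1.fderiv_eq]
    have h2 : DifferentiableAt ℝ (fderiv ℝ (fun p' => A p' a b)) p :=
      (((hA a b).fderiv_of_isOpen hU (m := ∞) (by simp)).contDiffAt
        (hU.mem_nhds hp)).differentiableAt (by simp)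
    rw [fderiv_clm_apply h2 (differentiableAt_const _)]
    simp
  rw [key, key]
  -- Symmetry of second derivatives; it makes the parameter derivations commute with each other and
  -- with ∂.
  have hs : IsSymmSndFDerivAt ℝ (fun p' => A p' a b) p :=
    ((hA a b).contDiffAt (hU.mem_nhds hp)).isSymmSndFDerivAt (by
      rw [minSmoothness_of_isRCLikeNormedField]
      exact WithTop.coe_le_coe.mpr le_top)
  exact hs _ _

theorem partialDeriv_add (hU : IsOpen U) (ℓ : Fin 3) (i : Fin m) {A B : MatFun m n}
    (hA : SmoothMatOn U A) (hB : SmoothMatOn U B) {p : Params m} (hp : p ∈ U) :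
    partialDeriv ℓ i (A + B) p = partialDeriv ℓ i A p + partialDeriv ℓ i B p := by
  ext a b
  rw [Matrix.add_apply, partialDeriv_eq_fderiv hU ℓ i (hA.add hB) hp,
    partialDeriv_eq_fderiv hU ℓ i hA hp, partialDeriv_eq_fderiv hU ℓ i hB hp]
  have h := fderiv_fun_add (hA.differentiableAt hU hp a b) (hB.differentiableAt hU hp a b)
  exact congrArg (fun f => f (paramDir ℓ i)) h

theorem partialDeriv_mul (hU : IsOpen U) (ℓ : Fin 3) (i : Fin m) {A B : MatFun m n}
    (hA : SmoothMatOn U A) (hB : SmoothMatOn U B) {p : Params m} (hp : p ∈ U) :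
    partialDeriv ℓ i (A * B) p = partialDeriv ℓ i A p * B p + A p * partialDeriv ℓ i B p := by
  ext a b
  rw [Matrix.add_apply, Matrix.mul_apply, Matrix.mul_apply,
    partialDeriv_eq_fderiv hU ℓ i (hA.mul hB) hp, ← Finset.sum_add_distrib]
  have h1 : (fun p' => (A * B) p' a b) = fun p' => ∑ c, A p' a c * B p' c b := rfl
  have h2 : ∀ c ∈ Finset.univ, DifferentiableAt ℝ (fun p' => A p' a c * B p' c b) p := fun c _ =>
    (hA.differentiableAt hU hp a c).mul (hB.differentiableAt hU hp c b)
  rw [h1, fderiv_fun_sum h2, sum_apply]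
  refine Finset.sum_congr rfl fun c _ => ?_
  rw [fderiv_fun_mul (hA.differentiableAt hU hp a c) (hB.differentiableAt hU hp c b),
    partialDeriv_eq_fderiv hU ℓ i hA hp, partialDeriv_eq_fderiv hU ℓ i hB hp]
  simp
  ring

/-- The ring of smooth matrix-valued functions on `U`. -/
def smoothRing (n : ℕ) (U : Set (Params m)) : Subring (U → Matrix (Fin n) (Fin n) ℂ) where
  carrier := {a | SmoothMatOn U (extendZero a)}
  zero_mem' := (SmoothMatOn.const 0).congr fun p hp => by rw [extendZero_apply _ hp]; rfl
  one_mem' := (SmoothMatOn.const 1).congr fun p hp => by rw [extendZero_apply _ hp]; rfl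
  add_mem' {a b} ha hb := (SmoothMatOn.add ha hb).congr fun p hp => by
    rw [Pi.add_apply]; simp only [extendZero_apply _ hp]; rfl
  neg_mem' {a} ha := (SmoothMatOn.neg ha).congr fun p hp => by
    rw [Pi.neg_apply]; simp only [extendZero_apply _ hp]; rfl
  mul_mem' {a b} ha hb := (SmoothMatOn.mul ha hb).congr fun p hp => by
    rw [Pi.mul_apply]; simp only [extendZero_apply _ hp]; rfl

/-- The restriction to `U` of a function which is smooth on `U`. -/
def restrictSmooth (A : MatFun m n) (hA : SmoothMatOn U A) : smoothRing n U :=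
  ⟨fun p => A p, hA.congr fun p hp => by rw [extendZero_apply _ hp]⟩

/-- `A` restricts to `a` on `U`. -/
def Restricts (A : MatFun m n) (a : smoothRing n U) : Prop := ∀ p (hp : p ∈ U), A p = a.1 ⟨p, hp⟩

theorem restricts_restrictSmooth (A : MatFun m n) (hA : SmoothMatOn U A) :
    Restricts A (restrictSmooth A hA) := fun _ _ => rfl

theorem restricts_extendZero (a : smoothRing n U) : Restricts (extendZero a.1) a :=
  fun _ hp => extendZero_apply _ hp

theorem Restricts.unique {A B : MatFun m n} {a b : smoothRing n U} (h : Restricts A a)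
    (h' : Restricts B b) (e : ∀ p ∈ U, A p = B p) : a = b :=
  Subtype.ext (funext fun p => (h p p.2).symm.trans ((e p p.2).trans (h' p p.2)))

theorem Restricts.eqOn {A B : MatFun m n} {a : smoothRing n U} (h : Restricts A a)
    (h' : Restricts B a) : ∀ p ∈ U, A p = B p := fun p hp => (h p hp).trans (h' p hp).symm

theorem Restricts.add {A B : MatFun m n} {a b : smoothRing n U} (h : Restricts A a)
    (h' : Restricts B b) : Restricts (A + B) (a + b) := fun p hp => by
  rw [Pi.add_apply, h p hp, h' p hp]; rfl

theorem Restricts.mul {A B : MatFun m n} {a b : smoothRing n U} (h : Restricts A a)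
    (h' : Restricts B b) : Restricts (A * B) (a * b) := fun p hp => by
  rw [Pi.mul_apply, h p hp, h' p hp]; rfl

/-- The partial derivatives as derivations of the ring of smooth functions. -/
def partialDer (n : ℕ) (hU : IsOpen U) (ℓ : Fin 3) (i : Fin m) : RingDer (smoothRing n U) where
  toFun a := restrictSmooth (partialDeriv ℓ i (extendZero a.1)) (SmoothMatOn.partialDeriv hU ℓ i a.2)
  map_zero' := by
    refine (restricts_restrictSmooth _ _).unique (B := 0) (fun p hp => rfl) fun p hp => ?_
    rw [partialDeriv_congr hU ℓ i (B := 0) (fun p hp => by rw [extendZero_apply _ hp]; rfl) hp,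
      partialDeriv_zero]
  map_add' a b := by
    refine (restricts_restrictSmooth _ _).unique
      ((restricts_restrictSmooth _ _).add (restricts_restrictSmooth _ _)) fun p hp => ?_
    rw [Pi.add_apply, ← partialDeriv_add hU ℓ i a.2 b.2 hp]
    exact partialDeriv_congr hU ℓ i ((restricts_extendZero _).eqOn
      ((restricts_extendZero a).add (restricts_extendZero b))) hp
  leibniz' a b := by
    refine (restricts_restrictSmooth _ _).unique
      (((restricts_restrictSmooth _ _).mul (restricts_extendZero b)).add
        ((restricts_extendZero a).mul (restricts_restrictSmooth _ _))) fun p hp => ?_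
    refine (partialDeriv_congr hU ℓ i ((restricts_extendZero _).eqOn
      ((restricts_extendZero a).mul (restricts_extendZero b))) hp).trans ?_
    exact partialDeriv_mul hU ℓ i a.2 b.2 hp

theorem Restricts.partialDeriv (hU : IsOpen U) (ℓ : Fin 3) (i : Fin m) {A : MatFun m n}
    {a : smoothRing n U} (h : Restricts A a) :
    Restricts (partialDeriv ℓ i A) (partialDer n hU ℓ i a) := fun _ hp =>
  partialDeriv_congr hU ℓ i (h.eqOn (restricts_extendZero a)) hp

theorem partialDer_comm (hU : IsOpen U) (ℓ ℓ' : Fin 3) (i i' : Fin m) (a : smoothRing n U) :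
    partialDer n hU ℓ i (partialDer n hU ℓ' i' a) =
      partialDer n hU ℓ' i' (partialDer n hU ℓ i a) :=
  (((restricts_extendZero a).partialDeriv hU ℓ' i').partialDeriv hU ℓ i).unique
    (((restricts_extendZero a).partialDeriv hU ℓ i).partialDeriv hU ℓ' i')
    fun _ hp => partialDeriv_comm hU ℓ ℓ' i i' a.2 hp

/-- A finite sum of derivations. -/
def RingDer.sum {R ι : Type*} [Ring R] [Fintype ι] (d : ι → RingDer R) : RingDer R where
  toFun a := ∑ i, d i a
  map_zero' := Finset.sum_eq_zero fun i _ => map_zero (d i)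
  map_add' a b := by simp only [map_add, Finset.sum_add_distrib]
  leibniz' a b := by
    simp only [RingDer.leibniz, Finset.sum_add_distrib, Finset.sum_mul, Finset.mul_sum]

theorem RingDer.sum_apply {R ι : Type*} [Ring R] [Fintype ι] (d : ι → RingDer R) (a : R) :
    RingDer.sum d a = ∑ i, d i a := rfl

/-- The derivation `∂` of the ring of smooth functions. -/
def dXDer (hn : n ≤ m) (hU : IsOpen U) : RingDer (smoothRing n U) :=
  RingDer.sum fun j : Fin n => partialDer n hU 0 (Fin.castLE hn j)

theorem partialDer_dXDer (hn : n ≤ m) (hU : IsOpen U) (ℓ : Fin 3) (i : Fin m)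
    (a : smoothRing n U) :
    partialDer n hU ℓ i (dXDer hn hU a) = dXDer hn hU (partialDer n hU ℓ i a) := by
  simp only [dXDer, RingDer.sum_apply, map_sum]
  exact Finset.sum_congr rfl fun j _ => partialDer_comm hU _ _ _ _ a

/-- Evaluation at a point. -/
def evalHom (n : ℕ) {p : Params m} (hp : p ∈ U) : smoothRing n U →+ Matrix (Fin n) (Fin n) ℂ where
  toFun a := a.1 ⟨p, hp⟩
  map_zero' := rfl
  map_add' _ _ := rfl

theorem Restricts.dX (hn : n ≤ m) (hU : IsOpen U) {A : MatFun m n} {a : smoothRing n U}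
    (h : Restricts A a) : Restricts (dX hn A) (dXDer hn hU a) := fun p hp => by
  have h2 : (dXDer hn hU a).1 ⟨p, hp⟩ =
      ∑ j : Fin n, evalHom n hp (partialDer n hU 0 (Fin.castLE hn j) a) :=
    map_sum (evalHom n hp) _ _
  rw [h2, CubicKP.dX, Finset.sum_apply]
  exact Finset.sum_congr rfl fun j _ => h.partialDeriv hU _ _ p hp

theorem Restricts.dX_iterate (hn : n ≤ m) (hU : IsOpen U) {A : MatFun m n} {a : smoothRing n U}
    (h : Restricts A a) (r : ℕ) : Restricts ((CubicKP.dX hn)^[r] A) ((dXDer hn hU)^[r] a) := by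
  induction r with
  | zero => exact h
  | succ r ih =>
    rw [Function.iterate_succ_apply', Function.iterate_succ_apply']
    exact ih.dX hn hU

end SmoothRing

/-! ### Transfer of the formal calculus to operators with function coefficients -/

namespace PseudoDiffOp

variable {m n : ℕ} {hn : n ≤ m} {U : Set (Params m)} {hU : IsOpen U}

/-- The coefficients of `A` restrict to those of `a` on `U`. -/
def Rep (A : PseudoDiffOp hn) (a : PDO (dXDer hn hU)) : Prop :=
  ∀ k, Restricts (A.coeff k) (a.coeff k)

theorem exists_rep (hU : IsOpen U) (A : PseudoDiffOp hn) (hA : ∀ k, SmoothMatOn U (A.coeff k)) :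
    ∃ a : PDO (dXDer hn hU), Rep A a := by
  obtain ⟨N, hN⟩ := A.bounded
  refine ⟨PDO.mk (fun k => restrictSmooth (A.coeff k) (hA k)) N fun k hk => ?_,
    fun k => restricts_restrictSmooth _ (hA k)⟩
  exact (restricts_restrictSmooth _ (hA k)).unique (B := 0) (fun _ _ => rfl)
    fun p _ => by rw [hN k hk]

variable {A B : PseudoDiffOp hn} {a b : PDO (dXDer hn hU)}

theorem Rep.eqOn (h : Rep A a) (h' : Rep B a) : EqOn U A B := fun k => (h k).eqOn (h' k)

theorem Rep.eq (h : Rep A a) (h' : Rep B b) (e : EqOn U A B) : a = b :=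
  PDO.ext fun k => (h k).unique (h' k) (e k)

theorem Rep.sub (h : Rep A a) (h' : Rep B b) : Rep (A - B) (a - b) := fun k p hp => by
  change A.coeff k p - B.coeff k p = _
  rw [h k p hp, h' k p hp]
  rfl

/-- Both products are given by the same Leibniz sum. Evaluation at a point passes through it because
the sum over the smooth ring has finite support, and openness of U makes iterated derivatives of
restrictions the restrictions of iterated derivatives. -/
theorem Rep.mul (h : Rep A a) (h' : Rep B b) : Rep (A * B) (a * b) := fun k p hp => by
  change _ = evalHom n hp ((a * b).coeff k)
  rw [PDO.coeff_mul, map_finsum _ (PDO.mulTerm_finite a b k)]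
  refine finsum_congr fun s => ?_
  rw [PDO.mulTerm, map_zsmul, h s.1 p hp, (h' (k - s.1 + s.2)).dX_iterate hn hU s.2 p hp]
  rfl

theorem Rep.pos (h : Rep A a) : Rep A.pos a.pos := fun k p hp => by
  change (if 0 ≤ k then A.coeff k else 0) p = _
  rw [PDO.coeff_pos]
  split_ifs
  · exact h k p hp
  · rfl

theorem Rep.paramDeriv (h : Rep A a) (ℓ : Fin 3) (i : Fin n) : Rep (A.paramDeriv ℓ i)
    (PDO.mapDer (partialDer n hU ℓ (Fin.castLE hn i)) (partialDer_dXDer hn hU ℓ _) a) :=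
  fun k => (h k).partialDeriv hU ℓ _

/-- Constant matrices as elements of the ring of smooth functions. -/
def constMat (U : Set (Params m)) (E : Matrix (Fin n) (Fin n) ℂ) : smoothRing n U :=
  restrictSmooth (fun _ => E) (SmoothMatOn.const E)

theorem rep_monomial (E : Matrix (Fin n) (Fin n) ℂ) (s : ℤ) :
    Rep (monomial E s : PseudoDiffOp hn) (PDO.monomial (constMat U E) s : PDO (dXDer hn hU)) :=
  fun k p hp => by
    change (if k = s then fun _ => E else 0 : MatFun m n) p = _
    rw [PDO.coeff_monomial]
    split_ifs <;> rfl

theorem rep_one : Rep (1 : PseudoDiffOp hn) (1 : PDO (dXDer hn hU)) := rep_monomial 1 0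

theorem rep_ofSeq {q : ℕ → MatFun m n} {Q : ℕ → smoothRing n U}
    (h : ∀ k, 1 ≤ k → Restricts (q k) (Q k)) :
    Rep (ofSeq q : PseudoDiffOp hn) (PDO.ofSeq (dXDer hn hU) Q) := fun k p hp => by
  change (if k = 0 then fun _ => 1 else if k < 0 then q k.natAbs else 0 : MatFun m n) p =
    (if k = 0 then 1 else if k < 0 then Q k.natAbs else 0 : smoothRing n U).1 ⟨p, hp⟩
  split_ifs
  · rfl
  · exact h _ (by omega) p hp
  · rfl

theorem partialDer_constMat (hU : IsOpen U) (ℓ : Fin 3) (i : Fin m)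
    (E : Matrix (Fin n) (Fin n) ℂ) : partialDer n hU ℓ i (constMat U E) = 0 := by
  refine ((restricts_restrictSmooth (fun _ => E) _).partialDeriv hU ℓ i).unique (B := 0)
    (fun _ _ => rfl) fun p hp => ?_
  ext a b
  simp [partialDeriv_apply, lineDeriv]

theorem dXDer_constMat (hU : IsOpen U) (E : Matrix (Fin n) (Fin n) ℂ) :
    dXDer hn hU (constMat U E) = 0 :=
  (RingDer.sum_apply _ _).trans (Finset.sum_eq_zero fun _ _ => partialDer_constMat hU _ _ E)

/-- The geometric series is formed over the smooth ring, so its coefficients are automatically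
smooth on U; they are then extended by zero, which does not affect equality on U. -/
theorem exists_isInverseOn (hU : IsOpen U) (q : ℕ → MatFun m n)
    (hq : ∀ k, 1 ≤ k → SmoothMatOn U (q k)) :
    ∃ Q : PseudoDiffOp hn, IsInverseOn U (ofSeq q) Q := by
  classical
  let q' : ℕ → smoothRing n U := fun k => if h : 1 ≤ k then restrictSmooth (q k) (hq k h) else 0
  have hP : Rep (ofSeq q : PseudoDiffOp hn) (PDO.ofSeq (dXDer hn hU) q') := by
    refine rep_ofSeq fun k hk => ?_
    simp only [q', dif_pos hk]
    exact restricts_restrictSmooth _ _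
  obtain ⟨N, hN, hPN⟩ := PDO.ofSeq_eq_sub (δ := dXDer hn hU) q'
  obtain ⟨b, -, h1, h2⟩ := PDO.exists_inverse hN
  rw [← hPN] at h1 h2
  let Q : PseudoDiffOp hn :=
    { coeff := fun k => extendZero (b.coeff k).1
      bounded := by
        obtain ⟨M, hM⟩ := b.exists_ordLE
        refine ⟨M, fun k hk => ?_⟩
        funext p
        rw [hM k hk, extendZero]
        split_ifs <;> rfl }
  have hQ : Rep Q b := fun k => restricts_extendZero _
  refine ⟨Q, fun k => (b.coeff k).2, ?_, ?_⟩
  · exact (hP.mul hQ).eqOn (h1 ▸ rep_one)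
  · exact (hQ.mul hP).eqOn (h2 ▸ rep_one)

/-- The Sato and Zakharov–Shabat equations on an open set on which the sequence extends to a
double sequence of moments with the derivative law of the resolvent. -/
theorem equations_of_moments (hU : IsOpen U) (M : ℕ → ℕ → MatFun m n)
    (hM : ∀ r s, SmoothMatOn U (M r s))
    (hder : ∀ (ℓ : Fin 3) (i : Fin n) (r s : ℕ), ∀ p ∈ U,
      partialDeriv ℓ (Fin.castLE hn i) (M r s) p =
        Matrix.single i i 1 * M (r + ℓ + 1) s p - M r (s + ℓ + 1) p * Matrix.single i i 1 +
          ∑ x ∈ antidiagonal (ℓ : ℕ), M r x.1 p * Matrix.single i i 1 * M x.2 s p)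
    {q : ℕ → MatFun m n} (hq : ∀ s, ∀ p ∈ U, q (s + 1) p = M 0 s p)
    {P Q : PseudoDiffOp hn} (hP : P = ofSeq q) (hPQ : IsInverseOn U P Q) :
    (∀ (ℓ : Fin 3) (i : Fin n),
      EqOn U (P.paramDeriv ℓ i) (laxOp P Q ℓ i * P - P * unitPow ℓ i)) ∧
    ∀ (ℓ ℓ' : Fin 3) (i j : Fin n),
      EqOn U ((laxOp P Q ℓ i).paramDeriv ℓ' j - (laxOp P Q ℓ' j).paramDeriv ℓ i)
        (laxOp P Q ℓ' j * laxOp P Q ℓ i - laxOp P Q ℓ i * laxOp P Q ℓ' j) := by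
  let M' : ℕ → ℕ → smoothRing n U := fun r s => restrictSmooth (M r s) (hM r s)
  let E : Fin n → smoothRing n U := fun i => constMat U (Matrix.single i i 1)
  have hr : ∀ r s, Restricts (M r s) (M' r s) := fun r s => restricts_restrictSmooth _ _
  have hd : ∀ (ℓ : Fin 3) (i : Fin n) (r s : ℕ), partialDer n hU ℓ (Fin.castLE hn i) (M' r s) =
      E i * M' (r + ℓ + 1) s - M' r (s + ℓ + 1) * E i +
        ∑ x ∈ antidiagonal (ℓ : ℕ), M' r x.1 * E i * M' x.2 s := by
    intro ℓ i r s
    apply Subtype.ext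
    funext p
    refine (((hr r s).partialDeriv hU ℓ _) p p.2).symm.trans ((hder ℓ i r s p p.2).trans ?_)
    have h : ∑ x ∈ antidiagonal (ℓ : ℕ), M r x.1 p * Matrix.single i i 1 * M x.2 s p =
        evalHom n p.2 (∑ x ∈ antidiagonal (ℓ : ℕ), M' r x.1 * E i * M' x.2 s) := by
      rw [map_sum]
      rfl
    rw [h]
    rfl
  -- Since the E_i sum to the identity, summing the first flows yields a law for ∂ in which no E_i
  -- is left.
  have hE : ∑ i, E i = 1 := by
    apply Subtype.ext
    funext p
    change evalHom n p.2 (∑ i, E i) = 1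
    rw [map_sum]
    change ∑ i, Matrix.single i i (1 : ℂ) = 1
    exact Matrix.sum_single_one
  have hδ : ∀ r s, dXDer hn hU (M' r s) = M' (r + 1) s - M' r (s + 1) + M' r 0 * M' 0 s := by
    intro r s
    have h : dXDer hn hU (M' r s) = (∑ i, E i) * M' (r + 1) s - M' r (s + 1) * (∑ i, E i) +
        M' r 0 * (∑ i, E i) * M' 0 s := by
      rw [dXDer, RingDer.sum_apply, Finset.sum_congr rfl fun i _ => hd 0 i r s,
        Finset.sum_add_distrib, Finset.sum_sub_distrib, Finset.sum_mul, Finset.mul_sum,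
        Finset.mul_sum, Finset.sum_mul]
      simp
    rw [h, hE, one_mul, mul_one, mul_one]
  obtain ⟨b, hb⟩ := exists_rep hU Q hPQ.1
  have hPr : Rep P (PDO.ofSeq (dXDer hn hU) fun k => M' 0 (k - 1)) := by
    rw [hP]
    refine rep_ofSeq fun k hk p hp => ?_
    obtain ⟨s, rfl⟩ := Nat.exists_eq_add_of_le' hk
    exact (hq s p hp).trans (hr 0 s p hp)
  set a := PDO.ofSeq (dXDer hn hU) fun k => M' 0 (k - 1) with ha
  have hab : a * b = 1 := (hPr.mul hb).eq rep_one hPQ.2.1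
  have hba : b * a = 1 := (hb.mul hPr).eq rep_one hPQ.2.2
  let e : Fin 3 → Fin n → PDO (dXDer hn hU) := fun ℓ i => PDO.monomial (E i) ((ℓ : ℕ) + 1)
  have he : ∀ ℓ i, Rep (unitPow ℓ i : PseudoDiffOp hn) (e ℓ i) := fun ℓ i => rep_monomial _ _
  have hL : ∀ ℓ i, Rep (laxOp P Q ℓ i) (a * e ℓ i * b).pos := fun ℓ i =>
    ((hPr.mul (he ℓ i)).mul hb).pos
  have hsato : ∀ (ℓ : Fin 3) (i : Fin n), PDO.mapDer (partialDer n hU ℓ (Fin.castLE hn i))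
      (partialDer_dXDer hn hU ℓ _) a = (a * e ℓ i * b).pos * a - a * e ℓ i := by
    intro ℓ i
    refine PDO.sato M' hδ _ _ (dXDer_constMat hU _) ℓ (fun s => ?_) ha hab hba
    rw [hd, zero_add]
  refine ⟨fun ℓ i => ?_, fun ℓ ℓ' i j => ?_⟩
  · refine (hPr.paramDeriv ℓ i).eqOn ?_
    rw [hsato]
    exact ((hL ℓ i).mul hPr).sub (hPr.mul (he ℓ i))
  · refine (((hL ℓ i).paramDeriv ℓ' j).sub ((hL ℓ' j).paramDeriv ℓ i)).eqOn ?_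
    -- The bare operators E_i ∂^ℓ commute, being constant diagonal matrices times powers of ∂; this
    -- is the flatness that dressing by P transports to the Lax operators.
    have hcomm : e ℓ i * e ℓ' j = e ℓ' j * e ℓ i := by
      ext k : 1
      rw [PDO.coeff_mul_monomial _ (dXDer_constMat hU _),
        PDO.coeff_mul_monomial _ (dXDer_constMat hU _), PDO.coeff_monomial, PDO.coeff_monomial]
      have hEE : E i * E j = E j * E i := by
        apply Subtype.ext
        funext p
        change (Matrix.single i i (1 : ℂ)) * Matrix.single j j 1 =
          Matrix.single j j 1 * Matrix.single i i 1
        by_cases hij : i = j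
        · rw [hij]
        · rw [Matrix.single_mul_single_of_ne _ _ _ _ hij,
            Matrix.single_mul_single_of_ne _ _ _ _ (Ne.symm hij)]
      split_ifs
      · exact hEE
      · omega
      · omega
      · rw [zero_mul, zero_mul]
    have hconst : ∀ (ℓ ℓ' : Fin 3) (i j : Fin n),
        PDO.mapDer (partialDer n hU ℓ (Fin.castLE hn i)) (partialDer_dXDer hn hU ℓ _) (e ℓ' j) =
          0 := by
      intro ℓ ℓ' i j
      ext k : 1
      rw [PDO.coeff_mapDer, PDO.coeff_monomial]
      split_ifs
      · exact partialDer_constMat hU _ _ _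
      · exact map_zero _
    have hdd : ∀ x : PDO (dXDer hn hU),
        PDO.mapDer (partialDer n hU ℓ' (Fin.castLE hn j)) (partialDer_dXDer hn hU ℓ' _)
          (PDO.mapDer (partialDer n hU ℓ (Fin.castLE hn i)) (partialDer_dXDer hn hU ℓ _) x) =
        PDO.mapDer (partialDer n hU ℓ (Fin.castLE hn i)) (partialDer_dXDer hn hU ℓ _)
          (PDO.mapDer (partialDer n hU ℓ' (Fin.castLE hn j)) (partialDer_dXDer hn hU ℓ' _) x) := by
      intro x
      ext k : 1
      exact partialDer_comm hU _ _ _ _ _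
    rw [zakharovShabat_of_sato _ _ (hdd a) hab hcomm (hconst _ _ _ _) (hconst _ _ _ _)
      (hsato ℓ i) (hsato ℓ' j)]
    exact ((hL ℓ' j).mul (hL ℓ i)).sub ((hL ℓ i).mul (hL ℓ' j))

end PseudoDiffOp

end CubicKP

namespace CubicKP

/-! ### The measure and the density of an admissible set -/

theorem SimpleContour.measurableSet_dom (γ : SimpleContour) : MeasurableSet γ.dom := by
  rcases γ.closed_or_infinite with ⟨T, -, h, -⟩ | ⟨h, -⟩
  · rw [h]; exact measurableSet_Ico
  · rw [h]; exact MeasurableSet.univ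

/-- Lusin–Souslin: an injective continuous image of a Borel set of the line is Borel. Simplicity of
the contour is what makes this applicable. -/
theorem SimpleContour.measurableSet_image (γ : SimpleContour) {s : Set ℝ} (hs : MeasurableSet s)
    (h : s ⊆ γ.dom) : MeasurableSet (γ.toFun '' s) :=
  hs.image_of_continuousOn_injOn γ.regular.1.continuousOn (γ.simple.mono h)

theorem SimpleContour.measurableSet_trace (γ : SimpleContour) : MeasurableSet γ.trace :=
  γ.measurableSet_image γ.measurableSet_dom subset_rfl

theorem SimpleContour.ae_mem_trace (γ : SimpleContour) : ∀ᵐ z ∂γ.arcLength, z ∈ γ.trace := by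
  have hm : MeasurableSet {z | z ∈ γ.trace} := γ.measurableSet_trace
  rw [SimpleContour.arcLength, ae_map_iff γ.regular.1.measurable.aemeasurable hm]
  refine (withDensity_absolutelyContinuous _ _).ae_le ?_
  filter_upwards [ae_restrict_mem γ.measurableSet_dom] with t ht
  exact mem_image_of_mem _ ht

theorem SimpleContour.tangent_eq_zero (γ : SimpleContour) {z : ℂ} (hz : z ∉ γ.trace) :
    γ.tangent z = 0 := by
  unfold SimpleContour.tangent
  have h : ∀ t, ¬ (t ∈ γ.dom ∧ γ.toFun t = z) := fun t ht => hz ⟨t, ht.1, ht.2⟩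
  simp [h]

theorem SimpleContour.norm_tangent_le (γ : SimpleContour) (z : ℂ) : ‖γ.tangent z‖ ≤ 1 := by
  by_cases hz : z ∈ γ.trace
  · obtain ⟨t, ht, rfl⟩ := hz
    rw [γ.tangent_apply ht, norm_div, Complex.norm_real, norm_norm]
    exact div_self_le_one _
  · rw [γ.tangent_eq_zero hz, norm_zero]
    exact zero_le_one

/-- A preimage under the tangent is the curve's image of a Borel set of parameters, together with
the complement of the trace when 0 lies in the target set. -/
theorem SimpleContour.measurable_tangent (γ : SimpleContour) : Measurable γ.tangent := by
  intro s hs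
  let φ : ℝ → ℂ := fun t => deriv γ.toFun t / (‖deriv γ.toFun t‖ : ℂ)
  have hφ : Measurable φ := (measurable_deriv _).div
    (Complex.measurable_ofReal.comp (measurable_deriv _).norm)
  have h : γ.tangent ⁻¹' s = γ.toFun '' (γ.dom ∩ φ ⁻¹' s) ∪
      (γ.traceᶜ ∩ (fun _ => (0 : ℂ)) ⁻¹' s) := by
    ext z
    by_cases hz : z ∈ γ.trace
    · obtain ⟨t, ht, rfl⟩ := hz
      have htr : γ.toFun t ∈ γ.trace := mem_image_of_mem _ ht
      simp only [mem_preimage, γ.tangent_apply ht, mem_union, mem_image, mem_inter_iff,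
        mem_compl_iff, htr, not_true, false_and, or_false]
      refine ⟨fun h => ⟨t, ⟨ht, h⟩, rfl⟩, ?_⟩
      rintro ⟨t', ⟨ht', h⟩, e⟩
      rwa [γ.simple ht' ht e] at h
    · have hz' : z ∉ γ.toFun '' (γ.dom ∩ φ ⁻¹' s) := fun h' =>
        hz (image_mono inter_subset_left h')
      simp only [mem_preimage, γ.tangent_eq_zero hz, mem_union, hz', false_or, mem_inter_iff,
        mem_compl_iff, hz, not_false_eq_true, true_and]
  rw [h]
  exact (γ.measurableSet_image (γ.measurableSet_dom.inter (hφ hs)) inter_subset_left).union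
    (γ.measurableSet_trace.compl.inter (measurable_const hs))

theorem Locus.measurableSet_carrier (Ω : Locus) : MeasurableSet Ω.carrier := by
  cases Ω with
  | discrete S hS =>
    have h : S = ⋃ k : ℕ, S ∩ Metric.closedBall 0 k := by
      rw [← inter_iUnion, Metric.iUnion_closedBall_nat, inter_univ]
    change MeasurableSet S
    rw [h]
    exact (Set.countable_iUnion fun k : ℕ => (hS k).countable).measurableSet
  | contours N γ hγ => exact MeasurableSet.iUnion fun i => (γ i).measurableSet_trace

theorem Locus.ae_mem_carrier (Ω : Locus) : ∀ᵐ u ∂Ω.measure, u ∈ Ω.carrier := by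
  have hm := Ω.measurableSet_carrier
  cases Ω with
  | discrete S hS => exact ae_restrict_mem hm
  | contours N γ hγ =>
    change (∑ i, (γ i).arcLength) _ = 0
    rw [Measure.finsetSum_apply]
    refine Finset.sum_eq_zero fun i _ => ?_
    refine measure_mono_null (compl_subset_compl.mpr ?_) (γ i).ae_mem_trace
    exact subset_iUnion (fun i => (γ i).trace) i

theorem Locus.measurable_density (Ω : Locus) : Measurable Ω.density := by
  cases Ω with
  | discrete S hS => exact measurable_const
  | contours N γ hγ => exact Finset.measurable_fun_sum _ fun i _ => (γ i).measurable_tangent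

theorem Locus.exists_norm_density_le (Ω : Locus) : ∃ C : ℝ, ∀ u, ‖Ω.density u‖ ≤ C := by
  cases Ω with
  | discrete S hS => exact ⟨1, fun u => (norm_one (α := ℂ)).le⟩
  | contours N γ hγ =>
    refine ⟨∑ _i : Fin N, 1, fun u => (norm_sum_le _ _).trans ?_⟩
    exact Finset.sum_le_sum fun i _ => (γ i).norm_tangent_le u

end CubicKP

namespace CubicKP

/-! ### Pointwise estimates -/

/-- The exponent `∑_ℓ p ℓ j z^(ℓ+1)`. -/
def phase {m : ℕ} (p : Params m) (j : Fin m) (z : ℂ) : ℂ :=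
  ∑ ℓ : Fin 3, (p ℓ j : ℂ) * z ^ ((ℓ : ℕ) + 1)

theorem dressing_castSucc {m : ℕ} (p : Params m) (z : ℂ) (j : Fin m) :
    dressing p z j.castSucc = Complex.exp (phase p j z) := by
  rw [dressing, Fin.snoc_castSucc, phase, Fin.sum_univ_three]
  congr 1
  simp
  ring

theorem dressing_last {m : ℕ} (p : Params m) (z : ℂ) : dressing p z (Fin.last m) = 1 := by
  rw [dressing, Fin.snoc_last]

theorem phase_add {m : ℕ} (p q : Params m) (j : Fin m) (z : ℂ) :
    phase (p + q) j z = phase p j z + phase q j z := by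
  simp only [phase, Pi.add_apply, Complex.ofReal_add, add_mul, Finset.sum_add_distrib]

/-- The sum of the `|Re u^ℓ|`, `ℓ = 1, 2, 3`. -/
def reWeight (u : ℂ) : ℝ := ∑ ℓ : Fin 3, |(u ^ ((ℓ : ℕ) + 1)).re|

theorem reWeight_nonneg (u : ℂ) : 0 ≤ reWeight u := Finset.sum_nonneg fun _ _ => abs_nonneg _

theorem abs_param_le {m : ℕ} (δ : Params m) (ℓ : Fin 3) (j : Fin m) : |δ ℓ j| ≤ ‖δ‖ :=
  (norm_le_pi_norm (δ ℓ) j).trans (norm_le_pi_norm δ ℓ)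

theorem abs_re_phase_le {m : ℕ} (δ : Params m) (j : Fin m) (u : ℂ) :
    |(phase δ j u).re| ≤ ‖δ‖ * reWeight u := by
  rw [phase, Complex.re_sum, reWeight, Finset.mul_sum]
  refine (Finset.abs_sum_le_sum_abs _ _).trans (Finset.sum_le_sum fun ℓ _ => ?_)
  rw [Complex.re_ofReal_mul, abs_mul]
  exact mul_le_mul_of_nonneg_right (abs_param_le δ ℓ j) (abs_nonneg _)

theorem norm_phase_le {m : ℕ} (δ : Params m) (j : Fin m) (u : ℂ) :
    ‖phase δ j u‖ ≤ 3 * ‖δ‖ * (1 + ‖u‖) ^ 3 := by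
  have h : ∀ ℓ : Fin 3, ‖(δ ℓ j : ℂ) * u ^ ((ℓ : ℕ) + 1)‖ ≤ ‖δ‖ * (1 + ‖u‖) ^ 3 := by
    intro ℓ
    rw [norm_mul, Complex.norm_real, norm_pow]
    refine mul_le_mul (abs_param_le δ ℓ j) ?_ (by positivity) (norm_nonneg _)
    refine (pow_le_pow_left₀ (norm_nonneg u) (by linarith : ‖u‖ ≤ 1 + ‖u‖) _).trans ?_
    exact pow_le_pow_right₀ (by linarith [norm_nonneg u]) (by omega)
  refine (norm_sum_le _ _).trans ((Finset.sum_le_sum fun ℓ _ => h ℓ).trans_eq ?_)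
  simp
  ring

/-- The divided difference of `phase`. -/
def phaseSlope {m : ℕ} (δ : Params m) (j : Fin m) (u v : ℂ) : ℂ :=
  ∑ ℓ : Fin 3, (δ ℓ j : ℂ) * ∑ x ∈ antidiagonal (ℓ : ℕ), v ^ x.1 * u ^ x.2

theorem phaseSlope_mul {m : ℕ} (δ : Params m) (j : Fin m) (u v : ℂ) :
    phaseSlope δ j u v * (u - v) = phase δ j u - phase δ j v := by
  rw [phaseSlope, phase, phase, ← Finset.sum_sub_distrib, Finset.sum_mul]
  refine Finset.sum_congr rfl fun ℓ _ => ?_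
  have h := geom_sum₂_mul v u ((ℓ : ℕ) + 1)
  rw [Finset.Nat.sum_antidiagonal_eq_sum_range_succ (fun i j => v ^ i * u ^ j)]
  simp only [Nat.add_sub_cancel] at h
  linear_combination -(δ ℓ j : ℂ) * h

theorem norm_phaseSlope_le {m : ℕ} (δ : Params m) (j : Fin m) (u v : ℂ) :
    ‖phaseSlope δ j u v‖ ≤ 9 * ‖δ‖ * ((1 + ‖u‖) ^ 2 * (1 + ‖v‖) ^ 2) := by
  have hu := norm_nonneg u
  have hv := norm_nonneg v
  have h : ∀ ℓ : Fin 3, ‖(δ ℓ j : ℂ) * ∑ x ∈ antidiagonal (ℓ : ℕ), v ^ x.1 * u ^ x.2‖ ≤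
      ‖δ‖ * (3 * ((1 + ‖u‖) ^ 2 * (1 + ‖v‖) ^ 2)) := by
    intro ℓ
    rw [norm_mul, Complex.norm_real]
    refine mul_le_mul (abs_param_le δ ℓ j) ?_ (norm_nonneg _) (norm_nonneg _)
    have h1 : ∀ x ∈ antidiagonal (ℓ : ℕ), ‖v ^ x.1 * u ^ x.2‖ ≤
        (1 + ‖u‖) ^ 2 * (1 + ‖v‖) ^ 2 := by
      intro x hx
      have hx' := Finset.HasAntidiagonal.mem_antidiagonal.mp hx
      rw [norm_mul, norm_pow, norm_pow, mul_comm]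
      refine mul_le_mul ?_ ?_ (by positivity) (by positivity)
      · exact (pow_le_pow_left₀ hu (by linarith : ‖u‖ ≤ 1 + ‖u‖) _).trans
          (pow_le_pow_right₀ (by linarith) (by omega))
      · exact (pow_le_pow_left₀ hv (by linarith : ‖v‖ ≤ 1 + ‖v‖) _).trans
          (pow_le_pow_right₀ (by linarith) (by omega))
    refine (norm_sum_le _ _).trans ((Finset.sum_le_sum h1).trans ?_)
    rw [Finset.sum_const, Finset.Nat.card_antidiagonal, nsmul_eq_mul]
    refine mul_le_mul_of_nonneg_right ?_ (by positivity)
    have : (ℓ : ℕ) + 1 ≤ 3 := by omega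
    exact_mod_cast this
  refine (norm_sum_le _ _).trans ((Finset.sum_le_sum fun ℓ _ => h ℓ).trans_eq ?_)
  simp
  ring

/-- Only Re w may appear in the exponent, because moving the parameters controls only the real parts
of u^ℓ. For ‖w‖ ≥ 1 each of the three terms is at most ‖w‖² exp|Re w|. -/
theorem norm_exp_sub_one_sub_le (w : ℂ) :
    ‖Complex.exp w - 1 - w‖ ≤ 3 * ‖w‖ ^ 2 * Real.exp |w.re| := by
  have h1 : 1 ≤ Real.exp |w.re| := Real.one_le_exp (abs_nonneg _)
  rcases le_total ‖w‖ 1 with h | h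
  · refine (Complex.norm_exp_sub_one_sub_id_le h).trans ?_
    nlinarith [sq_nonneg ‖w‖, mul_nonneg (sq_nonneg ‖w‖) (sub_nonneg.mpr h1)]
  · have h2 : ‖Complex.exp w - 1 - w‖ ≤ Real.exp |w.re| + 1 + ‖w‖ := by
      refine (norm_sub_le _ _).trans (add_le_add_left ((norm_sub_le _ _).trans ?_) _)
      rw [norm_one, Complex.norm_exp]
      exact add_le_add_left (Real.exp_le_exp.mpr (le_abs_self _)) _
    have h3 : ‖w‖ ≤ ‖w‖ ^ 2 := by nlinarith
    have h4 : 1 ≤ ‖w‖ ^ 2 := by nlinarith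
    have h5 : ‖w‖ ^ 2 ≤ ‖w‖ ^ 2 * Real.exp |w.re| := le_mul_of_one_le_right (by positivity) h1
    have h6 : Real.exp |w.re| ≤ ‖w‖ ^ 2 * Real.exp |w.re| :=
      le_mul_of_one_le_left (by positivity) h4
    linarith

/-- The real parts of u and u² already control |u|, since |u|² = 2 (Re u)² - Re(u²) ≤ (1 + 2 W)² for
the weight W. The quadratic parameters are thus essential: Re u alone is blind to the imaginary
direction. -/
theorem one_add_norm_le_reWeight (u : ℂ) : 1 + ‖u‖ ≤ 2 * (1 + reWeight u) := by
  have h1 : |u.re| ≤ reWeight u := by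
    have := Finset.single_le_sum (f := fun ℓ : Fin 3 => |(u ^ ((ℓ : ℕ) + 1)).re|)
      (fun _ _ => abs_nonneg _) (Finset.mem_univ 0)
    simpa [reWeight] using this
  have h2 : |(u ^ 2).re| ≤ reWeight u := by
    have := Finset.single_le_sum (f := fun ℓ : Fin 3 => |(u ^ ((ℓ : ℕ) + 1)).re|)
      (fun _ _ => abs_nonneg _) (Finset.mem_univ 1)
    simpa [reWeight] using this
  have h3 : (u ^ 2).re = u.re ^ 2 - u.im ^ 2 := by rw [sq, Complex.mul_re]; ring
  have h4 : ‖u‖ ^ 2 = u.re ^ 2 + u.im ^ 2 := by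
    rw [Complex.sq_norm, Complex.normSq_apply]; ring
  have h5 := neg_abs_le (u ^ 2).re
  have h6 : u.re ^ 2 ≤ reWeight u ^ 2 := by
    rw [← sq_abs]
    exact pow_le_pow_left₀ (abs_nonneg _) h1 2
  have h0 := reWeight_nonneg u
  have h7 : ‖u‖ ^ 2 ≤ (1 + 2 * reWeight u) ^ 2 := by nlinarith
  have h8 := abs_le_of_sq_le_sq h7 (by linarith)
  rw [abs_of_nonneg (norm_nonneg u)] at h8
  linarith

/-- Linear growth is absorbed by exp(a W) with a = ε/(N+1), and the N-th power then costs at most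
exp(ε W). -/
theorem exists_growth {ε : ℝ} (hε : 0 < ε) (N : ℕ) :
    ∃ C : ℝ, 0 ≤ C ∧ ∀ u : ℂ, (1 + ‖u‖) ^ N ≤ C * Real.exp (ε * reWeight u) := by
  have hN : (0 : ℝ) < N + 1 := by positivity
  set a : ℝ := ε / (N + 1) with ha
  have ha0 : 0 < a := div_pos hε hN
  set K : ℝ := max 1 a⁻¹ with hK
  have hK1 : 1 ≤ K := le_max_left _ _
  have hK2 : 1 ≤ K * a := by
    calc (1 : ℝ) = a⁻¹ * a := (inv_mul_cancel₀ ha0.ne').symm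
      _ ≤ K * a := mul_le_mul_of_nonneg_right (le_max_right _ _) ha0.le
  refine ⟨(2 * K) ^ N, by positivity, fun u => ?_⟩
  have h0 := reWeight_nonneg u
  have h1 : 1 + reWeight u ≤ K * Real.exp (a * reWeight u) := by
    have h2 := Real.add_one_le_exp (a * reWeight u)
    have h3 := mul_le_mul_of_nonneg_left h2 (by linarith : 0 ≤ K)
    nlinarith [mul_le_mul_of_nonneg_right hK2 h0]
  have h2 : 1 + ‖u‖ ≤ 2 * K * Real.exp (a * reWeight u) := by
    linarith [one_add_norm_le_reWeight u]
  refine (pow_le_pow_left₀ (by positivity) h2 N).trans ?_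
  rw [mul_pow, ← Real.exp_nat_mul]
  refine mul_le_mul_of_nonneg_left (Real.exp_le_exp.mpr ?_) (by positivity)
  rw [← mul_assoc]
  refine mul_le_mul_of_nonneg_right ?_ h0
  rw [ha, mul_div_assoc', div_le_iff₀ hN]
  nlinarith

/-! ### Square integrable families with exponential parameter dependence -/

theorem Locus.toL2_eq (Ω : Locus) {φ : ℂ → ℂ} (h : MemLp φ 2 Ω.measure) :
    Ω.toL2 φ = h.toLp φ := dif_pos h

theorem Locus.coeFn_toL2 (Ω : Locus) {φ : ℂ → ℂ} (h : MemLp φ 2 Ω.measure) :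
    Ω.toL2 φ =ᵐ[Ω.measure] φ := by
  rw [Ω.toL2_eq h]
  exact h.coeFn_toLp

theorem Locus.coeFn_sum_smul (Ω : Locus) {ι 𝕜 : Type*} [NormedRing 𝕜] [Module 𝕜 ℂ]
    [IsBoundedSMul 𝕜 ℂ] (t : Finset ι) (c : ι → 𝕜)
    (f : ι → Ω.L2) :
    (∑ i ∈ t, c i • f i : Ω.L2) =ᵐ[Ω.measure] fun u => ∑ i ∈ t, c i • f i u := by
  have h : ∀ᵐ u ∂Ω.measure, ∀ i ∈ t, (c i • f i : Ω.L2) u = c i • f i u :=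
    (Filter.eventually_all_finset t).mpr fun i _ => by
      filter_upwards [Lp.coeFn_smul (c i) (f i)] with u hu
      rw [hu, Pi.smul_apply]
  filter_upwards [Lp.coeFn_fun_finsetSum t fun i => c i • f i, h] with u h1 h2
  rw [h1, Finset.sum_congr rfl h2]

/-- The linear map with prescribed values on the coordinate directions. -/
def dirSum {m : ℕ} {E : Type*} [NormedAddCommGroup E] [NormedSpace ℝ E] (X : Fin 3 → Fin m → E) :
    Params m →L[ℝ] E :=
  ∑ ℓ, ∑ i, ((ContinuousLinearMap.proj (R := ℝ) (φ := fun _ : Fin m => ℝ) i).comp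
    (ContinuousLinearMap.proj (R := ℝ) (φ := fun _ : Fin 3 => Fin m → ℝ) ℓ)).smulRight (X ℓ i)

theorem dirSum_apply {m : ℕ} {E : Type*} [NormedAddCommGroup E] [NormedSpace ℝ E]
    (X : Fin 3 → Fin m → E) (δ : Params m) : dirSum X δ = ∑ ℓ, ∑ i, δ ℓ i • X ℓ i := by
  simp [dirSum, sum_apply]

theorem dirSum_paramDir {m : ℕ} {E : Type*} [NormedAddCommGroup E] [NormedSpace ℝ E]
    (X : Fin 3 → Fin m → E) (ℓ : Fin 3) (i : Fin m) : dirSum X (paramDir ℓ i) = X ℓ i := by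
  rw [dirSum_apply, Finset.sum_eq_single ℓ, Finset.sum_eq_single i]
  · simp [paramDir]
  · intro j _ hj
    simp [paramDir, hj]
  · simp
  · intro l _ hl
    simp [paramDir, hl]
  · simp

theorem eq_dirSum {m : ℕ} {E : Type*} [NormedAddCommGroup E] [NormedSpace ℝ E]
    (L : Params m →L[ℝ] E) : L = dirSum fun ℓ i => L (paramDir ℓ i) := by
  ext δ
  rw [dirSum_apply]
  have h : δ = ∑ ℓ : Fin 3, ∑ i : Fin m, δ ℓ i • paramDir ℓ i := by
    funext ℓ i
    rw [Finset.sum_apply, Finset.sum_apply, Finset.sum_eq_single ℓ]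
    · rw [Finset.sum_apply, Finset.sum_apply, Finset.sum_eq_single i]
      · simp [paramDir]
      · intro j _ hj
        simp [paramDir, hj.symm]
      · simp
    · intro l _ hl
      simp [paramDir, hl.symm, Finset.sum_apply]
    · simp
  conv_lhs => rw [h]
  simp only [map_sum, map_smul]

theorem hasFDerivAt_of_norm_le_sq {E F : Type*} [NormedAddCommGroup E] [NormedSpace ℝ E]
    [NormedAddCommGroup F] [NormedSpace ℝ F] {f : E → F} {f' : E →L[ℝ] F} {x : E} (C : ℝ)
    (h : ∀ᶠ y in 𝓝 x, ‖f y - f x - f' (y - x)‖ ≤ C * ‖y - x‖ ^ 2) : HasFDerivAt f f' x := by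
  refine HasFDerivAt.of_isLittleO ?_
  have h1 : (fun y => f y - f x - f' (y - x)) =O[𝓝 x] fun y => ‖y - x‖ ^ 2 := by
    refine Asymptotics.IsBigO.of_bound C ?_
    filter_upwards [h] with y hy
    rwa [norm_pow, norm_norm]
  refine h1.trans_isLittleO ?_
  have h2 : (fun y : E => ‖y - x‖ ^ 2) =o[𝓝 x] fun y => y - x := by
    have h3 := (Asymptotics.isLittleO_norm_pow_id (E' := E) one_lt_two).comp_tendsto
      (tendsto_sub_nhds_zero_iff.mpr (tendsto_id (x := 𝓝 x)))
    exact h3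
  exact h2

section Family

variable {m : ℕ} {Ω : Locus} {V : Set (Params m)} {s : ℝ} {j : Fin m} {θ : ℂ → ℂ}

/-- The functions `u^k exp(± phase) θ(u)`. -/
def expFamily (s : ℝ) (j : Fin m) (θ : ℂ → ℂ) (k : ℕ) (p : Params m) (u : ℂ) : ℂ :=
  u ^ k * (Complex.exp (s * phase p j u) * θ u)

/-- At every u some sign pattern of shifts of the parameters by 2ε multiplies the modulus by exactly
exp(2ε W(u)). The sum over the eight shifted functions is square integrable and dominates; half of
the exponent pays for the polynomial factor, the other half remains for Taylor remainders. -/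
theorem exists_dominating (hs : s = 1 ∨ s = -1)
    (hθ : ∀ p ∈ V, MemLp (fun u => Complex.exp (s * phase p j u) * θ u) 2 Ω.measure)
    {p : Params m} {ε : ℝ} (hε : 0 < ε) (hV : Metric.closedBall p (2 * ε) ⊆ V) (N : ℕ) :
    ∃ D : ℂ → ℝ, MemLp D 2 Ω.measure ∧ (∀ u, 0 ≤ D u) ∧ ∀ u,
      (1 + ‖u‖) ^ N * (‖Complex.exp (s * phase p j u) * θ u‖ * Real.exp (ε * reWeight u)) ≤
        D u := by
  obtain ⟨C, hC, hgrow⟩ := exists_growth hε N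
  let σ : Bool → ℝ := fun b => if b then 1 else -1
  -- One sign for each of the three powers u, u², u³, the same for all components.
  let q : (Fin 3 → Bool) → Params m := fun b => p + fun ℓ _ => 2 * ε * σ (b ℓ)
  have hσ : ∀ b, |σ b| = 1 := by intro b; cases b <;> simp [σ]
  have hq : ∀ b, q b ∈ V := by
    intro b
    apply hV
    rw [Metric.mem_closedBall, dist_eq_norm, add_sub_cancel_left]
    refine (pi_norm_le_iff_of_nonneg (by positivity)).mpr fun ℓ =>
      (pi_norm_le_iff_of_nonneg (by positivity)).mpr fun _ => ?_
    rw [Real.norm_eq_abs, abs_mul, hσ, mul_one, abs_of_pos (by positivity)]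
  refine ⟨fun u => C * ∑ b, ‖Complex.exp (s * phase (q b) j u) * θ u‖, ?_, ?_, ?_⟩
  · exact (memLp_finsetSum _ fun b _ => (hθ _ (hq b)).norm).const_mul C
  · intro u; positivity
  · intro u
    have hex : ∀ ℓ : Fin 3, ∃ b : Bool, s * σ b * (u ^ ((ℓ : ℕ) + 1)).re =
        |(u ^ ((ℓ : ℕ) + 1)).re| := by
      intro ℓ
      rcases le_total 0 (u ^ ((ℓ : ℕ) + 1)).re with h | h <;> rcases hs with rfl | rfl
      · exact ⟨true, by simp only [σ, if_true]; rw [abs_of_nonneg h]; ring⟩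
      · exact ⟨false, by simp [σ, abs_of_nonneg h]⟩
      · exact ⟨false, by simp [σ, abs_of_nonpos h]⟩
      · exact ⟨true, by simp [σ, abs_of_nonpos h]⟩
    choose b hb using hex
    have hre : (s * phase (q b) j u).re = (s * phase p j u).re + 2 * ε * reWeight u := by
      rw [phase_add, mul_add, Complex.add_re]
      congr 1
      rw [Complex.re_ofReal_mul, phase, Complex.re_sum, reWeight, Finset.mul_sum, Finset.mul_sum]
      refine Finset.sum_congr rfl fun ℓ _ => ?_
      rw [Complex.re_ofReal_mul, ← hb ℓ]
      ring
    have h1 : ‖Complex.exp (s * phase p j u) * θ u‖ * Real.exp (2 * ε * reWeight u) =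
        ‖Complex.exp (s * phase (q b) j u) * θ u‖ := by
      rw [norm_mul, norm_mul, Complex.norm_exp, Complex.norm_exp, hre, Real.exp_add]
      ring
    have h2 : ‖Complex.exp (s * phase (q b) j u) * θ u‖ ≤
        ∑ b, ‖Complex.exp (s * phase (q b) j u) * θ u‖ :=
      Finset.single_le_sum (f := fun b => ‖Complex.exp (s * phase (q b) j u) * θ u‖)
        (fun _ _ => norm_nonneg _) (Finset.mem_univ b)
    calc _ ≤ C * Real.exp (ε * reWeight u) *
          (‖Complex.exp (s * phase p j u) * θ u‖ * Real.exp (ε * reWeight u)) :=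
          mul_le_mul_of_nonneg_right (hgrow u) (by positivity)
      _ = C * (‖Complex.exp (s * phase p j u) * θ u‖ * Real.exp (2 * ε * reWeight u)) := by
          rw [two_mul, add_mul, Real.exp_add]; ring
      _ ≤ _ := by rw [h1]; exact mul_le_mul_of_nonneg_left h2 hC

theorem memLp_expFamily (hs : s = 1 ∨ s = -1) (hV : IsOpen V)
    (hθ : ∀ p ∈ V, MemLp (fun u => Complex.exp (s * phase p j u) * θ u) 2 Ω.measure)
    {p : Params m} (hp : p ∈ V) (k : ℕ) : MemLp (expFamily s j θ k p) 2 Ω.measure := by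
  obtain ⟨r, hr, hball⟩ := Metric.nhds_basis_closedBall.mem_iff.mp (hV.mem_nhds hp)
  obtain ⟨D, hD, -, hle⟩ := exists_dominating hs hθ (half_pos hr)
    (by rwa [mul_div_cancel₀ _ (two_ne_zero)]) k
  refine hD.mono' ?_ (Eventually.of_forall fun u => ?_)
  · exact ((continuous_id.pow k).aestronglyMeasurable).mul (hθ p hp).1
  · refine le_trans ?_ (hle u)
    rw [expFamily, norm_mul, norm_pow]
    refine mul_le_mul (pow_le_pow_left₀ (norm_nonneg _) (by linarith) _) ?_ (norm_nonneg _)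
      (by positivity)
    exact le_mul_of_one_le_right (norm_nonneg _)
      (Real.one_le_exp (mul_nonneg (half_pos hr).le (reWeight_nonneg u)))

/-- Pointwise, the derivative in p_ℓ multiplies by ± u^{ℓ+1} (ℓ from 0). The second order remainder
is at most ‖δ‖² times a square integrable function, so the expansion holds in the norm of L². -/
theorem hasFDerivAt_expFamily (hs : s = 1 ∨ s = -1) (hV : IsOpen V)
    (hθ : ∀ p ∈ V, MemLp (fun u => Complex.exp (s * phase p j u) * θ u) 2 Ω.measure)
    {p : Params m} (hp : p ∈ V) (k : ℕ) :
    HasFDerivAt (fun p => Ω.toL2 (expFamily s j θ k p))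
      (dirSum fun ℓ i => if i = j then s • Ω.toL2 (expFamily s j θ (k + ℓ + 1) p) else 0) p := by
  obtain ⟨r, hr, hball⟩ := Metric.nhds_basis_closedBall.mem_iff.mp (hV.mem_nhds hp)
  have hε : 0 < r / 2 := half_pos hr
  -- The exponent k + 6 covers the factor u^k and the square of a phase that is cubic in u.
  obtain ⟨D, hD, hD0, hle⟩ := exists_dominating hs hθ hε
    (by rwa [mul_div_cancel₀ _ (two_ne_zero)]) (k + 6)
  refine hasFDerivAt_of_norm_le_sq (27 * ‖hD.toLp D‖) ?_
  filter_upwards [hV.mem_nhds hp, Metric.closedBall_mem_nhds p hε] with q hq hqp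
  rw [Metric.mem_closedBall, dist_eq_norm] at hqp
  have hmem := fun p hp k => memLp_expFamily hs hV hθ (p := p) hp k
  set δ := q - p with hδ
  have hqδ : q = p + δ := by rw [hδ]; abel
  have hs1 : |s| = 1 := by rcases hs with rfl | rfl <;> norm_num
  rw [dirSum_apply]
  have hsum : ∑ ℓ, ∑ i, δ ℓ i • (if i = j then s • Ω.toL2 (expFamily s j θ (k + ℓ + 1) p) else 0) =
      ∑ ℓ, (δ ℓ j * s) • Ω.toL2 (expFamily s j θ (k + ℓ + 1) p) := by
    refine Finset.sum_congr rfl fun ℓ _ => ?_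
    rw [Finset.sum_eq_single j]
    · rw [if_pos rfl, smul_smul]
    · intro i _ hi
      rw [if_neg hi, smul_zero]
    · simp
  rw [hsum]
  have key : ‖Ω.toL2 (expFamily s j θ k q) - Ω.toL2 (expFamily s j θ k p) -
      ∑ ℓ, (δ ℓ j * s) • Ω.toL2 (expFamily s j θ (k + ℓ + 1) p)‖ ≤
        (27 * ‖δ‖ ^ 2) * ‖hD.toLp D‖ := by
    refine Lp.norm_le_mul_norm_of_ae_le_mul ?_
    filter_upwards [Lp.coeFn_sub (Ω.toL2 (expFamily s j θ k q) - Ω.toL2 (expFamily s j θ k p))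
      (∑ ℓ, (δ ℓ j * s) • Ω.toL2 (expFamily s j θ (k + ℓ + 1) p)),
      Lp.coeFn_sub (Ω.toL2 (expFamily s j θ k q)) (Ω.toL2 (expFamily s j θ k p)),
      Ω.coeFn_sum_smul Finset.univ (fun ℓ : Fin 3 => δ ℓ j * s)
        (fun ℓ => Ω.toL2 (expFamily s j θ (k + ℓ + 1) p)),
      Ω.coeFn_toL2 (hmem q hq k), Ω.coeFn_toL2 (hmem p hp k),
      ae_all_iff.mpr fun ℓ : Fin 3 => Ω.coeFn_toL2 (hmem p hp (k + ℓ + 1)), hD.coeFn_toLp]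
      with u h1 h2 h3 h4 h5 h6 h7
    rw [h1, Pi.sub_apply, h2, Pi.sub_apply, h3, h4, h5, h7, Finset.sum_congr rfl fun ℓ _ => by
      rw [h6 ℓ]]
    set w : ℂ := s * phase δ j u with hw
    have hfun : expFamily s j θ k q u - expFamily s j θ k p u -
        ∑ ℓ : Fin 3, (δ ℓ j * s) • expFamily s j θ (k + ℓ + 1) p u =
        u ^ k * (Complex.exp (s * phase p j u) * θ u) * (Complex.exp w - 1 - w) := by
      have e1 : ∑ ℓ : Fin 3, (δ ℓ j * s) • expFamily s j θ (k + ℓ + 1) p u =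
          u ^ k * (Complex.exp (s * phase p j u) * θ u) * w := by
        rw [hw, show phase δ j u = ∑ ℓ : Fin 3, (δ ℓ j : ℂ) * u ^ ((ℓ : ℕ) + 1) from rfl,
          Finset.mul_sum, Finset.mul_sum]
        refine Finset.sum_congr rfl fun ℓ _ => ?_
        rw [expFamily, Complex.real_smul]
        push_cast
        ring
      rw [e1, expFamily, expFamily, hqδ, phase_add, mul_add, Complex.exp_add, ← hw]
      ring
    have hwn : ‖w‖ = ‖phase δ j u‖ := by
      rw [hw, norm_mul, Complex.norm_real, Real.norm_eq_abs, hs1, one_mul]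
    have hwre : |w.re| = |(phase δ j u).re| := by
      rw [hw, Complex.re_ofReal_mul, abs_mul, hs1, one_mul]
    have hexp : Real.exp |w.re| ≤ Real.exp (r / 2 * reWeight u) := by
      rw [hwre]
      exact Real.exp_le_exp.mpr ((abs_re_phase_le δ j u).trans
        (mul_le_mul_of_nonneg_right hqp (reWeight_nonneg u)))
    have hw2 : ‖w‖ ^ 2 ≤ 9 * ‖δ‖ ^ 2 * (1 + ‖u‖) ^ 6 := by
      rw [hwn]
      refine (pow_le_pow_left₀ (norm_nonneg _) (norm_phase_le δ j u) 2).trans_eq ?_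
      ring
    have hE : ‖Complex.exp w - 1 - w‖ ≤
        27 * ‖δ‖ ^ 2 * (1 + ‖u‖) ^ 6 * Real.exp (r / 2 * reWeight u) := by
      refine (norm_exp_sub_one_sub_le w).trans ?_
      refine mul_le_mul ?_ hexp (Real.exp_pos _).le (by positivity)
      linarith
    have hk : ‖u‖ ^ k ≤ (1 + ‖u‖) ^ k := pow_le_pow_left₀ (norm_nonneg _) (by linarith) _
    rw [hfun, norm_mul, norm_mul, norm_pow, Real.norm_eq_abs, abs_of_nonneg (hD0 u)]
    calc ‖u‖ ^ k * ‖Complex.exp (s * phase p j u) * θ u‖ * ‖Complex.exp w - 1 - w‖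
        ≤ (1 + ‖u‖) ^ k * ‖Complex.exp (s * phase p j u) * θ u‖ *
          (27 * ‖δ‖ ^ 2 * (1 + ‖u‖) ^ 6 * Real.exp (r / 2 * reWeight u)) :=
          mul_le_mul (mul_le_mul_of_nonneg_right hk (norm_nonneg _)) hE (norm_nonneg _)
            (by positivity)
      _ = 27 * ‖δ‖ ^ 2 * ((1 + ‖u‖) ^ (k + 6) *
          (‖Complex.exp (s * phase p j u) * θ u‖ * Real.exp (r / 2 * reWeight u))) := by
          rw [pow_add]; ring
      _ ≤ _ := mul_le_mul_of_nonneg_left (hle u) (by positivity)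
  linarith

end Family

end CubicKP

namespace CubicKP

/-! ### The bilinear pairing and integral operators -/

/-- The bilinear pairing `∫ ψ φ` on `L²(Ω)`. -/
def Locus.pairing (Ω : Locus) : Ω.L2 →L[ℂ] Ω.L2 →L[ℂ] ℂ :=
  (ContinuousLinearMap.mul ℂ ℂ).lpPairing Ω.measure 2 2

theorem Locus.pairing_apply (Ω : Locus) (ψ φ : Ω.L2) :
    Ω.pairing ψ φ = ∫ u, ψ u * φ u ∂Ω.measure :=
  ContinuousLinearMap.lpPairing_eq_integral _ _ _

theorem Locus.pairing_toL2 (Ω : Locus) {ψ : ℂ → ℂ} (hψ : MemLp ψ 2 Ω.measure) (φ : Ω.L2) :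
    Ω.pairing (Ω.toL2 ψ) φ = ∫ u, ψ u * φ u ∂Ω.measure := by
  rw [Ω.pairing_apply]
  refine integral_congr_ae ?_
  filter_upwards [Ω.coeFn_toL2 hψ] with u hu
  rw [hu]

theorem Locus.memLp_mul_density (Ω : Locus) {φ : ℂ → ℂ} (h : MemLp φ 2 Ω.measure) :
    MemLp (fun u => φ u * Ω.density u) 2 Ω.measure := by
  obtain ⟨C, hC⟩ := Ω.exists_norm_density_le
  refine (h.norm.const_mul C).mono' (h.1.mul Ω.measurable_density.aestronglyMeasurable)
    (Eventually.of_forall fun u => ?_)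
  rw [norm_mul, mul_comm]
  exact mul_le_mul_of_nonneg_right (hC u) (norm_nonneg _)

/-- An operator dominated by a product kernel is bounded by the product of the norms. -/
theorem Locus.exists_opNorm_le (Ω : Locus) {α β : ℂ → ℝ} (hα : MemLp α 2 Ω.measure)
    (hβ : MemLp β 2 Ω.measure) : ∃ K : ℝ, ∀ (t : ℝ) (T : Ω.L2 →L[ℂ] Ω.L2), 0 ≤ t →
      (∀ φ : Ω.L2, ∀ᵐ u ∂Ω.measure, ‖T φ u‖ ≤ t * (α u * ∫ v, β v * ‖φ v‖ ∂Ω.measure)) →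
      ‖T‖ ≤ K * t := by
  let B := (ContinuousLinearMap.mul ℝ ℝ).lpPairing Ω.measure 2 2
  refine ⟨‖B‖ * ‖hβ.toLp β‖ * ‖hα.toLp α‖, fun t T ht h => ?_⟩
  refine T.opNorm_le_bound (by positivity) fun φ => ?_
  have hφ : MemLp (fun v => ‖φ v‖) 2 Ω.measure := (Lp.memLp φ).norm
  have hB : B (hβ.toLp β) (hφ.toLp _) = ∫ v, β v * ‖φ v‖ ∂Ω.measure := by
    rw [ContinuousLinearMap.lpPairing_eq_integral]
    refine integral_congr_ae ?_
    filter_upwards [hβ.coeFn_toLp, hφ.coeFn_toLp] with v h1 h2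
    rw [h1, h2]
    rfl
  have hnorm : ‖hφ.toLp _‖ = ‖φ‖ := by
    rw [Lp.norm_toLp, Lp.norm_def, eLpNorm_norm]
  have hint : |∫ v, β v * ‖φ v‖ ∂Ω.measure| ≤ ‖B‖ * ‖hβ.toLp β‖ * ‖φ‖ := by
    rw [← hB, ← hnorm, ← Real.norm_eq_abs]
    exact B.le_opNorm₂ _ _
  have h1 : ‖T φ‖ ≤ (t * (‖B‖ * ‖hβ.toLp β‖ * ‖φ‖)) * ‖hα.toLp α‖ := by
    refine Lp.norm_le_mul_norm_of_ae_le_mul ?_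
    filter_upwards [h φ, hα.coeFn_toLp] with u h2 h3
    rw [h3]
    refine h2.trans ?_
    rw [mul_assoc]
    refine mul_le_mul_of_nonneg_left ?_ ht
    refine (le_abs_self _).trans ?_
    rw [abs_mul, mul_comm, Real.norm_eq_abs]
    exact mul_le_mul_of_nonneg_right hint (abs_nonneg _)
  linarith

theorem iiksKernel_eq {ι : Type} [Fintype ι] (f g : ℂ → ι → ℂ) (u v : ℂ) :
    iiksKernel f g u v = (∑ a, f u a * g v a) / (u - v) := by
  rw [iiksKernel]
  split_ifs with h
  · rw [h, sub_self, div_zero]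
  · rfl

theorem measurableSet_lt_dist (u : ℂ) (ε : ℝ) : MeasurableSet {v : ℂ | ε < dist u v} :=
  measurableSet_lt measurable_const (measurable_const.dist measurable_id)

/-- The truncated integrals of the kernel converge absolutely. -/
theorem Locus.integrableOn_iiksKernel (Ω : Locus) {ι : Type} [Fintype ι] {f g : ℂ → ι → ℂ}
    (hg : ∀ a, MemLp (fun v => g v a) 2 Ω.measure) (φ : Ω.L2) (u : ℂ) {ε : ℝ} (hε : 0 < ε) :
    IntegrableOn (fun v => iiksKernel f g u v * φ v * Ω.density v) {v | ε < dist u v}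
      Ω.measure := by
  have hφ := Ω.memLp_mul_density (Lp.memLp φ)
  have hint : ∀ a, Integrable (fun v => g v a * (φ v * Ω.density v)) Ω.measure := fun a =>
    (hg a).integrable_mul hφ
  have hsum : Integrable (fun v => ∑ a, f u a * (g v a * (φ v * Ω.density v))) Ω.measure :=
    integrable_finsetSum _ fun a _ => (hint a).const_mul _
  have heq : (fun v => iiksKernel f g u v * φ v * Ω.density v) =
      fun v => (u - v)⁻¹ * ∑ a, f u a * (g v a * (φ v * Ω.density v)) := by
    funext v
    rw [iiksKernel_eq, Finset.mul_sum, div_eq_inv_mul, Finset.mul_sum, Finset.sum_mul,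
      Finset.sum_mul]
    exact Finset.sum_congr rfl fun a _ => by ring
  rw [heq]
  have hm : Measurable fun v : ℂ => (u - v)⁻¹ := (measurable_const.sub measurable_id).inv
  refine Integrable.mono' ((hsum.norm.const_mul ε⁻¹).integrableOn)
    (hm.aestronglyMeasurable.mul hsum.1.restrict) ?_
  filter_upwards [ae_restrict_mem (measurableSet_lt_dist u ε)] with v hv
  rw [norm_mul, norm_inv, ← dist_eq_norm]
  refine mul_le_mul_of_nonneg_right ?_ (norm_nonneg _)
  exact inv_anti₀ hε (le_of_lt hv)

theorem tendsto_one_div_nhdsGT :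
    Tendsto (fun k : ℕ => 1 / ((k : ℝ) + 1)) atTop (𝓝[>] 0) :=
  tendsto_nhdsWithin_iff.mpr ⟨tendsto_one_div_add_atTop_nhds_zero_nat,
    Eventually.of_forall fun k => by rw [mem_Ioi]; positivity⟩

/-- The truncated integrals of an integrable function vanishing at `u` tend to its integral. -/
theorem tendsto_truncated_integral {μ : Measure ℂ} {h : ℂ → ℂ} (hint : Integrable h μ) {u : ℂ}
    (hu : h u = 0) :
    Tendsto (fun k : ℕ => ∫ v in {v | 1 / ((k : ℝ) + 1) < dist u v}, h v ∂μ) atTop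
      (𝓝 (∫ v, h v ∂μ)) := by
  have hmono : Monotone fun k : ℕ => {v : ℂ | 1 / ((k : ℝ) + 1) < dist u v} := by
    intro k l hkl v hv
    have h : 1 / ((l : ℝ) + 1) ≤ 1 / ((k : ℝ) + 1) :=
      one_div_le_one_div_of_le (by positivity) (by exact_mod_cast Nat.succ_le_succ hkl)
    exact lt_of_le_of_lt h hv
  have hl := tendsto_setIntegral_of_monotone (μ := μ) (f := h)
    (fun k : ℕ => measurableSet_lt_dist u (1 / ((k : ℝ) + 1))) hmono hint.integrableOn
  rw [setIntegral_eq_integral_of_forall_compl_eq_zero] at hl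
  · exact hl
  -- The truncation regions exhaust everything except the point u itself, which may carry mass in
  -- the discrete case; hence the assumption that h vanishes there.
  · intro v hv
    have : v = u := by
      by_contra hne
      apply hv
      obtain ⟨k, hk⟩ := exists_nat_one_div_lt (dist_pos.mpr (Ne.symm hne))
      exact mem_iUnion.mpr ⟨k, hk⟩
    rw [this, hu]

/-! ### Differentiability of the cubic integrable operator -/

section Cubic

variable {m : ℕ} {Ω : Locus} {F G : ℂ → Fin (m + 1) → ℂ} {d : ℂ → ℂ} {V : Set (Params m)}
  {H : Params m → Ω.L2 →L[ℂ] Ω.L2}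

/-- The function `u^k f_j(u)`. -/
def fFam (d : ℂ → ℂ) (F : ℂ → Fin (m + 1) → ℂ) (j : Fin m) : ℕ → Params m → ℂ → ℂ :=
  expFamily 1 j fun u => d u * F u j.castSucc

/-- The function `u^k g_j(u)`, with the density of `dμ` included. -/
def gFam (Ω : Locus) (d : ℂ → ℂ) (G : ℂ → Fin (m + 1) → ℂ) (j : Fin m) : ℕ → Params m → ℂ → ℂ :=
  expFamily (-1) j fun u => (d u)⁻¹ * G u j.castSucc * Ω.density u

theorem vecf_castSucc (d : ℂ → ℂ) (F : ℂ → Fin (m + 1) → ℂ) (p : Params m) (u : ℂ) (j : Fin m) :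
    vecf d F p u j.castSucc =
      Complex.exp ((1 : ℝ) * phase p j u) * (d u * F u j.castSucc) := by
  rw [vecf, dressing_castSucc, Complex.ofReal_one, one_mul]
  ring

theorem vecg_castSucc (d : ℂ → ℂ) (G : ℂ → Fin (m + 1) → ℂ) (p : Params m) (u : ℂ) (j : Fin m) :
    vecg d G p u j.castSucc =
      Complex.exp ((-1 : ℝ) * phase p j u) * ((d u)⁻¹ * G u j.castSucc) := by
  rw [vecg, dressing_castSucc, Complex.ofReal_neg, Complex.ofReal_one, neg_one_mul,
    Complex.exp_neg]
  ring

theorem fFam_eq (k : ℕ) (p : Params m) (j : Fin m) (u : ℂ) :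
    fFam d F j k p u = u ^ k * vecf d F p u j.castSucc := by
  rw [fFam, expFamily, vecf_castSucc]

theorem gFam_eq (k : ℕ) (p : Params m) (j : Fin m) (u : ℂ) :
    gFam Ω d G j k p u = u ^ k * vecg d G p u j.castSucc * Ω.density u := by
  rw [gFam, expFamily, vecg_castSucc]
  ring

theorem memLp_f_base (hH : ∀ p ∈ V, IsCubicIntegrable Ω F G d p (H p)) (j : Fin m) :
    ∀ p ∈ V, MemLp (fun u => Complex.exp ((1 : ℝ) * phase p j u) * (d u * F u j.castSucc)) 2
      Ω.measure := fun p hp => by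
  simpa only [vecf_castSucc] using (hH p hp).f_memL2 j.castSucc

theorem memLp_g_base (hH : ∀ p ∈ V, IsCubicIntegrable Ω F G d p (H p)) (j : Fin m) :
    ∀ p ∈ V, MemLp (fun u => Complex.exp ((-1 : ℝ) * phase p j u) *
      ((d u)⁻¹ * G u j.castSucc * Ω.density u)) 2 Ω.measure := fun p hp => by
  have h := Ω.memLp_mul_density ((hH p hp).g_memL2 j.castSucc)
  simpa only [vecg_castSucc, mul_assoc] using h

theorem memLp_fFam (hV : IsOpen V) (hH : ∀ p ∈ V, IsCubicIntegrable Ω F G d p (H p))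
    {p : Params m} (hp : p ∈ V) (j : Fin m) (k : ℕ) : MemLp (fFam d F j k p) 2 Ω.measure :=
  memLp_expFamily (Or.inl rfl) hV (memLp_f_base hH j) hp k

theorem memLp_gFam (hV : IsOpen V) (hH : ∀ p ∈ V, IsCubicIntegrable Ω F G d p (H p))
    {p : Params m} (hp : p ∈ V) (j : Fin m) (k : ℕ) : MemLp (gFam Ω d G j k p) 2 Ω.measure :=
  memLp_expFamily (Or.inr rfl) hV (memLp_g_base hH j) hp k

/-- The finite rank operators `∂H/∂p_ℓ^{(i)}`. -/
def derivOp (Ω : Locus) (F G : ℂ → Fin (m + 1) → ℂ) (d : ℂ → ℂ) (p : Params m) (ℓ : Fin 3)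
    (i : Fin m) : Ω.L2 →L[ℂ] Ω.L2 :=
  ∑ x ∈ antidiagonal (ℓ : ℕ),
    (Ω.pairing (Ω.toL2 (gFam Ω d G i x.1 p))).smulRight (Ω.toL2 (fFam d F i x.2 p))

/-- The kernel of the derivative of `H` in the direction `δ`. -/
def derivKernel (F G : ℂ → Fin (m + 1) → ℂ) (d : ℂ → ℂ) (p δ : Params m) (u v : ℂ) : ℂ :=
  ∑ i : Fin m, vecf d F p u i.castSucc * vecg d G p v i.castSucc * phaseSlope δ i u v

theorem derivKernel_mul (p δ : Params m) (φ : Ω.L2) (u v : ℂ) :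
    derivKernel F G d p δ u v * φ v * Ω.density v =
      ∑ ℓ : Fin 3, ∑ i, (δ ℓ i : ℂ) * ∑ x ∈ antidiagonal (ℓ : ℕ),
        fFam d F i x.2 p u * (gFam Ω d G i x.1 p v * φ v) := by
  rw [derivKernel, Finset.sum_mul, Finset.sum_mul, Finset.sum_comm]
  refine Finset.sum_congr rfl fun i _ => ?_
  rw [phaseSlope, Finset.mul_sum, Finset.sum_mul, Finset.sum_mul]
  refine Finset.sum_congr rfl fun ℓ _ => ?_
  simp only [Finset.mul_sum, Finset.sum_mul, fFam_eq, gFam_eq]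
  exact Finset.sum_congr rfl fun x _ => by ring

theorem integrable_derivKernel (hV : IsOpen V)
    (hH : ∀ p ∈ V, IsCubicIntegrable Ω F G d p (H p)) {p : Params m} (hp : p ∈ V) (δ : Params m)
    (φ : Ω.L2) (u : ℂ) :
    Integrable (fun v => derivKernel F G d p δ u v * φ v * Ω.density v) Ω.measure ∧
      ∫ v, derivKernel F G d p δ u v * φ v * Ω.density v ∂Ω.measure =
        ∑ ℓ : Fin 3, ∑ i, (δ ℓ i : ℂ) * ∑ x ∈ antidiagonal (ℓ : ℕ),
          fFam d F i x.2 p u * Ω.pairing (Ω.toL2 (gFam Ω d G i x.1 p)) φ := by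
  have hint : ∀ i s, Integrable (fun v => gFam Ω d G i s p v * φ v) Ω.measure := fun i s =>
    (memLp_gFam hV hH hp i s).integrable_mul (Lp.memLp φ)
  simp only [derivKernel_mul]
  have h1 : ∀ (ℓ : Fin 3) (i : Fin m), Integrable (fun v => ∑ x ∈ antidiagonal (ℓ : ℕ),
      fFam d F i x.2 p u * (gFam Ω d G i x.1 p v * φ v)) Ω.measure := fun ℓ i =>
    integrable_finsetSum _ fun x _ => (hint i x.1).const_mul _
  have h2 : ∀ ℓ : Fin 3, Integrable (fun v => ∑ i, (δ ℓ i : ℂ) * ∑ x ∈ antidiagonal (ℓ : ℕ),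
      fFam d F i x.2 p u * (gFam Ω d G i x.1 p v * φ v)) Ω.measure := fun ℓ =>
    integrable_finsetSum _ fun i _ => (h1 ℓ i).const_mul _
  refine ⟨integrable_finsetSum _ fun ℓ _ => h2 ℓ, ?_⟩
  rw [integral_finsetSum _ fun ℓ _ => h2 ℓ]
  refine Finset.sum_congr rfl fun ℓ _ => ?_
  rw [integral_finsetSum _ fun i _ => (h1 ℓ i).const_mul _]
  refine Finset.sum_congr rfl fun i _ => ?_
  rw [integral_const_mul, integral_finsetSum _ fun x _ => (hint i x.1).const_mul _]
  congr 1
  refine Finset.sum_congr rfl fun x _ => ?_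
  rw [integral_const_mul, Ω.pairing_toL2 (memLp_gFam hV hH hp i x.1)]

theorem dirSum_derivOp_apply (hV : IsOpen V)
    (hH : ∀ p ∈ V, IsCubicIntegrable Ω F G d p (H p)) {p : Params m} (hp : p ∈ V) (δ : Params m)
    (φ : Ω.L2) : ∀ᵐ u ∂Ω.measure, dirSum (derivOp Ω F G d p) δ φ u =
      ∫ v, derivKernel F G d p δ u v * φ v * Ω.density v ∂Ω.measure := by
  have h0 : dirSum (derivOp Ω F G d p) δ φ =
      ∑ y ∈ (Finset.univ : Finset (Fin 3 × Fin m)).sigma fun y => antidiagonal (y.1 : ℕ),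
        ((δ y.1.1 y.1.2 : ℂ) * Ω.pairing (Ω.toL2 (gFam Ω d G y.1.2 y.2.1 p)) φ) •
          Ω.toL2 (fFam d F y.1.2 y.2.2 p) := by
    rw [dirSum_apply, Finset.sum_sigma, Fintype.sum_prod_type, sum_apply]
    refine Finset.sum_congr rfl fun ℓ _ => ?_
    rw [sum_apply]
    refine Finset.sum_congr rfl fun i _ => ?_
    rw [derivOp, Finset.smul_sum, sum_apply]
    refine Finset.sum_congr rfl fun x _ => ?_
    rw [mul_smul]
    rfl
  have h1 : ∀ᵐ u ∂Ω.measure, ∀ (i : Fin m) (k : ℕ),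
      Ω.toL2 (fFam d F i k p) u = fFam d F i k p u :=
    ae_all_iff.mpr fun i => ae_all_iff.mpr fun k => Ω.coeFn_toL2 (memLp_fFam hV hH hp i k)
  rw [h0]
  filter_upwards [Ω.coeFn_sum_smul ((Finset.univ : Finset (Fin 3 × Fin m)).sigma fun y =>
      antidiagonal (y.1 : ℕ))
    (fun y => (δ y.1.1 y.1.2 : ℂ) * Ω.pairing (Ω.toL2 (gFam Ω d G y.1.2 y.2.1 p)) φ)
    (fun y => Ω.toL2 (fFam d F y.1.2 y.2.2 p)), h1] with u h2 h3
  rw [h2, (integrable_derivKernel hV hH hp δ φ u).2, Finset.sum_sigma, Fintype.sum_prod_type]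
  refine Finset.sum_congr rfl fun ℓ _ => Finset.sum_congr rfl fun i _ => ?_
  rw [Finset.mul_sum]
  refine Finset.sum_congr rfl fun x _ => ?_
  simp only [h3, smul_eq_mul]
  ring

/-- The Taylor remainder of the kernel. -/
theorem kernel_remainder (p δ : Params m) {u v : ℂ} (huv : u ≠ v) :
    iiksKernel (vecf d F (p + δ)) (vecg d G (p + δ)) u v -
      iiksKernel (vecf d F p) (vecg d G p) u v - derivKernel F G d p δ u v =
    ∑ i : Fin m, vecf d F p u i.castSucc * vecg d G p v i.castSucc *
      ((Complex.exp (phase δ i u - phase δ i v) - 1 - (phase δ i u - phase δ i v)) / (u - v)) := by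
  have hne : u - v ≠ 0 := sub_ne_zero.mpr huv
  have hlast : ∀ q : Params m, vecf d F q u (Fin.last m) * vecg d G q v (Fin.last m) =
      d u * F u (Fin.last m) * ((d v)⁻¹ * G v (Fin.last m)) := by
    intro q
    rw [vecf, vecg, dressing_last, dressing_last]
    simp
  rw [iiksKernel_eq, iiksKernel_eq, Fin.sum_univ_castSucc, Fin.sum_univ_castSucc, hlast, hlast,
    ← sub_div, add_sub_add_right_eq_sub, ← Finset.sum_sub_distrib, derivKernel, Finset.sum_div,
    ← Finset.sum_sub_distrib]
  refine Finset.sum_congr rfl fun i _ => ?_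
  have h1 : vecf d F (p + δ) u i.castSucc * vecg d G (p + δ) v i.castSucc =
      vecf d F p u i.castSucc * vecg d G p v i.castSucc *
        Complex.exp (phase δ i u - phase δ i v) := by
    simp only [vecf_castSucc, vecg_castSucc, phase_add, mul_add, Complex.exp_add, sub_eq_add_neg,
      Complex.ofReal_one, one_mul, Complex.ofReal_neg, neg_one_mul]
    ring
  rw [h1, ← phaseSlope_mul]
  field_simp

/-- The phase difference is divisible by u - v, so its square cancels the denominator and leaves one
spare factor |u - v| ≤ (1+|u|)(1+|v|). This turns the exponent 4 into 5; the constant is 3 · 9². The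
bound splits into a function of u times a function of v. -/
theorem norm_remainder_le {δ : Params m} {ε : ℝ} (hδ : ‖δ‖ ≤ ε) (i : Fin m) {u v : ℂ}
    (huv : u ≠ v) :
    ‖(Complex.exp (phase δ i u - phase δ i v) - 1 - (phase δ i u - phase δ i v)) / (u - v)‖ ≤
      243 * ‖δ‖ ^ 2 * (((1 + ‖u‖) ^ 5 * Real.exp (ε * reWeight u)) *
        ((1 + ‖v‖) ^ 5 * Real.exp (ε * reWeight v))) := by
  have hne : 0 < ‖u - v‖ := norm_pos_iff.mpr (sub_ne_zero.mpr huv)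
  set w := phase δ i u - phase δ i v with hw
  have hu := norm_nonneg u
  have hv := norm_nonneg v
  have h1 : ‖w‖ ≤ 9 * ‖δ‖ * ((1 + ‖u‖) ^ 2 * (1 + ‖v‖) ^ 2) * ‖u - v‖ := by
    rw [hw, ← phaseSlope_mul, norm_mul]
    exact mul_le_mul_of_nonneg_right (norm_phaseSlope_le δ i u v) hne.le
  have h2 : ‖u - v‖ ≤ (1 + ‖u‖) * (1 + ‖v‖) := by
    refine (norm_sub_le _ _).trans ?_
    nlinarith
  have h3 : |w.re| ≤ ε * reWeight u + ε * reWeight v := by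
    rw [hw, Complex.sub_re]
    refine (abs_sub _ _).trans (add_le_add ?_ ?_)
    · exact (abs_re_phase_le δ i u).trans (mul_le_mul_of_nonneg_right hδ (reWeight_nonneg u))
    · exact (abs_re_phase_le δ i v).trans (mul_le_mul_of_nonneg_right hδ (reWeight_nonneg v))
  have h4 : Real.exp |w.re| ≤ Real.exp (ε * reWeight u) * Real.exp (ε * reWeight v) := by
    rw [← Real.exp_add]
    exact Real.exp_le_exp.mpr h3
  have h5 : ‖w‖ ^ 2 ≤ 81 * ‖δ‖ ^ 2 * ((1 + ‖u‖) ^ 5 * (1 + ‖v‖) ^ 5) * ‖u - v‖ := by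
    refine (pow_le_pow_left₀ (norm_nonneg _) h1 2).trans ?_
    calc (9 * ‖δ‖ * ((1 + ‖u‖) ^ 2 * (1 + ‖v‖) ^ 2) * ‖u - v‖) ^ 2
        = 81 * ‖δ‖ ^ 2 * ((1 + ‖u‖) ^ 4 * (1 + ‖v‖) ^ 4) * ‖u - v‖ * ‖u - v‖ := by ring
      _ ≤ 81 * ‖δ‖ ^ 2 * ((1 + ‖u‖) ^ 4 * (1 + ‖v‖) ^ 4) * ‖u - v‖ *
          ((1 + ‖u‖) * (1 + ‖v‖)) := mul_le_mul_of_nonneg_left h2 (by positivity)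
      _ = _ := by ring
  rw [norm_div, div_le_iff₀ hne]
  refine (norm_exp_sub_one_sub_le w).trans ?_
  calc 3 * ‖w‖ ^ 2 * Real.exp |w.re|
      ≤ 3 * (81 * ‖δ‖ ^ 2 * ((1 + ‖u‖) ^ 5 * (1 + ‖v‖) ^ 5) * ‖u - v‖) *
        (Real.exp (ε * reWeight u) * Real.exp (ε * reWeight v)) :=
        mul_le_mul (mul_le_mul_of_nonneg_left h5 (by norm_num)) h4 (Real.exp_pos _).le
          (by positivity)
    _ = _ := by ring

end Cubic

end CubicKP

namespace CubicKP

/-! ### Derivatives of the operator, its resolvent and the moments -/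

section Cubic

variable {m : ℕ} {Ω : Locus} {F G : ℂ → Fin (m + 1) → ℂ} {d : ℂ → ℂ} {V : Set (Params m)}
  {H : Params m → Ω.L2 →L[ℂ] Ω.L2}

/-- The orthogonality F_a G_a = 0 makes the derivative kernel vanish on the diagonal, in agreement
with the convention that the kernel of H is 0 there. This matters when points carry mass. -/
theorem derivKernel_self (p δ : Params m) {u : ℂ} (h : ∀ a, F u a * G u a = 0) :
    derivKernel F G d p δ u u = 0 := by
  refine Finset.sum_eq_zero fun i _ => ?_
  rw [vecf, vecg]
  linear_combination (d u * dressing p u i.castSucc * (d u)⁻¹ * (dressing p u i.castSucc)⁻¹ *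
    phaseSlope δ i u u) * h i.castSucc

/-- The operator norm derivative of `H`. -/
theorem hasFDerivAt_operator (hV : IsOpen V)
    (hH : ∀ p ∈ V, IsCubicIntegrable Ω F G d p (H p)) {p : Params m} (hp : p ∈ V) :
    HasFDerivAt H (dirSum (derivOp Ω F G d p)) p := by
  obtain ⟨r, hr, hball⟩ := Metric.nhds_basis_closedBall.mem_iff.mp (hV.mem_nhds hp)
  have hε : 0 < r / 2 := half_pos hr
  have hball' : Metric.closedBall p (2 * (r / 2)) ⊆ V := by
    rwa [mul_div_cancel₀ _ (two_ne_zero)]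
  choose Df hDf hDf0 hDfle using fun i : Fin m =>
    exists_dominating (Or.inl rfl) (memLp_f_base hH i) hε hball' 5
  choose Dg hDg hDg0 hDgle using fun i : Fin m =>
    exists_dominating (Or.inr rfl) (memLp_g_base hH i) hε hball' 5
  have hα : MemLp (fun u => ∑ i, Df i u) 2 Ω.measure := memLp_finsetSum _ fun i _ => hDf i
  have hβ : MemLp (fun u => ∑ i, Dg i u) 2 Ω.measure := memLp_finsetSum _ fun i _ => hDg i
  obtain ⟨K, hK⟩ := Ω.exists_opNorm_le hα hβ
  refine hasFDerivAt_of_norm_le_sq (K * 243) ?_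
  filter_upwards [hV.mem_nhds hp, Metric.closedBall_mem_nhds p hε] with q hq hqp
  rw [Metric.mem_closedBall, dist_eq_norm] at hqp
  set δ := q - p with hδ
  have hqδ : q = p + δ := by rw [hδ]; abel
  rw [mul_assoc]
  refine hK _ _ (by positivity) fun φ => ?_
  have hφβ : Integrable (fun v => (∑ i, Dg i v) * ‖φ v‖) Ω.measure :=
    hβ.integrable_mul (Lp.memLp φ).norm
  filter_upwards [(hH q hq).hasKernel φ, (hH p hp).hasKernel φ,
    dirSum_derivOp_apply hV hH hp δ φ, Ω.ae_mem_carrier,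
    Lp.coeFn_sub (H q φ - H p φ) (dirSum (derivOp Ω F G d p) δ φ),
    Lp.coeFn_sub (H q φ) (H p φ)] with u h1 h2 h3 h4 h5 h6
  have h7 : (H q - H p - dirSum (derivOp Ω F G d p) δ) φ u =
      H q φ u - H p φ u - dirSum (derivOp Ω F G d p) δ φ u := by
    change (H q φ - H p φ - dirSum (derivOp Ω F G d p) δ φ : Ω.L2) u = _
    rw [h5, Pi.sub_apply, h6, Pi.sub_apply]
  have hb := integrable_derivKernel hV hH hp δ φ u
  -- The remainder of H is a limit of truncated integrals, where the integrands may be combined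
  -- before estimating. The combined kernel is no longer singular, so the bound is uniform in the
  -- truncation and survives the limit.
  have hlim := ((h1.comp tendsto_one_div_nhdsGT).sub (h2.comp tendsto_one_div_nhdsGT)).sub
    (tendsto_truncated_integral hb.1 (u := u)
      (by rw [derivKernel_self p δ ((hH p hp).orthogonal u h4), zero_mul, zero_mul]))
  rw [← h3, ← h7] at hlim
  refine le_of_tendsto' hlim.norm fun k => ?_
  have hpos : (0 : ℝ) < 1 / ((k : ℝ) + 1) := by positivity
  have hi1 := Ω.integrableOn_iiksKernel (f := vecf d F q) (hH q hq).g_memL2 φ u hpos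
  have hi2 := Ω.integrableOn_iiksKernel (f := vecf d F p) (hH p hp).g_memL2 φ u hpos
  simp only [Function.comp_apply]
  have hi3 : IntegrableOn (fun v => iiksKernel (vecf d F q) (vecg d G q) u v * φ v * Ω.density v -
      iiksKernel (vecf d F p) (vecg d G p) u v * φ v * Ω.density v)
      {v | 1 / ((k : ℝ) + 1) < dist u v} Ω.measure := hi1.sub hi2
  rw [← integral_sub hi1 hi2, ← integral_sub hi3 hb.1.integrableOn]
  have hbound : Integrable (fun v => 243 * ‖δ‖ ^ 2 * (∑ i, Df i u) * ((∑ i, Dg i v) * ‖φ v‖))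
      Ω.measure := hφβ.const_mul _
  have h0 : ∀ v, 0 ≤ 243 * ‖δ‖ ^ 2 * (∑ i, Df i u) * ((∑ i, Dg i v) * ‖φ v‖) := fun v =>
    mul_nonneg (mul_nonneg (by positivity) (Finset.sum_nonneg fun i _ => hDf0 i u))
      (mul_nonneg (Finset.sum_nonneg fun i _ => hDg0 i v) (norm_nonneg _))
  refine (norm_integral_le_of_norm_le hbound.integrableOn ?_).trans
    ((setIntegral_le_integral hbound (Eventually.of_forall h0)).trans_eq ?_)
  · filter_upwards [ae_restrict_mem (measurableSet_lt_dist u (1 / ((k : ℝ) + 1)))] with v hv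
    have huv : u ≠ v := dist_pos.mp (hpos.trans hv)
    have e1 : iiksKernel (vecf d F q) (vecg d G q) u v * φ v * Ω.density v -
        iiksKernel (vecf d F p) (vecg d G p) u v * φ v * Ω.density v -
        derivKernel F G d p δ u v * φ v * Ω.density v =
        ∑ i : Fin m, vecf d F p u i.castSucc * (vecg d G p v i.castSucc * Ω.density v) *
          ((Complex.exp (phase δ i u - phase δ i v) - 1 - (phase δ i u - phase δ i v)) /
            (u - v)) * φ v := by
      have := kernel_remainder (F := F) (G := G) (d := d) p δ huv
      rw [← hqδ] at this
      rw [← sub_mul, ← sub_mul, ← sub_mul, ← sub_mul, this, Finset.sum_mul, Finset.sum_mul]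
      exact Finset.sum_congr rfl fun i _ => by ring
    rw [e1]
    refine (norm_sum_le _ _).trans ?_
    have e2 : ∀ i : Fin m, ‖vecf d F p u i.castSucc *
        (vecg d G p v i.castSucc * Ω.density v) *
          ((Complex.exp (phase δ i u - phase δ i v) - 1 - (phase δ i u - phase δ i v)) /
            (u - v)) * φ v‖ ≤ 243 * ‖δ‖ ^ 2 * (Df i u * (∑ j, Dg j v)) * ‖φ v‖ := by
      intro i
      rw [norm_mul, norm_mul, norm_mul]
      refine mul_le_mul_of_nonneg_right ?_ (norm_nonneg _)
      have hf := hDfle i u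
      have hg := (hDgle i v).trans
        (Finset.single_le_sum (f := fun j => Dg j v) (fun j _ => hDg0 j v) (Finset.mem_univ i))
      rw [← vecf_castSucc] at hf
      rw [← mul_assoc (Complex.exp _), ← vecg_castSucc] at hg
      calc _ ≤ ‖vecf d F p u i.castSucc‖ * ‖vecg d G p v i.castSucc * Ω.density v‖ *
            (243 * ‖δ‖ ^ 2 * (((1 + ‖u‖) ^ 5 * Real.exp (r / 2 * reWeight u)) *
              ((1 + ‖v‖) ^ 5 * Real.exp (r / 2 * reWeight v)))) :=
            mul_le_mul_of_nonneg_left (norm_remainder_le hqp i huv) (by positivity)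
        _ = 243 * ‖δ‖ ^ 2 * (((1 + ‖u‖) ^ 5 * (‖vecf d F p u i.castSucc‖ *
              Real.exp (r / 2 * reWeight u))) * ((1 + ‖v‖) ^ 5 *
              (‖vecg d G p v i.castSucc * Ω.density v‖ * Real.exp (r / 2 * reWeight v)))) := by
            ring
        _ ≤ _ := by
            refine mul_le_mul_of_nonneg_left ?_ (by positivity)
            exact mul_le_mul hf hg (by positivity) (hDf0 i u)
    refine (Finset.sum_le_sum fun i _ => e2 i).trans_eq ?_
    rw [← Finset.sum_mul, ← Finset.mul_sum, ← Finset.sum_mul]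
    ring
  · rw [integral_const_mul]
    ring

/-- The derivative of the resolvent. -/
theorem hasFDerivAt_resolvent (hV : IsOpen V)
    (hH : ∀ p ∈ V, IsCubicIntegrable Ω F G d p (H p)) {p : Params m} (hp : p ∈ V)
    (hinv : IsUnit (1 - H p)) :
    HasFDerivAt (fun p => Ring.inverse (1 - H p))
      (dirSum fun ℓ i => Ring.inverse (1 - H p) * derivOp Ω F G d p ℓ i *
        Ring.inverse (1 - H p)) p := by
  obtain ⟨x, hx⟩ := hinv
  have h1 : HasFDerivAt (fun p => 1 - H p) (-dirSum (derivOp Ω F G d p)) p :=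
    (hasFDerivAt_operator hV hH hp).const_sub 1
  have h2 := hasFDerivAt_ringInverse (𝕜 := ℝ) x
  rw [hx] at h2
  have h3 := h2.comp p h1
  refine h3.congr_fderiv ((eq_dirSum _).trans
    (congrArg dirSum (funext fun ℓ => funext fun i => ?_)))
  change -(↑x⁻¹ * (-(dirSum (derivOp Ω F G d p) (paramDir ℓ i))) * ↑x⁻¹) = _
  rw [dirSum_paramDir, ← hx, Ring.inverse_unit, mul_neg, neg_mul, neg_neg]

/-- The moments `∫ u^s ((1 - H)⁻¹ u^r f_a)(u) g_b(u) dμ(u)`. -/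
def moment (Ω : Locus) (F G : ℂ → Fin (m + 1) → ℂ) (d : ℂ → ℂ)
    (H : Params m → Ω.L2 →L[ℂ] Ω.L2) (a b : Fin m) (r s : ℕ) (p : Params m) : ℂ :=
  Ω.pairing (Ω.toL2 (gFam Ω d G b s p))
    (Ring.inverse (1 - H p) (Ω.toL2 (fFam d F a r p)))

/-- The derivatives of the moments. -/
def momentDeriv (M : Fin m → Fin m → ℕ → ℕ → Params m → ℂ) (a b : Fin m) (r s : ℕ) (p : Params m)
    (ℓ : Fin 3) (i : Fin m) : ℂ :=
  (if i = a then M a b (r + ℓ + 1) s p else 0) - (if i = b then M a b r (s + ℓ + 1) p else 0) +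
    ∑ x ∈ antidiagonal (ℓ : ℕ), M a i r x.1 p * M i b x.2 s p

/-- The product rule with three factors: differentiating f raises r if i = a, differentiating g
raises s with a minus sign if i = b, and R (∂H) R with R = (1-H)⁻¹ splits into products of moments
because ∂H is of finite rank. -/
theorem hasFDerivAt_moment (hV : IsOpen V)
    (hH : ∀ p ∈ V, IsCubicIntegrable Ω F G d p (H p)) (hinv : ∀ p ∈ V, IsUnit (1 - H p))
    {p : Params m} (hp : p ∈ V) (a b : Fin m) (r s : ℕ) :
    HasFDerivAt (moment Ω F G d H a b r s)
      (dirSum (momentDeriv (moment Ω F G d H) a b r s p)) p := by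
  have hf : HasFDerivAt (fun p => Ω.toL2 (fFam d F a r p)) (dirSum fun ℓ i =>
      if i = a then (1 : ℝ) • Ω.toL2 (fFam d F a (r + ℓ + 1) p) else 0) p :=
    hasFDerivAt_expFamily (Or.inl rfl) hV (memLp_f_base hH a) hp r
  have hg : HasFDerivAt (fun p => Ω.toL2 (gFam Ω d G b s p)) (dirSum fun ℓ i =>
      if i = b then (-1 : ℝ) • Ω.toL2 (gFam Ω d G b (s + ℓ + 1) p) else 0) p :=
    hasFDerivAt_expFamily (Or.inr rfl) hV (memLp_g_base hH b) hp s
  have hR := hasFDerivAt_resolvent hV hH hp (hinv p hp)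
  let ev : (Ω.L2 →L[ℂ] Ω.L2) →L[ℝ] Ω.L2 →L[ℝ] Ω.L2 :=
    (ContinuousLinearMap.id ℂ (Ω.L2 →L[ℂ] Ω.L2)).bilinearRestrictScalars ℝ
  have h1 := ev.hasFDerivAt_of_bilinear hR hf
  have h2 := (Ω.pairing.bilinearRestrictScalars ℝ).hasFDerivAt_of_bilinear hg h1
  refine h2.congr_fderiv ((eq_dirSum _).trans
    (congrArg dirSum (funext fun ℓ => funext fun i => ?_)))
  change Ω.pairing (Ω.toL2 (gFam Ω d G b s p))
      (Ring.inverse (1 - H p) (dirSum (fun (ℓ : Fin 3) i =>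
        if i = a then (1 : ℝ) • Ω.toL2 (fFam d F a (r + ℓ + 1) p) else 0) (paramDir ℓ i)) +
      dirSum (fun ℓ i => Ring.inverse (1 - H p) * derivOp Ω F G d p ℓ i *
        Ring.inverse (1 - H p)) (paramDir ℓ i) (Ω.toL2 (fFam d F a r p))) +
    Ω.pairing (dirSum (fun (ℓ : Fin 3) i =>
      if i = b then (-1 : ℝ) • Ω.toL2 (gFam Ω d G b (s + ℓ + 1) p) else 0) (paramDir ℓ i))
      (Ring.inverse (1 - H p) (Ω.toL2 (fFam d F a r p))) = _
  rw [dirSum_paramDir, dirSum_paramDir, dirSum_paramDir, momentDeriv, map_add]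
  have e1 : Ω.pairing (Ω.toL2 (gFam Ω d G b s p)) (Ring.inverse (1 - H p)
      (if i = a then (1 : ℝ) • Ω.toL2 (fFam d F a (r + ℓ + 1) p) else 0)) =
      if i = a then moment Ω F G d H a b (r + ℓ + 1) s p else 0 := by
    split_ifs
    · rw [one_smul]; rfl
    · rw [map_zero, map_zero]
  have e2 : Ω.pairing (if i = b then (-1 : ℝ) • Ω.toL2 (gFam Ω d G b (s + ℓ + 1) p) else 0)
      (Ring.inverse (1 - H p) (Ω.toL2 (fFam d F a r p))) =
      -(if i = b then moment Ω F G d H a b r (s + ℓ + 1) p else 0) := by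
    split_ifs
    · rw [neg_smul, one_smul, map_neg]; rfl
    · rw [map_zero, neg_zero]; rfl
  have e3 : Ω.pairing (Ω.toL2 (gFam Ω d G b s p)) ((Ring.inverse (1 - H p) *
      derivOp Ω F G d p ℓ i * Ring.inverse (1 - H p)) (Ω.toL2 (fFam d F a r p))) =
      ∑ x ∈ antidiagonal (ℓ : ℕ), moment Ω F G d H a i r x.1 p * moment Ω F G d H i b x.2 s p := by
    change Ω.pairing (Ω.toL2 (gFam Ω d G b s p)) (Ring.inverse (1 - H p)
      (derivOp Ω F G d p ℓ i (Ring.inverse (1 - H p) (Ω.toL2 (fFam d F a r p))))) = _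
    rw [derivOp, sum_apply, map_sum, map_sum]
    refine Finset.sum_congr rfl fun x _ => ?_
    rw [ContinuousLinearMap.smulRight_apply, map_smul, map_smul]
    rfl
  rw [e1, e2, e3]
  ring

/-- The moments are smooth functions of the parameters. -/
theorem contDiffOn_moment (hV : IsOpen V)
    (hH : ∀ p ∈ V, IsCubicIntegrable Ω F G d p (H p)) (hinv : ∀ p ∈ V, IsUnit (1 - H p))
    (a b : Fin m) (r s : ℕ) : ContDiffOn ℝ ∞ (moment Ω F G d H a b r s) V := by
  have hd := fun (a b : Fin m) (r s : ℕ) (p : Params m) (hp : p ∈ V) =>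
    hasFDerivAt_moment hV hH hinv hp a b r s
  refine contDiffOn_infty.mpr fun N => ?_
  -- Bootstrap: the derivative of each moment is a polynomial in moments with other indices, so if
  -- all of them are C^N they are all C^{N+1}.
  induction N generalizing a b r s with
  | zero =>
    exact contDiffOn_zero.mpr fun p hp => (hd a b r s p hp).continuousAt.continuousWithinAt
  | succ N ih =>
    rw [Nat.cast_succ, contDiffOn_succ_iff_fderiv_of_isOpen hV]
    refine ⟨fun p hp => (hd a b r s p hp).differentiableAt.differentiableWithinAt,
      fun h => absurd h (by simp), ?_⟩
    have h : ContDiffOn ℝ N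
        (fun p => dirSum (momentDeriv (moment Ω F G d H) a b r s p)) V := by
      refine ContDiffOn.sum fun ℓ _ => ContDiffOn.sum fun i _ => ?_
      refine contDiffOn_const.smulRight ?_
      refine ContDiffOn.add (ContDiffOn.sub ?_ ?_) (ContDiffOn.sum fun x _ => (ih _ _ _ _).mul
        (ih _ _ _ _))
      · split_ifs
        · exact ih _ _ _ _
        · exact contDiffOn_const
      · split_ifs
        · exact ih _ _ _ _
        · exact contDiffOn_const
    exact h.congr fun p hp => (hd a b r s p hp).fderiv

end Cubic

end CubicKP

namespace CubicKP

/-! ### Independence of the scalar c -/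

section Gauge

variable {m : ℕ} {Ω : Locus} {F G : ℂ → Fin (m + 1) → ℂ}

/-- Changing the scalar `d` to `c` conjugates the resolvent by multiplication with `c / d`. -/
theorem resolvent_gauge {c d : ℂ → ℂ} {p : Params m} {Hc Hd : Ω.L2 →L[ℂ] Ω.L2}
    (hc : IsCubicIntegrable Ω F G c p Hc) (hd : IsCubicIntegrable Ω F G d p Hd)
    (ic : IsUnit (1 - Hc)) (id : IsUnit (1 - Hd)) {C : ℝ}
    (hC : ∀ u ∈ Ω.carrier, ‖c u‖ ≤ C * ‖d u‖) (a : Fin (m + 1)) :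
    ∀ᵐ u ∂Ω.measure, Ring.inverse (1 - Hc) (Ω.toL2 fun v => vecf c F p v a) u * d u =
      Ring.inverse (1 - Hd) (Ω.toL2 fun v => vecf d F p v a) u * c u := by
  set x : Ω.L2 := Ring.inverse (1 - Hd) (Ω.toL2 fun v => vecf d F p v a) with hx
  have hxd : x - Hd x = Ω.toL2 fun v => vecf d F p v a := by
    change ((1 - Hd) * Ring.inverse (1 - Hd)) (Ω.toL2 fun v => vecf d F p v a) = _
    rw [Ring.mul_inverse_cancel _ id]
    rfl
  -- Boundedness of c/d is needed only here: it keeps the candidate solution in L², so no inverse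
  -- multiplication operator is required.
  have hy : MemLp (fun u => c u / d u * x u) 2 Ω.measure := by
    refine ((Lp.memLp x).norm.const_mul C).mono'
      ((hc.c_measurable.div₀ hd.c_measurable).mul (Lp.memLp x).1) ?_
    filter_upwards [Ω.ae_mem_carrier] with u hu
    rw [norm_mul, norm_div]
    refine mul_le_mul_of_nonneg_right ?_ (norm_nonneg _)
    rw [div_le_iff₀ (norm_pos_iff.mpr (hd.c_ne_zero u hu))]
    exact hC u hu
  set y : Ω.L2 := Ω.toL2 fun u => c u / d u * x u with hydef
  have hya : ∀ᵐ u ∂Ω.measure, y u = c u / d u * x u := Ω.coeFn_toL2 hy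
  -- The truncated integrals for the two kernels differ exactly by the factor c(u)/d(u), so their
  -- principal values do too.
  have hHy : ∀ᵐ u ∂Ω.measure, Hc y u = c u / d u * Hd x u := by
    filter_upwards [hc.hasKernel y, hd.hasKernel x, Ω.ae_mem_carrier] with u h1 h2 hu
    refine tendsto_nhds_unique h1 ((h2.const_mul (c u / d u)).congr fun ε => ?_)
    rw [← integral_const_mul]
    refine integral_congr_ae (ae_restrict_of_ae ?_)
    filter_upwards [hya, Ω.ae_mem_carrier] with v hv hvc
    have hdu := hd.c_ne_zero u hu
    have hdv := hd.c_ne_zero v hvc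
    have hcv := hc.c_ne_zero v hvc
    have hk : iiksKernel (vecf c F p) (vecg c G p) u v * (c v / d v) =
        c u / d u * iiksKernel (vecf d F p) (vecg d G p) u v := by
      have hs : (∑ b, vecf c F p u b * vecg c G p v b) * (c v / d v) =
          c u / d u * ∑ b, vecf d F p u b * vecg d G p v b := by
        rw [Finset.sum_mul, Finset.mul_sum]
        refine Finset.sum_congr rfl fun b _ => ?_
        simp only [vecf, vecg]
        field_simp
      rw [iiksKernel_eq, iiksKernel_eq, div_mul_eq_mul_div, hs, mul_div_assoc]
    rw [hv]
    linear_combination -(x v * Ω.density v) * hk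
  have hyc : y - Hc y = Ω.toL2 fun v => vecf c F p v a := by
    refine Lp.ext ?_
    have h0 : ∀ᵐ u ∂Ω.measure, x u - Hd x u = vecf d F p u a := by
      filter_upwards [Lp.coeFn_sub x (Hd x), Ω.coeFn_toL2 (hd.f_memL2 a)] with u h1 h2
      rw [← h2, ← hxd, h1, Pi.sub_apply]
    filter_upwards [Lp.coeFn_sub y (Hc y), hya, hHy, Ω.coeFn_toL2 (hc.f_memL2 a), h0,
      Ω.ae_mem_carrier] with u h1 h2 h3 h4 h5 hu
    have hdu := hd.c_ne_zero u hu
    rw [h1, Pi.sub_apply, h2, h3, h4, ← mul_sub, h5, vecf, vecf]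
    field_simp
  have hyL : Ring.inverse (1 - Hc) (Ω.toL2 fun v => vecf c F p v a) = y := by
    rw [← hyc]
    change (Ring.inverse (1 - Hc) * (1 - Hc)) y = y
    rw [Ring.inverse_mul_cancel _ ic]
    rfl
  rw [hyL]
  filter_upwards [hya, Ω.ae_mem_carrier] with u h1 hu
  have hdu := hd.c_ne_zero u hu
  rw [h1]
  field_simp

/-- Near every parameter the entries of `Y_k` are given by smooth moments. -/
theorem exists_local_moments {c : Params m → ℂ → ℂ} {U : Set (Params m)} (hU : IsOpen U)
    {H : Params m → Ω.L2 →L[ℂ] Ω.L2} (hH : ∀ p ∈ U, IsCubicIntegrable Ω F G (c p) p (H p))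
    (hinv : ∀ p ∈ U, IsUnit (1 - H p)) (hc : ScalarRegular Ω F G c U) {p₀ : Params m}
    (hp₀ : p₀ ∈ U) :
    ∃ V : Set (Params m), IsOpen V ∧ p₀ ∈ V ∧ V ⊆ U ∧
      ∃ M : Fin m → Fin m → ℕ → ℕ → Params m → ℂ,
        (∀ a b r s, ContDiffOn ℝ ∞ (M a b r s) V) ∧
        (∀ a b r s, ∀ p ∈ V, HasFDerivAt (M a b r s) (dirSum (momentDeriv M a b r s p)) p) ∧
        ∀ k, ∀ p ∈ V, ∀ a b : Fin m,
          Integrable (integrandY Ω F G c H k p a.castSucc b.castSucc) Ω.measure ∧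
          matY Ω F G c H k p a.castSucc b.castSucc = M a b 0 (k - 1) p := by
  obtain ⟨W, hW, d, hWd⟩ := hc p₀ hp₀
  choose! Hd hHd hHdinv using fun p hp => (hWd p hp).1
  have hcomp := fun p hp => (hWd p hp).2
  have hV : IsOpen (interior W ∩ U) := isOpen_interior.inter hU
  have hVW : ∀ p ∈ interior W ∩ U, p ∈ W := fun p hp => interior_subset hp.1
  have hHV : ∀ p ∈ interior W ∩ U, IsCubicIntegrable Ω F G d p (Hd p) :=
    fun p hp => hHd p (hVW p hp)
  have hIV : ∀ p ∈ interior W ∩ U, IsUnit (1 - Hd p) := fun p hp => hHdinv p (hVW p hp)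
  refine ⟨interior W ∩ U, hV, ⟨mem_interior_iff_mem_nhds.mpr hW, hp₀⟩, inter_subset_right,
    moment Ω F G d Hd, fun a b r s => contDiffOn_moment hV hHV hIV a b r s,
    fun a b r s p hp => hasFDerivAt_moment hV hHV hIV hp a b r s, fun k p hp a b => ?_⟩
  have hf0 : fFam d F a 0 p = fun u => vecf d F p u a.castSucc := by
    funext u
    rw [fFam_eq, pow_zero, one_mul]
  set z : Ω.L2 := Ring.inverse (1 - Hd p) (Ω.toL2 (fFam d F a 0 p)) with hz
  have hgauge : ∀ᵐ u ∂Ω.measure,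
      Ring.inverse (1 - H p) (Ω.toL2 fun v => vecf (c p) F p v a.castSucc) u * d u =
        z u * c p u := by
    rw [hz, hf0]
    -- The relation is symmetric in c and d, so a bound on either quotient suffices.
    rcases hcomp p (hVW p hp) with ⟨C, hC⟩ | ⟨C, hC⟩
    · filter_upwards [resolvent_gauge (hHV p hp) (hH p hp.2) (hIV p hp) (hinv p hp.2) hC
        a.castSucc] with u hu
      exact hu.symm
    · exact resolvent_gauge (hH p hp.2) (hHV p hp) (hinv p hp.2) (hIV p hp) hC a.castSucc
  have hae : (fun u => gFam Ω d G b (k - 1) p u * z u) =ᵐ[Ω.measure]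
      integrandY Ω F G c H k p a.castSucc b.castSucc := by
    filter_upwards [hgauge, Ω.ae_mem_carrier] with u h1 hu
    have hdu := (hHV p hp).c_ne_zero u hu
    have hcu := (hH p hp.2).c_ne_zero u hu
    -- As g carries the inverse scalar, the integrand of Y_k is the same for c and d, which also
    -- gives its absolute convergence.
    have h2 : Ring.inverse (1 - H p) (Ω.toL2 fun v => vecf (c p) F p v a.castSucc) u *
        (c p u)⁻¹ = z u * (d u)⁻¹ := by
      field_simp
      exact h1.trans (mul_comm _ _)
    rw [gFam_eq, integrandY, vecg, vecg]
    linear_combination -(u ^ (k - 1) * (dressing p u b.castSucc)⁻¹ * G u b.castSucc *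
      Ω.density u) * h2
  have hint : Integrable (fun u => gFam Ω d G b (k - 1) p u * z u) Ω.measure :=
    (memLp_gFam hV hHV hp b (k - 1)).integrable_mul (Lp.memLp z)
  refine ⟨hint.congr hae, ?_⟩
  rw [moment, Ω.pairing_toL2 (memLp_gFam hV hHV hp b (k - 1)), matY, Matrix.of_apply]
  exact (integral_congr_ae hae).symm

end Gauge

end CubicKP

end

/-! ### Patching the local statements -/

open CubicKP in
theorem mainTheorem10 (m n : ℕ) (hn1 : 1 ≤ n) (hn : n ≤ m) (Ω : Locus)
    (F G : ℂ → Fin (m + 1) → ℂ) (c : Params m → ℂ → ℂ)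
    (U : Set (Params m)) (hU : IsOpen U) (H : Params m → Ω.L2 →L[ℂ] Ω.L2)
    (hH : ∀ p ∈ U, IsCubicIntegrable Ω F G (c p) p (H p))
    (hinv : ∀ p ∈ U, IsUnit (1 - H p))
    (hc : ScalarRegular Ω F G c U) :
    -- the integrals defining the blocks `q_k` converge absolutely and `q_k` is smooth on `U`
    (∀ k : ℕ, 1 ≤ k → ∀ p ∈ U, ∀ i j : Fin n,
      MeasureTheory.Integrable (integrandY Ω F G c H k p (blockIdx hn i) (blockIdx hn j))
        Ω.measure) ∧
    (∀ k : ℕ, 1 ≤ k → SmoothMatOn U (matq hn Ω F G c H k)) ∧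
    -- the operator `P = I + ∑ q_k ∂^(-k)` is invertible
    (∃ Q : PseudoDiffOp hn,
      PseudoDiffOp.IsInverseOn U (PseudoDiffOp.ofSeq (matq hn Ω F G c H)) Q) ∧
    ∀ P Q : PseudoDiffOp hn, P = PseudoDiffOp.ofSeq (matq hn Ω F G c H) →
      PseudoDiffOp.IsInverseOn U P Q →
      -- the Sato equations
      (∀ (ℓ : Fin 3) (i : Fin n),
        PseudoDiffOp.EqOn U (P.paramDeriv ℓ i)
          (PseudoDiffOp.laxOp P Q ℓ i * P - P * PseudoDiffOp.unitPow ℓ i)) ∧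
      -- the Zakharov–Shabat equations
      ∀ (ℓ ℓ' : Fin 3) (i j : Fin n),
        PseudoDiffOp.EqOn U
          ((PseudoDiffOp.laxOp P Q ℓ i).paramDeriv ℓ' j
            - (PseudoDiffOp.laxOp P Q ℓ' j).paramDeriv ℓ i)
          (PseudoDiffOp.laxOp P Q ℓ' j * PseudoDiffOp.laxOp P Q ℓ i
            - PseudoDiffOp.laxOp P Q ℓ i * PseudoDiffOp.laxOp P Q ℓ' j) := by
  choose! V hV hpV hVU M hM hMd hMY using
    fun p (hp : p ∈ U) => exists_local_moments hU hH hinv hc hp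
  -- The index k = 0 does no harm: truncated subtraction makes its integrand that of k = 1, and
  -- `ofSeq` never reads it.
  have hsmooth : ∀ k : ℕ, SmoothMatOn U (matq hn Ω F G c H k) := by
    intro k i j p hp
    have h : ContDiffAt ℝ ∞ (M p (Fin.castLE hn i) (Fin.castLE hn j) 0 (k - 1)) p :=
      (hM p hp _ _ _ _).contDiffAt ((hV p hp).mem_nhds (hpV p hp))
    refine (h.congr_of_eventuallyEq ?_).contDiffWithinAt
    filter_upwards [(hV p hp).mem_nhds (hpV p hp)] with q hq
    exact (hMY p hp k q hq _ _).2
  refine ⟨fun k _ p hp i j => (hMY p hp k p (hpV p hp) _ _).1, fun k _ => hsmooth k,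
    PseudoDiffOp.exists_isInverseOn hU _ fun k _ => hsmooth k, fun P Q hP hPQ => ?_⟩
  -- The double sequence of moments depends on the local scalar, but its row 0 is the global q. An
  -- inverse on U is also one on the smaller neighbourhood, where the equations are proved and then
  -- read off at p.
  have key := fun p (hp : p ∈ U) => PseudoDiffOp.equations_of_moments (hn := hn) (hV p hp)
    (fun r s q => Matrix.of fun i j => M p (Fin.castLE hn i) (Fin.castLE hn j) r s q)
    (fun r s i j => hM p hp _ _ _ _)
    (fun ℓ i r s q hq => by
      ext a b
      have h := (hMd p hp (Fin.castLE hn a) (Fin.castLE hn b) r s q hq).hasLineDerivAt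
        (paramDir ℓ (Fin.castLE hn i))
      rw [dirSum_paramDir] at h
      refine h.lineDeriv.trans ?_
      have hinj : ∀ a : Fin n, (Fin.castLE hn i = Fin.castLE hn a) ↔ i = a := fun a =>
        (Fin.castLE_injective hn).eq_iff
      rw [momentDeriv, Matrix.add_apply, Matrix.sub_apply, Matrix.sum_apply]
      simp only [hinj]
      congr 1
      · congr 1
        · by_cases h : i = a
          · subst h; simp
          · simp [h, Matrix.single_mul_apply_of_ne, Ne.symm h]
        · by_cases h : i = b
          · subst h; simp
          · simp [h, Matrix.mul_single_apply_of_ne, Ne.symm h]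
      · refine Finset.sum_congr rfl fun x _ => ?_
        rw [Matrix.mul_apply, Finset.sum_eq_single i]
        · simp
        · intro j _ hj
          simp [Matrix.mul_single_apply_of_ne, hj]
        · simp)
    (q := matq hn Ω F G c H)
    (fun s q hq => by
      ext i j
      exact (hMY p hp (s + 1) q hq _ _).2)
    hP ⟨fun k => (hPQ.1 k).mono (hVU p hp), fun k q hq => hPQ.2.1 k q (hVU p hp hq),
      fun k q hq => hPQ.2.2 k q (hVU p hp hq)⟩
  exact ⟨fun ℓ i k p hp => (key p hp).1 ℓ i k p (hpV p hp),
    fun ℓ ℓ' i j k p hp => (key p hp).2 ℓ ℓ' i j k p (hpV p hp)⟩
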